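/- **Theorem.** Work over $\mathbb C$, with homogeneous coordinates $(x_1:x_2:x_3)\times(y_1:y_2:y_3)$ on $\mathbb P^2\times\mathbb P^2$. Let $u_1=(1:0:0)$, $u_2=(0:1:0)$, $u_3=(0:0:1)$, $u_4=(1:1:1)$, let $O_4=\{(u_i,u_i)\}_{1\le i\le 4}\subset\mathbb P^2\times\mathbb P^2$, and let $\mathcal I$ be the ideal sheaf of $O_4$. Let $V^{ram}\subset\mathbb P^2\times\mathbb P^2$ be the threefold of bidegree $(2,2)$ $$(x_1-x_2)x_3\,y_1(y_2-y_3)\;-\;x_1(x_2-x_3)\,(y_1-y_2)y_3=0 .$$ (a) $V^{ram}$ has exactly $19$ singular points, and all of them are ordinary double points. (b) $V^{ram}$ is attached to a Morin configuration of $20$ planes in $\mathbb P^5=\mathbb P(W)$. Precisely: there are a Lagrangian subspace $A\subset\wedge^3W$ (for the wedge pairing $\wedge^3W\times\wedge^3W\to\wedge^6W$) and a plane $P_u=\mathbb P(U)$, with $A\subset U\wedge W\wedge W$ and $A\cap(U\wedge U\wedge W)=\wedge^3U$, such that the set $F$ of the planes whose Plücker point lies in $\mathbb P(A)$ has exactly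 $20$ elements, $P_u\in F$, $\mathbb P(A)$ is the linear span of $F$, and $F$ is a complete reduced scheme of incident planes: $F=\bigcap_{Q\in F}\{P: P\cap Q\neq\emptyset\}$ as schemes. Moreover, for suitable coordinates on $P_u$ and on the net $P_u^\perp=\mathbb P(\wedge^2(W/U))$ of hyperplanes through $P_u$, $V^{ram}$ is the threefold $V_A\subset P_u\times P_u^\perp$ defined by the form of bidegree $(2,2)$ whose value at $(x,\,v\wedge w \bmod U)$ is $x\wedge v\wedge w\wedge a\in\wedge^6W\cong\mathbb C$, for any $a\in A$ with $a\equiv x\wedge v\wedge w$ modulo $U\wedge U\wedge W$. (c) $\dim H^0(\mathcal I(1,1))=5$, and the rational map $\phi:\mathbb P^2\times\mathbb P^2\dashrightarrow\mathbb P^4$ defined by $|\mathcal I(1,1)|$ has degree $2$, that is, its fibre over a general point of $\mathbb P^4$ consists of exactly two points. (d) $V^{ram}$ is the ramification divisor of $\phi$, that is, the divisor of the Jacobian determinant of $\phi$, with multiplicities (defined outside the base locus of $\phi$). (e) The image $\phi(V^{ram})$ (the Zariski closure of the image of the points of $V^{ram}$ at which $\phi$ is defined) is the Igusa quartic: it is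 an irreducible quartic hypersurface of $\mathbb P^4$, and it is the dual variety of a Segre cubic, that is, of a cubic threefold in $\mathbb P^4$ whose singular locus consists of ten ordinary double points. -/

import Mathlib

open MvPolynomial
open scoped LinearAlgebra.Projectivization

noncomputable section

/-! ## Forms on `ℙ² × ℙ²` -/

/-- Bihomogeneous coordinates on `ℙ² × ℙ²`: the `x`-coordinates are `X (Sum.inl i)`,
the `y`-coordinates are `X (Sum.inr j)`. -/
abbrev BiPoly := MvPolynomial (Fin 3 ⊕ Fin 3) ℂ

abbrev P2 := ℙ ℂ (Fin 3 → ℂ)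

abbrev P4 := ℙ ℂ (Fin 5 → ℂ)

/-- The space of forms of bidegree `(a, b)`. -/
def biForms (a b : ℕ) : Submodule ℂ BiPoly :=
  weightedHomogeneousSubmodule ℂ
    (Sum.elim (fun _ => ((1, 0) : ℕ × ℕ)) (fun _ => ((0, 1) : ℕ × ℕ))) (a, b)

/-- Chosen homogeneous coordinates of a point of `ℙ² × ℙ²`. -/
def coords (p : P2 × P2) : Fin 3 ⊕ Fin 3 → ℂ := Sum.elim p.1.rep p.2.rep

/-- Four points of `ℙ²` in general position: the coordinate points and `(1 : 1 : 1)`. -/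
def fourPts : Fin 4 → Fin 3 → ℂ := ![![1, 0, 0], ![0, 1, 0], ![0, 0, 1], ![1, 1, 1]]

/-- `H⁰(𝓘(1,1))`: the forms of bidegree `(1, 1)` vanishing at the set `O₄` of the four points
`(uᵢ, uᵢ)` of `ℙ² × ℙ²`. -/
def formsThroughO4 : Submodule ℂ BiPoly :=
  biForms 1 1 ⊓ ⨅ k : Fin 4,
    LinearMap.ker (aeval (R := ℂ) (Sum.elim (fourPts k) (fourPts k))).toLinearMap

/-- The equation of `V^ram`:
`(x₁ - x₂) x₃ y₁ (y₂ - y₃) - x₁ (x₂ - x₃) (y₁ - y₂) y₃`. -/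
def vRam : BiPoly :=
  let x : Fin 3 → BiPoly := fun i => X (Sum.inl i)
  let y : Fin 3 → BiPoly := fun j => X (Sum.inr j)
  (x 0 - x 1) * x 2 * (y 0 * (y 1 - y 2)) - x 0 * (x 1 - x 2) * ((y 0 - y 1) * y 2)

/-! ## Singular points and nodes -/

/-- The Hessian matrix of a polynomial at a vector. -/
def hessianAt {σ : Type} (f : MvPolynomial σ ℂ) (v : σ → ℂ) : Matrix σ σ ℂ :=
  Matrix.of fun i j => eval v (pderiv i (pderiv j f))

/-- The singular points of the hypersurface of `ℙ² × ℙ²` defined by a bihomogeneous form of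
positive bidegree. -/
def biSing (f : BiPoly) : Set (P2 × P2) := {p | ∀ s, eval (coords p) (pderiv s f) = 0}

/-- A singular point `(x, y)` is an ordinary double point: the Hessian, whose kernel always contains
the two vectors `(x, 0)` and `(0, y)`, is nondegenerate on the 4-dimensional quotient
by them, which is the tangent space of `ℙ² × ℙ²`. -/
def IsBiNode (f : BiPoly) (p : P2 × P2) : Prop :=
  p ∈ biSing f ∧ (hessianAt f (coords p)).rank = 4

/-- The singular points of the hypersurface of `ℙ⁴` defined by a form of positive degree. -/
def singPts (g : MvPolynomial (Fin 5) ℂ) : Set P4 := {p | ∀ i, eval p.rep (pderiv i g) = 0}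

/-- Ordinary double points of a hypersurface of degree at least two of `ℙ⁴`: the Hessian at a
singular point `v` always has `v` in its kernel, and it is nondegenerate on the quotient by it. -/
def IsNode (g : MvPolynomial (Fin 5) ℂ) (p : P4) : Prop :=
  p ∈ singPts g ∧ (hessianAt g p.rep).rank = 4

/-! ## The rational map `φ` -/

/-- Values of five forms at a point of `ℙ² × ℙ²`. -/
def phiVec (b : Fin 5 → BiPoly) (p : P2 × P2) : Fin 5 → ℂ := fun k => eval (coords p) (b k)

/-- The graph of the rational map `ℙ² × ℙ² ⇢ ℙ⁴` given by five forms of the same bidegree: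
`p` is not a base point and it is mapped to `q`. -/
def PhiMaps (b : Fin 5 → BiPoly) (p : P2 × P2) (q : P4) : Prop :=
  ∃ h : phiVec b p ≠ 0, Projectivization.mk ℂ (phiVec b p) h = q

/-- The rational map is dominant of degree two: over a nonempty Zariski open set of `ℙ⁴`, every
fibre consists of exactly two points. -/
def HasDegreeTwo (b : Fin 5 → BiPoly) : Prop :=
  ∃ (n : ℕ) (h : MvPolynomial (Fin 5) ℂ), h.IsHomogeneous n ∧ h ≠ 0 ∧
    ∀ q : P4, eval q.rep h ≠ 0 → {p | PhiMaps b p q}.ncard = 2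

/-- Dehomogenization on the affine chart `xᵢ = 1`, `yⱼ = 1` of `ℙ² × ℙ²`, a copy of `𝔸⁴`. -/
def dehom (i j : Fin 3) : BiPoly →ₐ[ℂ] MvPolynomial (Fin 2 ⊕ Fin 2) ℂ :=
  aeval (Sum.elim
    (i.insertNth (α := fun _ => MvPolynomial (Fin 2 ⊕ Fin 2) ℂ) 1 (fun m => X (Sum.inl m)))
    (j.insertNth (α := fun _ => MvPolynomial (Fin 2 ⊕ Fin 2) ℂ) 1 (fun m => X (Sum.inr m))))

/-- Let `β` be the dehomogenized forms on the chart `xᵢ = 1`, `yⱼ = 1`. On the part `β k ≠ 0` of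
the chart the map is given by the four functions `β l / β k`, `l ≠ k`, of the four coordinates.
Up to the unit `(β k) ^ 8` its Jacobian determinant is this polynomial, by the quotient rule. -/
def jacobianNumerator (b : Fin 5 → BiPoly) (i j : Fin 3) (k : Fin 5) :
    MvPolynomial (Fin 2 ⊕ Fin 2) ℂ :=
  (Matrix.of fun m l : Fin 2 ⊕ Fin 2 =>
    pderiv m (dehom i j (b (k.succAbove (finSumFinEquiv l)))) * dehom i j (b k) -
      dehom i j (b (k.succAbove (finSumFinEquiv l))) * pderiv m (dehom i j (b k))).det

/-- The ramification divisor of the rational map is the divisor of the bihomogeneous form `f`,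
with multiplicities: on each of the affine open sets `xᵢ ≠ 0, yⱼ ≠ 0, bₖ ≠ 0`, which cover the
complement of the base locus, the Jacobian determinant equals the local equation of
`f` up to a unit of the coordinate ring. -/
def IsRamificationDivisor (b : Fin 5 → BiPoly) (f : BiPoly) : Prop :=
  f ≠ 0 ∧ ∀ (i j : Fin 3) (k : Fin 5),
    Associated
      (algebraMap _ (Localization.Away (dehom i j (b k))) (jacobianNumerator b i j k))
      (algebraMap _ (Localization.Away (dehom i j (b k))) (dehom i j f))

/-! ## Closures, hypersurfaces and duals in `ℙ⁴` -/

/-- The Zariski closure of a subset of `ℙ⁴`. -/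
def zariskiClosure (S : Set P4) : Set P4 :=
  {q | ∀ (n : ℕ) (F : MvPolynomial (Fin 5) ℂ), F.IsHomogeneous n →
    (∀ p ∈ S, eval p.rep F = 0) → eval q.rep F = 0}

/-- The image under the rational map of the hypersurface `f = 0` of `ℙ² × ℙ²`, that is, the Zariski
closure of the image of its points that are not base points. -/
def imageOfHypersurface (b : Fin 5 → BiPoly) (f : BiPoly) : Set P4 :=
  zariskiClosure {q | ∃ p, eval (coords p) f = 0 ∧ PhiMaps b p q}

/-- The gradient of `g` at a vector. -/
def gradAt (g : MvPolynomial (Fin 5) ℂ) (v : Fin 5 → ℂ) : Fin 5 → ℂ := fun i => eval v (pderiv i g)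

/-- The dual variety of the hypersurface `g = 0` of `ℙ⁴`: the Zariski closure of the set of its
tangent hyperplanes at smooth points, a hyperplane `∑ aᵢ zᵢ = 0` being the point `[a]` of the dual
space. -/
def dualVariety (g : MvPolynomial (Fin 5) ℂ) : Set P4 :=
  zariskiClosure {q | ∃ p : P4, eval p.rep g = 0 ∧
    ∃ h : gradAt g p.rep ≠ 0, Projectivization.mk ℂ (gradAt g p.rep) h = q}

/-- A Segre cubic (Segre primal): a cubic hypersurface of `ℙ⁴` whose singular locus consists of ten
ordinary double points. -/
def IsSegrePrimal (g : MvPolynomial (Fin 5) ℂ) : Prop :=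
  g.IsHomogeneous 3 ∧ (singPts g).ncard = 10 ∧ ∀ p ∈ singPts g, IsNode g p

/-- A set of points of `ℙ⁴` is an Igusa quartic: it is an irreducible quartic hypersurface and it
is the dual of a Segre cubic. -/
def IsIgusaQuartic (S : Set P4) : Prop :=
  (∃ h : MvPolynomial (Fin 5) ℂ, h.IsHomogeneous 4 ∧ Irreducible h ∧
    S = {q | eval q.rep h = 0}) ∧
  ∃ g : MvPolynomial (Fin 5) ℂ, IsSegrePrimal g ∧ S = dualVariety g

/-! ## Morin configurations of planes in `ℙ⁵ = ℙ(W)` and their `V`-threefolds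

Planes of `ℙ⁵` are 3-dimensional subspaces of `W = ℂ⁶`, and `⋀³ W` lies in the exterior algebra. -/

abbrev W6 := Fin 6 → ℂ

/-- `p ∧ q ∧ r`. -/
def wedge3 (p q r : W6) : ExteriorAlgebra ℂ W6 :=
  ExteriorAlgebra.ι ℂ p * ExteriorAlgebra.ι ℂ q * ExteriorAlgebra.ι ℂ r

/-- A fixed plane `P_u = ℙ(U)`, with `U` spanned by the first three basis vectors. -/
def planeU : Submodule ℂ W6 := Submodule.span ℂ {Pi.single 0 1, Pi.single 1 1, Pi.single 2 1}

/-- `U ∧ W ∧ W`. -/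
def filt1 : Submodule ℂ (ExteriorAlgebra ℂ W6) :=
  Submodule.span ℂ {e | ∃ p ∈ planeU, ∃ q r, e = wedge3 p q r}

/-- `U ∧ U ∧ W`. -/
def filt2 : Submodule ℂ (ExteriorAlgebra ℂ W6) :=
  Submodule.span ℂ {e | ∃ p ∈ planeU, ∃ q ∈ planeU, ∃ r, e = wedge3 p q r}

/-- `U ∧ U ∧ U`. -/
def filt3 : Submodule ℂ (ExteriorAlgebra ℂ W6) :=
  Submodule.span ℂ {e | ∃ p ∈ planeU, ∃ q ∈ planeU, ∃ r ∈ planeU, e = wedge3 p q r}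

/-- `A` is a Lagrangian subspace of `⋀³ W` for the wedge pairing `⋀³ W × ⋀³ W → ⋀⁶ W`. -/
def IsLagrangian (A : Submodule ℂ (ExteriorAlgebra ℂ W6)) : Prop :=
  A ≤ ⋀[ℂ]^3 W6 ∧ Module.finrank ℂ A = 10 ∧ ∀ a ∈ A, ∀ b ∈ A, a * b = 0

/-- The planes whose Plücker point lies in `ℙ(A)`. -/
def planesIn (A : Submodule ℂ (ExteriorAlgebra ℂ W6)) : Set (Submodule ℂ W6) :=
  {P | Module.finrank ℂ P = 3 ∧ ∀ p ∈ P, ∀ q ∈ P, ∀ r ∈ P, wedge3 p q r ∈ A}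

/-- A finite reduced Morin configuration of planes: as a scheme, `F` is the
intersection of the Schubert divisors `σ_Q` (the planes that meet `Q`), `Q ∈ F`.
The second clause is the equality of points. The third one says that this intersection has zero
tangent space at each `P ∈ F`: tangent vectors of the Grassmannian at `P` are linear maps
`P → W / P`, here lifted to maps `τ` to `W`, and such a vector is tangent to `σ_Q` when the
derivative of the Plücker equation `(p₁ ∧ p₂ ∧ p₃) ∧ (q₁ ∧ q₂ ∧ q₃) = 0` vanishes along it. -/
def IsFiniteMorinConfiguration (F : Set (Submodule ℂ W6)) : Prop :=
  F.Finite ∧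
  (∀ P : Submodule ℂ W6, P ∈ F ↔ Module.finrank ℂ P = 3 ∧ ∀ Q ∈ F, P ⊓ Q ≠ ⊥) ∧
  ∀ P ∈ F, ∀ τ : P →ₗ[ℂ] W6,
    (∀ Q ∈ F, ∀ p₁ p₂ p₃ : P, ∀ q₁ ∈ Q, ∀ q₂ ∈ Q, ∀ q₃ ∈ Q,
      (wedge3 (τ p₁) p₂ p₃ + wedge3 p₁ (τ p₂) p₃ + wedge3 p₁ p₂ (τ p₃)) * wedge3 q₁ q₂ q₃ = 0) →
    ∀ p : P, τ p ∈ P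

/-- The basis element of `⋀⁶ W`. -/
def volW : ExteriorAlgebra ℂ W6 :=
  wedge3 (Pi.single 0 1) (Pi.single 1 1) (Pi.single 2 1) *
    wedge3 (Pi.single 3 1) (Pi.single 4 1) (Pi.single 5 1)

/-- The `V`-threefold `V_A ⊂ P_u × P_u^⊥` of the pair `(A, u)` is `f = 0`. Here a point of `P_u`
is `[x]` with `x ∈ U`, and a point of `P_u^⊥ = ℙ(⋀² (W / U))`, a hyperplane through `P_u`, is given
by vectors `v, w` that span it together with `U`; its coordinates are those of `v ∧ w` mod `U`, the
cross product of the last three coordinates. If `a ∈ A` is congruent to `a₁ = x ∧ v ∧ w` modulo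
`U ∧ U ∧ W`, with difference `a₂`, then the section defining `V_A` takes the value
`a₁ ∧ a₂ = a₁ ∧ a` in `⋀⁶ W`. -/
def IsThreefoldOf (A : Submodule ℂ (ExteriorAlgebra ℂ W6)) (f : BiPoly) : Prop :=
  ∃ c : ℂ, c ≠ 0 ∧ ∀ x ∈ planeU, ∀ v w : W6, ∀ a ∈ A, a - wedge3 x v w ∈ filt2 →
    wedge3 x v w * a =
      (c * eval (Sum.elim (![x 0, x 1, x 2])
        (crossProduct ![v 3, v 4, v 5] ![w 3, w 4, w 5])) f) • volW

/-- The `V`-threefold `f = 0` is attached to a Morin configuration `F` of 20 planes containing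
`P_u`: the span of `F` is `ℙ(A)` with `A` Lagrangian, `F` consists of the
planes in `ℙ(A)`, it is reduced at `u`, and `V_A` is `f = 0`. -/
def IsAttachedTo20Planes (f : BiPoly) : Prop :=
  ∃ (A : Submodule ℂ (ExteriorAlgebra ℂ W6)) (F : Set (Submodule ℂ W6)),
    IsLagrangian A ∧ A ≤ filt1 ∧ A ⊓ filt2 = filt3 ∧
    F = planesIn A ∧ planeU ∈ F ∧ F.ncard = 20 ∧ IsFiniteMorinConfiguration F ∧
    A = Submodule.span ℂ {e | ∃ P ∈ F, ∃ p ∈ P, ∃ q ∈ P, ∃ r ∈ P, e = wedge3 p q r} ∧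
    IsThreefoldOf A f

end

noncomputable section

/-! ## Homogeneous coordinates -/

/-! The map. A bilinear form through the four points has no diagonal terms, and its six remaining
coefficients sum to zero. So a point of `ℙ⁴` records the six products `xᵢ yⱼ`, `i ≠ j`, up to a
common scalar and a common additive shift `t`. Since `(x₀y₁)(x₁y₂)(x₂y₀) = (x₀y₂)(x₂y₁)(x₁y₀)`, the
shift satisfies an equation between two products of three factors; the terms `t³` cancel and a
quadratic is left. Its two roots are the two points of a general fibre (`fibre_unique`,
`stdVec_fibre`). Its discriminant is a quartic, `igusaForm`, whose pullback is the square of the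
equation of `V^ram` (`eval_stdVec_igusaForm`). Hence `V^ram` maps onto the quartic up to closure,
and the Jacobian computation shows that it is the ramification divisor (`det_stdVec`). The quartic
is irreducible by Eisenstein. It is the dual of the Segre cubic because a double root of the fibre
equation is the same thing as a point of the cubic with a given gradient (`eval_gradAt_igusaForm`,
`exists_gradAt_eq_smul`). An arbitrary basis of forms differs from the standard one by an invertible
matrix, and everything is transported by linear substitution.

Nodes. The equation is `A(x) B(y) - B(x) A(y)` for a pencil of conics through the four points. Its
singular points are the 16 pairs of base points and the 3 pairs `(n, n)` with `n` the node of a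
singular conic of the pencil (`exists_vRamNode`).

Planes. The space `⋀³ W` splits into parts of dimensions 1, 9, 9, 1. The Lagrangian `lagA` is the
first part plus the graph of `polB`, a self-adjoint map between the two middle parts whose quadratic
form is twice the equation of `V^ram` on rank-one matrices. A plane in `ℙ(lagA)` meets `P_u`. If it
differs from `P_u`, it determines a singular point of `V^ram` (`vRamGrad_eq_zero`) and is determined
by it (`wedge3_eq_smul_nodeWedge`), so there are `1 + 19` planes. Their Plücker vectors span `lagA`,
which is its own orthogonal; so meeting all the planes means lying in `ℙ(lagA)`. Reducedness at the
19 planes is the nondegeneracy of the nodes (`mem_span3_of_deriv_mem`). -/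

theorem exists_rep_mk_eq_smul {V : Type*} [AddCommGroup V] [Module ℂ V] (v : V) (hv : v ≠ 0) :
    ∃ c : ℂ, c ≠ 0 ∧ (Projectivization.mk ℂ v hv).rep = c • v := by
  obtain ⟨a, ha⟩ := Projectivization.exists_smul_eq_mk_rep ℂ v hv
  exact ⟨a, a.ne_zero, ha.symm⟩

theorem MvPolynomial.IsHomogeneous.eval_smul {σ : Type*} {F : MvPolynomial σ ℂ} {n : ℕ}
    (hF : F.IsHomogeneous n) (c : ℂ) (v : σ → ℂ) :
    eval (c • v) F = c ^ n * eval v F := by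
  rw [eval_eq, eval_eq, Finset.mul_sum]
  refine Finset.sum_congr rfl fun d hd => ?_
  have hd' : ∑ i ∈ d.support, d i = n := by
    have := hF (mem_support_iff.mp hd)
    simpa [Finsupp.weight_apply, Finsupp.sum] using this
  simp only [Pi.smul_apply, smul_eq_mul, mul_pow, Finset.prod_mul_distrib, Finset.prod_pow_eq_pow_sum, hd']
  ring

theorem eval_rep_mk_eq_zero_iff {F : MvPolynomial (Fin 5) ℂ} {n : ℕ} (hF : F.IsHomogeneous n)
    (v : Fin 5 → ℂ) (hv : v ≠ 0) :
    eval (Projectivization.mk ℂ v hv).rep F = 0 ↔ eval v F = 0 := by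
  obtain ⟨c, hc, h⟩ := exists_rep_mk_eq_smul v hv
  rw [h, hF.eval_smul]
  simp [hc]

/-- A set of points of an irreducible hypersurface that contains a nonempty Zariski open subset of
it is dense in it. -/
theorem zariskiClosure_eq_hypersurface {S : Set P4} {h l : MvPolynomial (Fin 5) ℂ} {m n : ℕ}
    (hh : h.IsHomogeneous m) (hl : l.IsHomogeneous n) (hn : n ≠ 0) (hirr : Irreducible h)
    (hdvd : ¬ h ∣ l) (hS : ∀ q ∈ S, eval q.rep h = 0)
    (hS' : ∀ q : P4, eval q.rep h = 0 → eval q.rep l ≠ 0 → q ∈ S) :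
    zariskiClosure S = {q | eval q.rep h = 0} := by
  ext q
  refine ⟨fun hq => hq m h hh hS, fun hq k F hF hFS => ?_⟩
  -- Nullstellensatz: `F * l` vanishes on the whole cone `h = 0`, because off `l = 0` the points of
  -- the cone lie over `S`.
  have key : F * l ∈ (Ideal.span {h}).radical := by
    rw [← MvPolynomial.vanishingIdeal_zeroLocus_eq_radical (K := ℂ), mem_vanishingIdeal_iff]
    intro v hv
    rw [mem_zeroLocus_iff] at hv
    have hv0 : eval v h = 0 := by
      simpa [aeval_eq_eval] using hv h (Ideal.subset_span rfl)
    rw [aeval_eq_eval, map_mul]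
    by_cases hvz : v = 0
    -- The vertex of the cone is not a point of `ℙ⁴`; there `l` vanishes because its degree is
    -- positive.
    · have : eval v l = 0 := by
        have := hl.eval_smul 0 v
        rw [zero_smul, ← hvz, zero_pow hn, zero_mul] at this
        exact this
      rw [this, mul_zero]
    · by_cases hlv : eval v l = 0
      · rw [hlv, mul_zero]
      · have hq := hS' (Projectivization.mk ℂ v hvz) ((eval_rep_mk_eq_zero_iff hh v hvz).2 hv0)
          (fun h' => hlv ((eval_rep_mk_eq_zero_iff hl v hvz).1 h'))
        rw [(eval_rep_mk_eq_zero_iff hF v hvz).1 (hFS _ hq), zero_mul]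
  obtain ⟨N, hN⟩ := key
  rw [Ideal.mem_span_singleton] at hN
  have hp : Prime h := hirr.prime
  have := (hp.dvd_or_dvd (hp.dvd_of_dvd_pow hN)).resolve_right hdvd
  obtain ⟨G, rfl⟩ := this
  rw [map_mul, show eval q.rep h = 0 from hq, zero_mul]

/-! ## Linear substitutions -/

/-- The linear substitution `zᵢ ↦ ∑ⱼ Mᵢⱼ zⱼ`. -/
def linSubst {σ : Type} [Fintype σ] (M : Matrix σ σ ℂ) : MvPolynomial σ ℂ →ₐ[ℂ] MvPolynomial σ ℂ :=
  aeval fun i => ∑ j, C (M i j) * X j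

section

variable {σ : Type} [Fintype σ]

theorem eval_linSubst (M : Matrix σ σ ℂ) (f : MvPolynomial σ ℂ) (v : σ → ℂ) :
    eval v (linSubst M f) = eval (M.mulVec v) f := by
  rw [linSubst, aeval_def, eval₂_eq_eval_map, ← eval₂_eq_eval_map, eval_eval₂]
  rw [← eval₂_id]
  congr 1
  · ext; simp
  · ext i; simp [Matrix.mulVec, dotProduct]

theorem linSubst_isHomogeneous (M : Matrix σ σ ℂ) {f : MvPolynomial σ ℂ} {n : ℕ}
    (hf : f.IsHomogeneous n) : (linSubst M f).IsHomogeneous n := by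
  have := hf.aeval (n := 1) (fun i => ∑ j, C (M i j) * X j : σ → MvPolynomial σ ℂ) (fun i =>
    IsHomogeneous.sum _ _ _ fun j _ => isHomogeneous_C_mul_X _ _)
  rwa [one_mul] at this

/-- Substitution is precomposition with the linear map, hence the reversed order. -/
theorem linSubst_linSubst [DecidableEq σ] (M N : Matrix σ σ ℂ) (f : MvPolynomial σ ℂ) :
    linSubst M (linSubst N f) = linSubst (N * M) f := by
  apply MvPolynomial.funext
  intro v
  simp [eval_linSubst]

theorem linSubst_one [DecidableEq σ] (f : MvPolynomial σ ℂ) :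
    linSubst (1 : Matrix σ σ ℂ) f = f := by
  apply MvPolynomial.funext
  intro v
  simp [eval_linSubst]

theorem linSubst_irreducible [DecidableEq σ] {M : Matrix σ σ ℂ} (hM : IsUnit M.det)
    {f : MvPolynomial σ ℂ} (hf : Irreducible f) : Irreducible (linSubst M f) := by
  let e : MvPolynomial σ ℂ ≃ₐ[ℂ] MvPolynomial σ ℂ :=
    AlgEquiv.ofAlgHom (linSubst M) (linSubst M⁻¹)
      (AlgHom.ext fun p => by simp [linSubst_linSubst, Matrix.nonsing_inv_mul M hM, linSubst_one])
      (AlgHom.ext fun p => by simp [linSubst_linSubst, Matrix.mul_nonsing_inv M hM, linSubst_one])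
  exact (MulEquiv.irreducible_iff e).2 hf

theorem linSubst_dvd_linSubst_iff [DecidableEq σ] {M : Matrix σ σ ℂ} (hM : IsUnit M.det)
    {f g : MvPolynomial σ ℂ} : linSubst M f ∣ linSubst M g ↔ f ∣ g := by
  refine ⟨fun h => ?_, fun h => map_dvd _ h⟩
  have := map_dvd (linSubst M⁻¹) h
  simpa [linSubst_linSubst, Matrix.mul_nonsing_inv M hM, linSubst_one] using this

theorem pderiv_linSubst (M : Matrix σ σ ℂ) (f : MvPolynomial σ ℂ) (i : σ) :
    pderiv i (linSubst M f) = ∑ k, C (M k i) * linSubst M (pderiv k f) := by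
  classical
  induction f using MvPolynomial.induction_on with
  | C a => simp [linSubst]
  | add p q hp hq => simp [hp, hq, mul_add, Finset.sum_add_distrib]
  | mul_X p n hp =>
    have hX : pderiv i (linSubst M (X n)) = C (M n i) := by
      simp [linSubst, pderiv_X, Pi.single_apply]
    rw [map_mul, Derivation.leibniz, hp, hX]
    simp only [Derivation.leibniz, map_add, smul_eq_mul, map_mul, mul_add, Finset.sum_add_distrib, pderiv_X,
      Finset.mul_sum]
    congr 1
    · rw [Finset.sum_eq_single n]
      · simp [mul_comm]
      · intro b _ hb
        simp [hb]
      · simp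
    · exact Finset.sum_congr rfl fun k _ => by ring

theorem eval_pderiv_linSubst (M : Matrix σ σ ℂ) (f : MvPolynomial σ ℂ) (v : σ → ℂ) (i : σ) :
    eval v (pderiv i (linSubst M f)) = ∑ k, M k i * eval (M.mulVec v) (pderiv k f) := by
  simp [pderiv_linSubst, eval_linSubst]

theorem hessianAt_linSubst (M : Matrix σ σ ℂ) (f : MvPolynomial σ ℂ) (v : σ → ℂ) :
    hessianAt (linSubst M f) v = M.transpose * hessianAt f (M.mulVec v) * M := by
  ext i j
  simp only [hessianAt, Matrix.of_apply, pderiv_linSubst M f, map_sum, Matrix.mul_apply,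
    Matrix.transpose_apply, pderiv_C_mul, Finset.sum_mul, map_mul, eval_C,
    eval_pderiv_linSubst, Finset.mul_sum]
  refine Finset.sum_congr rfl fun k _ => Finset.sum_congr rfl fun l _ => ?_
  ring

end

theorem gradAt_linSubst (M : Matrix (Fin 5) (Fin 5) ℂ) (f : MvPolynomial (Fin 5) ℂ)
    (v : Fin 5 → ℂ) : gradAt (linSubst M f) v = M.transpose.mulVec (gradAt f (M.mulVec v)) := by
  ext i
  simp [gradAt, eval_pderiv_linSubst, Matrix.mulVec, dotProduct]
end

noncomputable section

/-! ## Forms of bidegree `(1, 1)` through the four points -/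

/-- The five forms `xᵢ yⱼ - x₂ y₁`, `i ≠ j`, `(i, j) ≠ (2, 1)`. -/
def stdForms : Fin 5 → BiPoly :=
  ![X (Sum.inl 0) * X (Sum.inr 1) - X (Sum.inl 1) * X (Sum.inr 0),
    X (Sum.inl 1) * X (Sum.inr 2) - X (Sum.inl 1) * X (Sum.inr 0),
    X (Sum.inl 2) * X (Sum.inr 0) - X (Sum.inl 1) * X (Sum.inr 0),
    X (Sum.inl 0) * X (Sum.inr 2) - X (Sum.inl 1) * X (Sum.inr 0),
    X (Sum.inl 2) * X (Sum.inr 1) - X (Sum.inl 1) * X (Sum.inr 0)]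

/-- The values of the forms `stdForms`. -/
def stdVec (x y : Fin 3 → ℂ) : Fin 5 → ℂ :=
  ![x 0 * y 1 - x 1 * y 0, x 1 * y 2 - x 1 * y 0, x 2 * y 0 - x 1 * y 0,
    x 0 * y 2 - x 1 * y 0, x 2 * y 1 - x 1 * y 0]

theorem X_inl_mul_X_inr_mem_biForms (i j : Fin 3) :
    (X (Sum.inl i) * X (Sum.inr j) : BiPoly) ∈ biForms 1 1 := by
  have h := (isWeightedHomogeneous_X ℂ (Sum.elim (fun _ => ((1, 0) : ℕ × ℕ))
    (fun _ => ((0, 1) : ℕ × ℕ))) (Sum.inl i : Fin 3 ⊕ Fin 3)).mul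
    (isWeightedHomogeneous_X ℂ (Sum.elim (fun _ => ((1, 0) : ℕ × ℕ))
    (fun _ => ((0, 1) : ℕ × ℕ))) (Sum.inr j : Fin 3 ⊕ Fin 3))
  exact h

/-- A monomial of bidegree `(1, 1)` has exponent one at exactly one `x`-variable and at exactly one
`y`-variable. -/
theorem biForms_one_one_eq_span :
    biForms 1 1 = Submodule.span ℂ
      (Set.range fun k : Fin 3 × Fin 3 => (X (Sum.inl k.1) * X (Sum.inr k.2) : BiPoly)) := by
  apply le_antisymm
  · intro p hp
    rw [p.as_sum]
    refine Submodule.sum_mem _ fun d hd => ?_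
    have hw : Finsupp.weight (Sum.elim (fun _ => ((1, 0) : ℕ × ℕ)) (fun _ => ((0, 1) : ℕ × ℕ))) d
        = ((1, 1) : ℕ × ℕ) := hp (mem_support_iff.mp hd)
    rw [Finsupp.weight_apply, Finsupp.sum_fintype _ _ (by simp)] at hw
    simp only [Fintype.sum_sum_type, Sum.elim_inl, Sum.elim_inr, Fin.sum_univ_three,
      Prod.ext_iff, Prod.fst_add, Prod.snd_add, Prod.smul_fst, Prod.smul_snd, smul_eq_mul,
      mul_one, mul_zero, add_zero, zero_add] at hw
    obtain ⟨h1, h2⟩ := hw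
    have e1 : ∃ i : Fin 3, ∀ k, d (Sum.inl k) = if k = i then 1 else 0 := by
      rcases Nat.eq_zero_or_pos (d (Sum.inl 0)) with h0 | h0
      · rcases Nat.eq_zero_or_pos (d (Sum.inl 1)) with h1 | h1
        · refine ⟨2, fun k => ?_⟩
          fin_cases k <;> simp <;> omega
        · refine ⟨1, fun k => ?_⟩
          fin_cases k <;> simp <;> omega
      · refine ⟨0, fun k => ?_⟩
        fin_cases k <;> simp <;> omega
    have e2 : ∃ i : Fin 3, ∀ k, d (Sum.inr k) = if k = i then 1 else 0 := by
      rcases Nat.eq_zero_or_pos (d (Sum.inr 0)) with h0 | h0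
      · rcases Nat.eq_zero_or_pos (d (Sum.inr 1)) with h1 | h1
        · refine ⟨2, fun k => ?_⟩
          fin_cases k <;> simp <;> omega
        · refine ⟨1, fun k => ?_⟩
          fin_cases k <;> simp <;> omega
      · refine ⟨0, fun k => ?_⟩
        fin_cases k <;> simp <;> omega
    obtain ⟨i, hi⟩ := e1
    obtain ⟨j, hj⟩ := e2
    have hd' : d = Finsupp.single (Sum.inl i) 1 + Finsupp.single (Sum.inr j) 1 := by
      ext s
      rcases s with k | k
      · simp [hi, Finsupp.single_apply, eq_comm]
      · simp [hj, Finsupp.single_apply, eq_comm]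
    have : monomial d (coeff d p) = coeff d p • (X (Sum.inl i) * X (Sum.inr j) : BiPoly) := by
      rw [X, X, monomial_mul, ← hd', smul_monomial]
      simp
    rw [this]
    exact Submodule.smul_mem _ _ (Submodule.subset_span ⟨(i, j), rfl⟩)
  · rw [Submodule.span_le]
    rintro _ ⟨⟨i, j⟩, rfl⟩
    exact X_inl_mul_X_inr_mem_biForms i j

theorem stdForms_mem (k : Fin 5) : stdForms k ∈ formsThroughO4 := by
  refine ⟨?_, ?_⟩
  · fin_cases k <;>
    exact Submodule.sub_mem _ (X_inl_mul_X_inr_mem_biForms _ _) (X_inl_mul_X_inr_mem_biForms _ _)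
  · simp only [SetLike.mem_coe, Submodule.mem_iInf, LinearMap.mem_ker, AlgHom.toLinearMap_apply]
    intro i
    fin_cases k <;> fin_cases i <;> simp [stdForms, fourPts]

/-- The coordinate points kill the three diagonal coefficients, and `(1 : 1 : 1)` then makes the
other six sum to zero, which eliminates the coefficient of `x₁ y₀`. -/
theorem formsThroughO4_le_span : formsThroughO4 ≤ Submodule.span ℂ (Set.range stdForms) := by
  rintro p ⟨hp, hp'⟩
  rw [SetLike.mem_coe, biForms_one_one_eq_span, Submodule.mem_span_range_iff_exists_fun] at hp
  obtain ⟨c, rfl⟩ := hp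
  simp only [SetLike.mem_coe, Submodule.mem_iInf, LinearMap.mem_ker, AlgHom.toLinearMap_apply,
    Fintype.sum_prod_type, Fin.sum_univ_three] at hp'
  have h0 := hp' 0
  have h1 := hp' 1
  have h2 := hp' 2
  have h3 := hp' 3
  simp [fourPts] at h0 h1 h2 h3
  rw [Submodule.mem_span_range_iff_exists_fun]
  refine ⟨![c (0, 1), c (1, 2), c (2, 0), c (0, 2), c (2, 1)], ?_⟩
  have h4 : c (1, 0) = -(c (0, 1) + c (1, 2) + c (2, 0) + c (0, 2) + c (2, 1)) := by
    linear_combination h3 - h0 - h1 - h2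
  simp only [Fintype.sum_prod_type, Fin.sum_univ_three, Fin.sum_univ_five, h0, h1, h2, h4, stdForms,
    smul_eq_C_mul]
  simp
  ring

theorem eval_stdForms (x y : Fin 3 → ℂ) (k : Fin 5) :
    eval (Sum.elim x y) (stdForms k) = stdVec x y k := by
  fin_cases k <;> simp [stdForms, stdVec]

theorem linearIndependent_stdForms : LinearIndependent ℂ stdForms := by
  rw [Fintype.linearIndependent_iff]
  intro g hg
  have key : ∀ x y : Fin 3 → ℂ, ∑ k, g k * stdVec x y k = 0 := fun x y => by
    have := congrArg (eval (Sum.elim x y)) hg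
    simpa [map_sum, smul_eval, eval_stdForms] using this
  intro k
  -- At `(eᵢ, eⱼ)` only the form containing `xᵢ yⱼ` is nonzero, since `x₁ y₀` vanishes there.
  have h0 := key ![1, 0, 0] ![0, 1, 0]
  have h1 := key ![0, 1, 0] ![0, 0, 1]
  have h2 := key ![0, 0, 1] ![1, 0, 0]
  have h3 := key ![1, 0, 0] ![0, 0, 1]
  have h4 := key ![0, 0, 1] ![0, 1, 0]
  simp [Fin.sum_univ_five, stdVec] at h0 h1 h2 h3 h4
  fin_cases k <;> assumption

/-- The basis `stdForms` of `H⁰(𝓘(1,1))`. -/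
def stdBasis : Module.Basis (Fin 5) ℂ formsThroughO4 :=
  Module.Basis.mk (v := fun k => ⟨stdForms k, stdForms_mem k⟩)
    (LinearIndependent.of_comp formsThroughO4.subtype linearIndependent_stdForms) (by
      rintro ⟨p, hp⟩ -
      obtain ⟨c, hc⟩ := (Submodule.mem_span_range_iff_exists_fun ℂ).1 (formsThroughO4_le_span hp)
      refine (Submodule.mem_span_range_iff_exists_fun ℂ).2 ⟨c, Subtype.ext ?_⟩
      simpa using hc)

theorem coe_stdBasis (k : Fin 5) : (stdBasis k : BiPoly) = stdForms k := by
  simp [stdBasis]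

theorem finrank_formsThroughO4 : Module.finrank ℂ formsThroughO4 = 5 := by
  rw [Module.finrank_eq_card_basis stdBasis, Fintype.card_fin]

theorem exists_matrix_of_basis (b : Module.Basis (Fin 5) ℂ formsThroughO4) :
    ∃ M : Matrix (Fin 5) (Fin 5) ℂ, IsUnit M.det ∧
      ∀ k, (b k : BiPoly) = ∑ l, C (M k l) * stdForms l := by
  refine ⟨(stdBasis.toMatrix b).transpose, ?_, fun k => ?_⟩
  · rw [Matrix.det_transpose, ← Matrix.isUnit_iff_isUnit_det]
    exact (IsUnit.of_mul_eq_one _ (stdBasis.toMatrix_mul_toMatrix_flip b))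
  · have := congrArg (Subtype.val) (stdBasis.sum_toMatrix_smul_self b k)
    rw [← this]
    simp only [Submodule.coe_sum, Submodule.coe_smul, coe_stdBasis, smul_eq_C_mul,
      Matrix.transpose_apply]

/-! ## Points and their images -/

theorem stdVec_smul_smul (c d : ℂ) (x y : Fin 3 → ℂ) :
    stdVec (c • x) (d • y) = (c * d) • stdVec x y := by
  ext k
  fin_cases k <;> simp [stdVec] <;> ring

theorem phiVec_eq_mulVec {b : Fin 5 → BiPoly} {M : Matrix (Fin 5) (Fin 5) ℂ}
    (hb : ∀ k, b k = ∑ l, C (M k l) * stdForms l) (p : P2 × P2) :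
    phiVec b p = M.mulVec (stdVec p.1.rep p.2.rep) := by
  ext k
  simp [phiVec, hb, coords, eval_stdForms, Matrix.mulVec, dotProduct]

/-- Moves the change of basis to the target, so that fibres need only be computed for `stdVec`. -/
theorem phiMaps_iff {b : Fin 5 → BiPoly} {M : Matrix (Fin 5) (Fin 5) ℂ} (hM : IsUnit M.det)
    (hb : ∀ k, b k = ∑ l, C (M k l) * stdForms l) (p : P2 × P2) (q : P4) :
    PhiMaps b p q ↔ ∃ c : ℂ, c ≠ 0 ∧ stdVec p.1.rep p.2.rep = c • M⁻¹.mulVec q.rep := by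
  have hinv : ∀ v w, M.mulVec v = w ↔ v = M⁻¹.mulVec w := fun v w => by
    constructor
    · rintro rfl
      simp [Matrix.nonsing_inv_mul M hM]
    · rintro rfl
      simp [Matrix.mul_nonsing_inv M hM]
  constructor
  · rintro ⟨h, rfl⟩
    obtain ⟨c, hc, e⟩ := exists_rep_mk_eq_smul _ h
    refine ⟨c⁻¹, inv_ne_zero hc, ?_⟩
    rw [e, Matrix.mulVec_smul, smul_smul, inv_mul_cancel₀ hc, one_smul, ← hinv,
      phiVec_eq_mulVec hb]
  · rintro ⟨c, hc, e⟩
    rw [← Matrix.mulVec_smul, ← hinv, ← phiVec_eq_mulVec hb] at e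
    have h0 : phiVec b p ≠ 0 := by
      rw [e]
      exact smul_ne_zero hc q.rep_nonzero
    refine ⟨h0, ?_⟩
    conv_rhs => rw [← q.mk_rep]
    rw [Projectivization.mk_eq_mk_iff']
    exact ⟨c, e.symm⟩

theorem exists_rep_smul_stdVec (x y : Fin 3 → ℂ) (hx : x ≠ 0) (hy : y ≠ 0) :
    ∃ c : ℂ, c ≠ 0 ∧ stdVec (Projectivization.mk ℂ x hx).rep (Projectivization.mk ℂ y hy).rep =
      c • stdVec x y := by
  obtain ⟨c, hc, e⟩ := exists_rep_mk_eq_smul x hx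
  obtain ⟨d, hd, e'⟩ := exists_rep_mk_eq_smul y hy
  exact ⟨c * d, mul_ne_zero hc hd, by rw [e, e', stdVec_smul_smul]⟩

end

noncomputable section

/-! ## The Igusa quartic and the fibres of the map

The point `(x, y)` is mapped to `w` if, up to a common factor, `xᵢ yⱼ = zᵢⱼ + t` for `i ≠ j`, where
`z₀₁, z₁₂, z₂₀, z₀₂, z₂₁` are the coordinates of `w` and `z₁₀ = 0`. Then `t` is a root of the
polynomial `(z₀₁ + t) (z₁₂ + t) (z₂₀ + t) - (z₀₂ + t) (z₂₁ + t) t` of degree two. -/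

/-- The discriminant of `(z₀₁ + t) (z₁₂ + t) (z₂₀ + t) - (z₀₂ + t) (z₂₁ + t) t`. -/
def igusaForm : MvPolynomial (Fin 5) ℂ :=
  (X 0 * X 1 + X 0 * X 2 + X 1 * X 2 - X 3 * X 4) ^ 2 -
    C 4 * (X 0 + X 1 + X 2 - X 3 - X 4) * (X 0 * X 1 * X 2)

/-- If this form does not vanish, then the polynomial in `t` is of degree two, and none of its roots
is a root of one of the six factors. -/
def exceptionalForm : MvPolynomial (Fin 5) ℂ :=
  (X 0 + X 1 + X 2 - X 3 - X 4) * (X 0 * X 1 * X 2) *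
    ((X 0 - X 3) * (X 1 - X 3) * (X 2 - X 3)) * ((X 0 - X 4) * (X 1 - X 4) * (X 2 - X 4))

theorem igusaForm_isHomogeneous : igusaForm.IsHomogeneous 4 := by
  have hX := fun i : Fin 5 => isHomogeneous_X ℂ i
  refine IsHomogeneous.sub (n := 4) ?_ ?_
  · exact IsHomogeneous.pow (m := 2) (((((hX 0).mul (hX 1)).add ((hX 0).mul (hX 2))).add
      ((hX 1).mul (hX 2))).sub ((hX 3).mul (hX 4))) 2
  · exact IsHomogeneous.mul (m := 1) (n := 3)
      (IsHomogeneous.C_mul (((((hX 0).add (hX 1)).add (hX 2)).sub (hX 3)).sub (hX 4)) 4)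
      (((hX 0).mul (hX 1)).mul (hX 2))

theorem exceptionalForm_isHomogeneous : exceptionalForm.IsHomogeneous 10 := by
  have hX := fun i : Fin 5 => isHomogeneous_X ℂ i
  have h3 : ∀ j : Fin 5, ((X 0 - X j) * (X 1 - X j) * (X 2 - X j) :
      MvPolynomial (Fin 5) ℂ).IsHomogeneous 3 := fun j =>
    (((hX 0).sub (hX j)).mul ((hX 1).sub (hX j))).mul ((hX 2).sub (hX j))
  exact (((((((hX 0).add (hX 1)).add (hX 2)).sub (hX 3)).sub (hX 4)).mul
    (((hX 0).mul (hX 1)).mul (hX 2))).mul (h3 3)).mul (h3 4)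

theorem eval_igusaForm (w : Fin 5 → ℂ) :
    eval w igusaForm = (w 0 * w 1 + w 0 * w 2 + w 1 * w 2 - w 3 * w 4) ^ 2 -
      4 * (w 0 + w 1 + w 2 - w 3 - w 4) * (w 0 * w 1 * w 2) := by
  simp [igusaForm]

theorem eval_exceptionalForm (w : Fin 5 → ℂ) :
    eval w exceptionalForm = (w 0 + w 1 + w 2 - w 3 - w 4) * (w 0 * w 1 * w 2) *
      ((w 0 - w 3) * (w 1 - w 3) * (w 2 - w 3)) * ((w 0 - w 4) * (w 1 - w 4) * (w 2 - w 4)) := by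
  simp [exceptionalForm]

/-- The point `(16, 1, 1, 7, 7)` lies on the quartic and on none of the exceptional hyperplanes. -/
theorem not_igusaForm_dvd_exceptionalForm : ¬ igusaForm ∣ exceptionalForm := by
  rintro ⟨k, hk⟩
  have := congrArg (eval ![16, 1, 1, 7, 7]) hk
  rw [map_mul, eval_igusaForm, eval_exceptionalForm] at this
  simp at this
  norm_num at this

theorem eval_vRam (x y : Fin 3 → ℂ) :
    eval (Sum.elim x y) vRam = (x 0 - x 1) * x 2 * (y 0 * (y 1 - y 2)) -
      x 0 * (x 1 - x 2) * ((y 0 - y 1) * y 2) := by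
  simp [vRam]

/-- The source point supplies a root `t = x₁ y₀` of the quadratic, so the discriminant is the square
of the derivative at this root. That derivative is the difference of the second elementary symmetric
functions of the two triples of products, which is the equation of `V^ram`. -/
theorem eval_stdVec_igusaForm (x y : Fin 3 → ℂ) :
    eval (stdVec x y) igusaForm = eval (Sum.elim x y) vRam ^ 2 := by
  rw [eval_igusaForm, eval_vRam]
  simp [stdVec]
  ring

/-- The equation satisfied by the parameter `t` of a point of the fibre over `w`. -/
def FibreEq (w : Fin 5 → ℂ) (t : ℂ) : Prop :=
  (w 0 + t) * (w 1 + t) * (w 2 + t) = (w 3 + t) * (w 4 + t) * t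

theorem fibreEq_iff (w : Fin 5 → ℂ) (t : ℂ) :
    FibreEq w t ↔ (w 0 + w 1 + w 2 - w 3 - w 4) * t ^ 2 +
      (w 0 * w 1 + w 0 * w 2 + w 1 * w 2 - w 3 * w 4) * t + w 0 * w 1 * w 2 = 0 := by
  rw [FibreEq, ← sub_eq_zero]
  ring_nf

/-- If a factor on one side vanishes, so does one on the other side. Then one of `w₀, w₁, w₂` equals
one of `w₃, w₄, 0`, which is excluded. -/
theorem FibreEq.ne_zero {w : Fin 5 → ℂ} {t : ℂ} (h : FibreEq w t)
    (hw : eval w exceptionalForm ≠ 0) :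
    w 0 + t ≠ 0 ∧ w 1 + t ≠ 0 ∧ w 2 + t ≠ 0 ∧ w 3 + t ≠ 0 ∧ w 4 + t ≠ 0 ∧ t ≠ 0 := by
  rw [eval_exceptionalForm] at hw
  simp only [ne_eq, mul_eq_zero, not_or, sub_eq_zero] at hw
  obtain ⟨⟨⟨-, ⟨h0, h1⟩, h2⟩, ⟨h3, h4⟩, h5⟩, ⟨h6, h7⟩, h8⟩ := hw
  have aux : ∀ p q : ℂ, p ≠ q → p + t = 0 → q + t ≠ 0 := fun p q hpq hp hq =>
    hpq (by linear_combination hp - hq)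
  have aux' : ∀ p : ℂ, p ≠ 0 → p + t = 0 → t ≠ 0 := fun p hp0 hp hq =>
    hp0 (by linear_combination hp - hq)
  have hl : ∀ p : ℂ, (p = w 0 ∨ p = w 1 ∨ p = w 2) → p + t ≠ 0 := by
    intro p hp hpt
    have hz : (w 3 + t) * (w 4 + t) * t = 0 := by
      rw [← h]
      rcases hp with rfl | rfl | rfl <;> rw [hpt] <;> ring
    have hp0 : p ≠ 0 := by rcases hp with rfl | rfl | rfl <;> assumption
    have hp3 : p ≠ w 3 := by rcases hp with rfl | rfl | rfl <;> assumption
    have hp4 : p ≠ w 4 := by rcases hp with rfl | rfl | rfl <;> assumption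
    exact mul_ne_zero (mul_ne_zero (aux _ _ hp3 hpt) (aux _ _ hp4 hpt)) (aux' _ hp0 hpt) hz
  have e0 := hl _ (Or.inl rfl)
  have e1 := hl _ (Or.inr (Or.inl rfl))
  have e2 := hl _ (Or.inr (Or.inr rfl))
  have hz : (w 3 + t) * (w 4 + t) * t ≠ 0 := by
    rw [← h]
    exact mul_ne_zero (mul_ne_zero e0 e1) e2
  simp only [ne_eq, mul_eq_zero, not_or] at hz
  exact ⟨e0, e1, e2, hz.1.1, hz.1.2, hz.2⟩

/-- The `x`-coordinates of the point with parameter `t` of the fibre over `w`. -/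
def fibreX (w : Fin 5 → ℂ) (t : ℂ) : Fin 3 → ℂ :=
  ![(w 0 + t) * (w 2 + t), t * (w 4 + t), (w 2 + t) * (w 4 + t)]

/-- The `y`-coordinates of the point with parameter `t` of the fibre over `w`. -/
def fibreY (w : Fin 5 → ℂ) (t : ℂ) : Fin 3 → ℂ :=
  ![t * (w 2 + t), t * (w 4 + t), (w 1 + t) * (w 2 + t)]

/-- The coordinates were solved from the ratios `x₀ : x₂ = (w₀ + t) : (w₄ + t)`, `x₁ : x₂ = t : (w₂
+ t)`, and likewise for `y`. Five of the six products then come out right identically; the sixth,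
`x₀ y₂`, is what the fibre equation is needed for. -/
theorem stdVec_fibre {w : Fin 5 → ℂ} {t : ℂ} (h : FibreEq w t) :
    stdVec (fibreX w t) (fibreY w t) = ((w 4 + t) * t * (w 2 + t)) • w := by
  unfold FibreEq at h
  ext k
  fin_cases k
  · simp [stdVec, fibreX, fibreY]; ring
  · simp [stdVec, fibreX, fibreY]; ring
  · simp [stdVec, fibreX, fibreY]; ring
  · simp [stdVec, fibreX, fibreY]; linear_combination (w 2 + t) * h
  · simp [stdVec, fibreX, fibreY]; ring

/-- The coordinate missing from `w` is `x₁ y₀`, which forces the parameter. All six products are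
then known and nonzero, so the ratios of the coordinates can be solved for. -/
theorem fibre_unique {w : Fin 5 → ℂ} (hw : eval w exceptionalForm ≠ 0) {x y : Fin 3 → ℂ} {c : ℂ}
    (hc : c ≠ 0) (h : stdVec x y = c • w) :
    FibreEq w (x 1 * y 0 / c) ∧ (∃ k : ℂ, x = k • fibreX w (x 1 * y 0 / c)) ∧
      ∃ k : ℂ, y = k • fibreY w (x 1 * y 0 / c) := by
  obtain ⟨s, hs⟩ : ∃ s, s = x 1 * y 0 / c := ⟨_, rfl⟩
  rw [← hs]
  have h10 : x 1 * y 0 = c * s := by rw [hs]; field_simp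
  have h0 := congrFun h 0
  have h1 := congrFun h 1
  have h2 := congrFun h 2
  have h3 := congrFun h 3
  have h4 := congrFun h 4
  simp [stdVec] at h0 h1 h2 h3 h4
  have e0 : x 0 * y 1 = c * (w 0 + s) := by linear_combination h0 + h10
  have e1 : x 1 * y 2 = c * (w 1 + s) := by linear_combination h1 + h10
  have e2 : x 2 * y 0 = c * (w 2 + s) := by linear_combination h2 + h10
  have e3 : x 0 * y 2 = c * (w 3 + s) := by linear_combination h3 + h10
  have e4 : x 2 * y 1 = c * (w 4 + s) := by linear_combination h4 + h10
  -- Both triples of products multiply to `x₀ x₁ x₂ y₀ y₁ y₂`.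
  have hF : FibreEq w s := by
    have : c ^ 3 * ((w 0 + s) * (w 1 + s) * (w 2 + s)) =
        c ^ 3 * ((w 3 + s) * (w 4 + s) * s) := by
      calc _ = (c * (w 0 + s)) * (c * (w 1 + s)) * (c * (w 2 + s)) := by ring
        _ = (c * (w 3 + s)) * (c * (w 4 + s)) * (c * s) := by
          rw [← e0, ← e1, ← e2, ← e3, ← e4, ← h10]; ring
        _ = _ := by ring
    exact mul_left_cancel₀ (pow_ne_zero 3 hc) this
  obtain ⟨n0, n1, n2, n3, n4, n5⟩ := hF.ne_zero hw
  have hy1 : y 1 ≠ 0 := by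
    intro h
    rw [h, mul_zero] at e4
    exact mul_ne_zero hc n4 e4.symm
  have hy0 : y 0 ≠ 0 := by
    intro h
    rw [h, mul_zero] at e2
    exact mul_ne_zero hc n2 e2.symm
  have hx1 : x 1 ≠ 0 := by
    intro h
    rw [h, zero_mul] at e1
    exact mul_ne_zero hc n1 e1.symm
  have hx2 : x 2 ≠ 0 := by
    intro h
    rw [h, zero_mul] at e2
    exact mul_ne_zero hc n2 e2.symm
  refine ⟨hF, ⟨x 2 / ((w 2 + s) * (w 4 + s)), ?_⟩, ⟨y 0 / (s * (w 2 + s)), ?_⟩⟩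
  · ext i
    fin_cases i
    · simp [fibreX]
      field_simp
      apply mul_right_cancel₀ hy1
      apply mul_left_cancel₀ hc
      linear_combination c * (w 4 + s) * e0 - c * (w 0 + s) * e4
    · simp [fibreX]
      field_simp
      apply mul_right_cancel₀ hy0
      apply mul_left_cancel₀ hc
      linear_combination c * (w 2 + s) * h10 - c * s * e2
    · simp [fibreX]
      field_simp
  · ext i
    fin_cases i
    · simp [fibreY]
      field_simp
    · simp [fibreY]
      field_simp
      apply mul_right_cancel₀ hx2
      apply mul_left_cancel₀ hc
      linear_combination c * (w 2 + s) * e4 - c * (w 4 + s) * e2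
    · simp [fibreY]
      field_simp
      apply mul_right_cancel₀ hx1
      apply mul_left_cancel₀ hc
      linear_combination c * s * e1 - c * (w 1 + s) * h10

theorem fibreX_ne_zero {w : Fin 5 → ℂ} {t : ℂ} (h : FibreEq w t)
    (hw : eval w exceptionalForm ≠ 0) : fibreX w t ≠ 0 := by
  obtain ⟨n0, n1, n2, n3, n4, n5⟩ := h.ne_zero hw
  intro h0
  exact mul_ne_zero n2 n4 (congrFun h0 2)

theorem fibreY_ne_zero {w : Fin 5 → ℂ} {t : ℂ} (h : FibreEq w t)
    (hw : eval w exceptionalForm ≠ 0) : fibreY w t ≠ 0 := by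
  obtain ⟨n0, n1, n2, n3, n4, n5⟩ := h.ne_zero hw
  intro h0
  exact mul_ne_zero n1 n2 (congrFun h0 2)

/-- The point with parameter `t` of the fibre over `w`. -/
def fibrePt (w : Fin 5 → ℂ) (hw : eval w exceptionalForm ≠ 0) (t : ℂ) (h : FibreEq w t) :
    P2 × P2 :=
  (Projectivization.mk ℂ _ (fibreX_ne_zero h hw), Projectivization.mk ℂ _ (fibreY_ne_zero h hw))

section

variable {b : Fin 5 → BiPoly} {M : Matrix (Fin 5) (Fin 5) ℂ} (hM : IsUnit M.det)
  (hb : ∀ k, b k = ∑ l, C (M k l) * stdForms l)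
include hM hb

theorem phiMaps_fibrePt {q : P4} (hw : eval (M⁻¹.mulVec q.rep) exceptionalForm ≠ 0) {t : ℂ}
    (h : FibreEq (M⁻¹.mulVec q.rep) t) : PhiMaps b (fibrePt _ hw t h) q := by
  obtain ⟨n0, n1, n2, n3, n4, n5⟩ := h.ne_zero hw
  obtain ⟨c, hc, e⟩ := exists_rep_smul_stdVec _ _ (fibreX_ne_zero h hw) (fibreY_ne_zero h hw)
  rw [phiMaps_iff hM hb]
  rw [stdVec_fibre h, smul_smul] at e
  exact ⟨_, mul_ne_zero hc (mul_ne_zero (mul_ne_zero n4 n5) n2), e⟩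

theorem exists_eq_fibrePt {p : P2 × P2} {q : P4}
    (hw : eval (M⁻¹.mulVec q.rep) exceptionalForm ≠ 0) (hp : PhiMaps b p q) :
    ∃ t h, p = fibrePt _ hw t h := by
  obtain ⟨c, hc, e⟩ := (phiMaps_iff hM hb p q).1 hp
  obtain ⟨hF, ⟨k, hk⟩, ⟨l, hl⟩⟩ := fibre_unique hw hc e
  refine ⟨_, hF, Prod.ext ?_ ?_⟩
  · conv_lhs => rw [← p.1.mk_rep]
    exact (Projectivization.mk_eq_mk_iff' _ _ _ _ _).2 ⟨k, hk.symm⟩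
  · conv_lhs => rw [← p.2.mk_rep]
    exact (Projectivization.mk_eq_mk_iff' _ _ _ _ _).2 ⟨l, hl.symm⟩

omit hM hb in
theorem fibrePt_injective {w : Fin 5 → ℂ} (hw : eval w exceptionalForm ≠ 0) {t t' : ℂ}
    {h : FibreEq w t} {h' : FibreEq w t'} (e : fibrePt w hw t h = fibrePt w hw t' h') :
    t = t' := by
  obtain ⟨n0, n1, n2, n3, n4, n5⟩ := h.ne_zero hw
  obtain ⟨m0, m1, m2, m3, m4, m5⟩ := h'.ne_zero hw
  obtain ⟨k, hk⟩ := (Projectivization.mk_eq_mk_iff' _ _ _ _ _).1 (congrArg Prod.fst e)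
  have h1 := congrFun hk 1
  have h2 := congrFun hk 2
  simp [fibreX] at h1 h2
  have h20 : w 2 ≠ 0 := by
    rw [eval_exceptionalForm] at hw
    intro h
    simp [h] at hw
  have n4' := n4
  -- The ratio `x₁ : x₂ = t : (w₂ + t)` determines `t` because `w₂ ≠ 0`.
  have : (t' - t) * w 2 * ((w 4 + t) * (w 4 + t')) * k = 0 := by
    linear_combination (w 2 + t) * (w 4 + t) * h1 - t * (w 4 + t) * h2
  have hk0 : k ≠ 0 := by
    rintro rfl
    rw [zero_mul] at h2
    exact mul_ne_zero n2 n4 h2.symm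
  have h3 := (mul_eq_zero.1 this).resolve_right hk0
  have h4 := (mul_eq_zero.1 h3).resolve_right (mul_ne_zero n4 m4)
  have h5 := (mul_eq_zero.1 h4).resolve_right h20
  exact (sub_eq_zero.1 h5).symm

theorem hasDegreeTwo_of_matrix : HasDegreeTwo b := by
  have hM' : IsUnit (M⁻¹).det := Matrix.isUnit_nonsing_inv_det M hM
  refine ⟨14, linSubst M⁻¹ (igusaForm * exceptionalForm), linSubst_isHomogeneous _
    (igusaForm_isHomogeneous.mul exceptionalForm_isHomogeneous), ?_, fun q hq => ?_⟩
  · intro h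
    have h2 := congrArg (eval (M.mulVec ![1, 2, 3, 4, 5])) h
    rw [eval_linSubst, Matrix.mulVec_mulVec, Matrix.nonsing_inv_mul M hM, Matrix.one_mulVec,
      map_mul, eval_igusaForm, eval_exceptionalForm] at h2
    simp at h2
    norm_num at h2
  · rw [eval_linSubst, map_mul] at hq
    obtain ⟨hd, hw⟩ := mul_ne_zero_iff.1 hq
    -- A square root of the discriminant, for the quadratic formula; it is nonzero off the quartic,
    -- so the two roots differ.
    obtain ⟨δ, hδ⟩ := IsAlgClosed.exists_pow_nat_eq
      (eval (M⁻¹.mulVec q.rep) igusaForm) (n := 2) (by norm_num)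
    obtain ⟨w, rfl⟩ : ∃ w, M⁻¹.mulVec q.rep = w := ⟨_, rfl⟩
    set w := M⁻¹.mulVec q.rep with hwdef
    have hδ0 : δ ≠ 0 := by
      rintro rfl
      exact hd (by rw [← hδ]; norm_num)
    obtain ⟨L, hL⟩ : ∃ L, L = w 0 + w 1 + w 2 - w 3 - w 4 := ⟨_, rfl⟩
    obtain ⟨E, hE⟩ : ∃ E, E = w 0 * w 1 + w 0 * w 2 + w 1 * w 2 - w 3 * w 4 := ⟨_, rfl⟩
    have hL0 : L ≠ 0 := by
      rw [eval_exceptionalForm] at hw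
      intro h
      simp [← hL, h] at hw
    have hδ' : δ ^ 2 = E ^ 2 - 4 * L * (w 0 * w 1 * w 2) := by
      rw [hδ, eval_igusaForm, hL, hE]
    have roots : ∀ t, FibreEq w t ↔ t = (-E + δ) / (2 * L) ∨ t = (-E - δ) / (2 * L) := by
      intro t
      rw [fibreEq_iff, ← hL, ← hE]
      constructor
      · intro h
        have : (2 * L * t + E - δ) * (2 * L * t + E + δ) = 0 := by
          linear_combination 4 * L * h - hδ'
        rcases mul_eq_zero.1 this with h | h
        · left; field_simp; linear_combination h
        · right; field_simp; linear_combination h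
      · rintro (rfl | rfl)
        · field_simp; linear_combination hδ'
        · field_simp; linear_combination hδ'
    have h1 := (roots _).2 (Or.inl rfl)
    have h2 := (roots _).2 (Or.inr rfl)
    have : {p | PhiMaps b p q} = {fibrePt w hw _ h1, fibrePt w hw _ h2} := by
      ext p
      simp only [Set.mem_ofPred_eq, Set.mem_insert_iff, Set.mem_singleton_iff]
      constructor
      · intro hp
        obtain ⟨t, ht, rfl⟩ := exists_eq_fibrePt hM hb hw hp
        rcases (roots t).1 ht with rfl | rfl
        · exact Or.inl rfl
        · exact Or.inr rfl
      · rintro (rfl | rfl) <;> exact phiMaps_fibrePt hM hb hw _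
    rw [this, Set.ncard_pair]
    intro h
    have := fibrePt_injective hw h
    field_simp at this
    apply hδ0
    linear_combination this / 2

end

end

noncomputable section

/-! ## Irreducibility of the Igusa quartic -/

/-- A substitution of polynomials of degree at most one in `v`, with coefficients in `ℂ[u]`, that
turns the Igusa quartic into an Eisenstein polynomial at `u`. -/
def eisensteinSubst : MvPolynomial (Fin 5) ℂ →+* Polynomial (Polynomial ℂ) :=
  (aeval (R := Polynomial ℂ) (S₁ := Polynomial (Polynomial ℂ)) ![Polynomial.C Polynomial.X, Polynomial.X + 1, Polynomial.X - 1,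
    2, Polynomial.C (Polynomial.C (-1 / 2))]).toRingHom.comp (MvPolynomial.map Polynomial.C)

/-- Every variable is sent to a polynomial of degree at most one in the outer variable. -/
theorem natDegree_eisensteinSubst_le (F : MvPolynomial (Fin 5) ℂ) :
    (eisensteinSubst F).natDegree ≤ F.totalDegree := by
  refine (aeval_natDegree_le (m := F.totalDegree) (n := 1) _ (Finset.sup_mono (support_map_subset _ _)) _ ?_).trans
    (mul_one _).le
  intro i
  fin_cases i
  · simp
  · simpa using Polynomial.natDegree_X_add_C (1 : Polynomial ℂ) |>.le
  · simpa using Polynomial.natDegree_X_sub_C (1 : Polynomial ℂ) |>.le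
  · simp
  · simp

/-- The choice `w₃ w₄ = -1` cancels the constant of `(v + 1)(v - 1)`, so the squared term becomes
`(v² + 2uv)²`, while the other term is divisible by `w₀ = u`. -/
theorem eisensteinSubst_igusaForm :
    eisensteinSubst igusaForm = Polynomial.X ^ 4 +
      (Polynomial.C (-4 * Polynomial.X) * Polynomial.X ^ 3 +
      Polynomial.C (6 * Polynomial.X) * Polynomial.X ^ 2 +
      Polynomial.C (8 * Polynomial.X) * Polynomial.X ^ 1 +
      Polynomial.C (4 * Polynomial.X ^ 2 - 6 * Polynomial.X)) := by
  have h : (Polynomial.C (Polynomial.C (-1 / 2)) : Polynomial (Polynomial ℂ)) * 2 = -1 := by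
    rw [show (2 : Polynomial (Polynomial ℂ)) = Polynomial.C (Polynomial.C 2) from rfl,
      ← Polynomial.C_mul, ← Polynomial.C_mul]
    norm_num
  -- The fraction becomes a symbol subject only to `k * 2 = -1`, so that the identity can be checked
  -- in any commutative ring.
  generalize hk : (Polynomial.C (Polynomial.C (-1 / 2)) : Polynomial (Polynomial ℂ)) = k at h
  have e : eisensteinSubst igusaForm =
      (Polynomial.C Polynomial.X * (Polynomial.X + 1) +
        Polynomial.C Polynomial.X * (Polynomial.X - 1) +
        (Polynomial.X + 1) * (Polynomial.X - 1) - 2 * k) ^ 2 -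
      4 * (Polynomial.C Polynomial.X + (Polynomial.X + 1) + (Polynomial.X - 1) - 2 - k) *
        (Polynomial.C Polynomial.X * (Polynomial.X + 1) * (Polynomial.X - 1)) := by
    rw [← hk]
    simp [eisensteinSubst, igusaForm, -map_div₀]
    exact Or.inl (Or.inl rfl)
  rw [e]
  simp only [map_mul, map_sub, map_pow, map_neg, map_ofNat]
  generalize (Polynomial.C (Polynomial.X) : Polynomial (Polynomial ℂ)) = u
  generalize (Polynomial.X : Polynomial (Polynomial ℂ)) = v
  linear_combination (-(2 * (2 * u * v + v ^ 2 - 1) - 2 * k + 1) + 2 * u * (v ^ 2 - 1)) * h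

theorem irreducible_eisensteinSubst_igusaForm : Irreducible (eisensteinSubst igusaForm) := by
  rw [eisensteinSubst_igusaForm]
  set r : Polynomial (Polynomial ℂ) := Polynomial.C (-4 * Polynomial.X) * Polynomial.X ^ 3 +
      Polynomial.C (6 * Polynomial.X) * Polynomial.X ^ 2 +
      Polynomial.C (8 * Polynomial.X) * Polynomial.X ^ 1 +
      Polynomial.C (4 * Polynomial.X ^ 2 - 6 * Polynomial.X) with hr
  have hdr : r.degree < (4 : ℕ) := by
    rw [hr]
    refine lt_of_le_of_lt (b := ((3 : ℕ) : WithBot ℕ)) ?_ (by norm_num)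
    compute_degree
    norm_num
  have hmonic : (Polynomial.X ^ 4 + r).Monic := Polynomial.monic_X_pow_add hdr
  have hdeg : (Polynomial.X ^ 4 + r).degree = ((4 : ℕ) : WithBot ℕ) := by
    rw [Polynomial.degree_add_eq_left_of_degree_lt, Polynomial.degree_X_pow]
    rwa [Polynomial.degree_X_pow]
  have hX : Prime (Polynomial.X : Polynomial ℂ) := Polynomial.prime_X
  have hP : (Ideal.span {(Polynomial.X : Polynomial ℂ)}).IsPrime :=
    (Ideal.span_singleton_prime Polynomial.X_ne_zero).2 hX
  refine Polynomial.irreducible_of_eisenstein_criterion hP ?_ ?_ ?_ ?_ hmonic.isPrimitive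
  · rw [hmonic.leadingCoeff]
    exact fun h => hP.ne_top ((Ideal.eq_top_iff_one _).2 h)
  · intro n hn
    rw [hdeg] at hn
    have hn4 : n < 4 := by exact_mod_cast hn
    rw [Ideal.mem_span_singleton, hr]
    interval_cases n <;>
      simp [Polynomial.coeff_X, Polynomial.coeff_C, Polynomial.coeff_X_pow, -map_mul, -map_neg, -map_sub]
    exact ⟨4 * Polynomial.X - 6, by ring⟩
  · rw [hdeg]; norm_num
  · rw [Ideal.span_singleton_pow, Ideal.mem_span_singleton, hr]
    rintro ⟨k, hk⟩
    simp [Polynomial.coeff_X, Polynomial.coeff_C, Polynomial.coeff_X_pow, -map_mul, -map_neg, -map_sub] at hk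
    have h1 : (Polynomial.X : Polynomial ℂ) * (4 * Polynomial.X - 6) =
        Polynomial.X * (Polynomial.X * k) := by linear_combination hk
    have h2 := mul_left_cancel₀ Polynomial.X_ne_zero h1
    have h3 := congrArg (Polynomial.eval 0) h2
    simp at h3

/-- The substitution keeps the degree four. If a factor became a unit, the cofactor's image would
have degree four, hence the cofactor total degree at least four; so the factor was already a
constant. -/
theorem irreducible_igusaForm : Irreducible igusaForm := by
  have hirr := irreducible_eisensteinSubst_igusaForm
  have hdeg : (eisensteinSubst igusaForm).natDegree = 4 := by
    rw [eisensteinSubst_igusaForm]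
    compute_degree!
  have h0 : igusaForm ≠ 0 := by
    intro h
    rw [h, map_zero] at hirr
    exact hirr.ne_zero rfl
  have key : ∀ F G : MvPolynomial (Fin 5) ℂ, igusaForm = F * G →
      IsUnit (eisensteinSubst F) → IsUnit F := by
    intro F G h hF
    have hF0 : F ≠ 0 := by rintro rfl; exact h0 (by rw [h, zero_mul])
    have hG0 : G ≠ 0 := by rintro rfl; exact h0 (by rw [h, mul_zero])
    have h1 : (eisensteinSubst G).natDegree = 4 := by
      rw [← hdeg, h, map_mul, Polynomial.natDegree_mul hF.ne_zero,
        Polynomial.natDegree_eq_zero_of_isUnit hF, zero_add]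
      intro hz
      apply hirr.ne_zero
      rw [h, map_mul, hz, mul_zero]
    have h2 := natDegree_eisensteinSubst_le G
    have h3 := totalDegree_mul_of_isDomain hF0 hG0
    rw [← h, igusaForm_isHomogeneous.totalDegree h0] at h3
    have h4 : F.totalDegree = 0 := by omega
    rw [totalDegree_eq_zero_iff_eq_C] at h4
    rw [h4]
    refine (isUnit_iff_ne_zero.2 ?_).map C
    intro hz
    rw [hz, map_zero] at h4
    exact hF0 h4
  refine ⟨fun h => hirr.not_isUnit (h.map eisensteinSubst), fun {F G} h => ?_⟩
  have h' := congrArg eisensteinSubst h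
  rw [map_mul] at h'
  rcases hirr.isUnit_or_isUnit h' with hF | hG
  · exact Or.inl (key F G h hF)
  · exact Or.inr (key G F (by rw [h, mul_comm]) hG)

/-! ## The image of the ramification divisor -/

theorem imageOfHypersurface_vRam {b : Fin 5 → BiPoly} {M : Matrix (Fin 5) (Fin 5) ℂ}
    (hM : IsUnit M.det) (hb : ∀ k, b k = ∑ l, C (M k l) * stdForms l) :
    imageOfHypersurface b vRam = {q | eval q.rep (linSubst M⁻¹ igusaForm) = 0} := by
  have hM' : IsUnit (M⁻¹).det := Matrix.isUnit_nonsing_inv_det M hM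
  refine zariskiClosure_eq_hypersurface (linSubst_isHomogeneous _ igusaForm_isHomogeneous)
    (linSubst_isHomogeneous _ exceptionalForm_isHomogeneous) (by norm_num)
    (linSubst_irreducible hM' irreducible_igusaForm)
    (fun h => not_igusaForm_dvd_exceptionalForm ((linSubst_dvd_linSubst_iff hM').1 h)) ?_ ?_
  · rintro q ⟨p, hp, hpq⟩
    obtain ⟨c, hc, e⟩ := (phiMaps_iff hM hb p q).1 hpq
    have h1 := eval_stdVec_igusaForm p.1.rep p.2.rep
    rw [show eval (Sum.elim p.1.rep p.2.rep) vRam = 0 from hp, e,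
      igusaForm_isHomogeneous.eval_smul] at h1
    rw [eval_linSubst]
    have h2 : c ^ 4 * eval (M⁻¹.mulVec q.rep) igusaForm = 0 := by rw [h1]; norm_num
    exact (mul_eq_zero.1 h2).resolve_left (pow_ne_zero 4 hc)
  · intro q hq hw
    rw [eval_linSubst] at hq hw
    set w := M⁻¹.mulVec q.rep with hwdef
    have hL0 : w 0 + w 1 + w 2 - w 3 - w 4 ≠ 0 := by
      rw [eval_exceptionalForm] at hw
      intro h
      simp [h] at hw
    -- On the quartic the quadratic has a double root; the point of the fibre it gives lies on
    -- `V^ram`, since the pullback of the quartic is the square of its equation.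
    have ht : FibreEq w (-(w 0 * w 1 + w 0 * w 2 + w 1 * w 2 - w 3 * w 4) /
        (2 * (w 0 + w 1 + w 2 - w 3 - w 4))) := by
      rw [fibreEq_iff]
      rw [eval_igusaForm] at hq
      field_simp
      linear_combination -hq
    refine ⟨_, ?_, phiMaps_fibrePt hM hb hw ht⟩
    have h1 := eval_stdVec_igusaForm (fibrePt w hw _ ht).1.rep (fibrePt w hw _ ht).2.rep
    obtain ⟨c, hc, e⟩ := (phiMaps_iff hM hb _ q).1 (phiMaps_fibrePt hM hb hw ht)
    rw [e, igusaForm_isHomogeneous.eval_smul, ← hwdef, hq, mul_zero] at h1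
    exact pow_eq_zero_iff (two_ne_zero) |>.1 h1.symm
end

noncomputable section

/-! ## Integer matrices and points -/

/-- An invertible `r × r` minor bounds the rank below, and a factorization through `r` columns
bounds it above. Both certificates are integral, hence decidable. -/
theorem rank_map_intCast_of_minor {n : Type} [Fintype n] [DecidableEq n] {r : ℕ}
    (H : Matrix n n ℤ) (I : Fin r → n) (K : Matrix (Fin r) (Fin r) ℤ)
    (h1 : H.submatrix I I * K = 1)
    (h2 : H.submatrix id I * K * H.submatrix I id = H) :
    (H.map (Int.castRingHom ℂ)).rank = r := by
  apply le_antisymm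
  · rw [← h2, Matrix.map_mul]
    refine (Matrix.rank_mul_le_left _ _).trans ((Matrix.rank_le_card_width _).trans ?_)
    simp
  · have h3 := congrArg (fun A : Matrix (Fin r) (Fin r) ℤ => A.map (Int.castRingHom ℂ)) h1
    simp only [Matrix.map_mul] at h3
    have h4 : IsUnit ((H.submatrix I I).map (Int.castRingHom ℂ)) :=
      IsUnit.of_mul_eq_one (K.map (Int.castRingHom ℂ)) (by rw [h3]; simp)
    have h5 := Matrix.rank_of_isUnit _ h4
    rw [Fintype.card_fin] at h5
    rw [← h5, ← Matrix.submatrix_map]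
    exact Matrix.rank_submatrix_le _ _ _

theorem Matrix.rank_smul_eq {m n : Type} [Fintype n] [Fintype m] {c : ℂ} (hc : c ≠ 0)
    (H : Matrix m n ℂ) : (c • H).rank = H.rank := by
  classical
  have h : c • H = (c • (1 : Matrix m m ℂ)) * H := by rw [Matrix.smul_mul, Matrix.one_mul]
  rw [h]
  refine Matrix.rank_mul_eq_right_of_isUnit_det _ _ ?_
  rw [Matrix.det_smul, Matrix.det_one, mul_one]
  exact (pow_ne_zero _ hc).isUnit

/-- The complex vector with given integer coordinates. -/
def intVec {n : Type} (v : n → ℤ) : n → ℂ := fun i => (v i : ℂ)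

theorem intVec_ne_zero {n : Type} {v : n → ℤ} (h : v ≠ 0) : intVec v ≠ 0 := by
  intro h'
  apply h
  ext i
  have := congrFun h' i
  simpa [intVec] using this

theorem intVec_not_proportional {n : Type} {v w : n → ℤ} (h : ∃ i j, v i * w j ≠ v j * w i)
    (c : ℂ) : c • intVec v ≠ intVec w := by
  rintro h'
  obtain ⟨i, j, hij⟩ := h
  apply hij
  have hi := congrFun h' i
  have hj := congrFun h' j
  simp [intVec] at hi hj
  have : (v i * w j : ℂ) = v j * w i := by rw [← hi, ← hj]; ring
  exact_mod_cast this

/-! ## The Segre cubic -/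

/-- The Segre cubic `α₀ α₁ α₂ + β₀ β₁ β₂ = 0`, `α₀ + α₁ + α₂ + β₀ + β₁ + β₂ = 0`, in the coordinates
`α₀, α₁, α₂, β₀, β₁`. -/
def segreForm : MvPolynomial (Fin 5) ℂ :=
  X 0 * X 1 * X 2 - X 3 * X 4 * (X 0 + X 1 + X 2 + X 3 + X 4)

theorem segreForm_isHomogeneous : segreForm.IsHomogeneous 3 := by
  have hX := fun i : Fin 5 => isHomogeneous_X ℂ i
  exact (((hX 0).mul (hX 1)).mul (hX 2)).sub
    (((hX 3).mul (hX 4)).mul (((((hX 0).add (hX 1)).add (hX 2)).add (hX 3)).add (hX 4)))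

theorem eval_segreForm (v : Fin 5 → ℂ) : eval v segreForm =
    v 0 * v 1 * v 2 - v 3 * v 4 * (v 0 + v 1 + v 2 + v 3 + v 4) := by
  simp [segreForm]

theorem gradAt_segreForm (v : Fin 5 → ℂ) : gradAt segreForm v =
    ![v 1 * v 2 - v 3 * v 4, v 0 * v 2 - v 3 * v 4, v 0 * v 1 - v 3 * v 4,
      -(v 4 * (v 0 + v 1 + v 2 + v 3 + v 4)) - v 3 * v 4,
      -(v 3 * (v 0 + v 1 + v 2 + v 3 + v 4)) - v 3 * v 4] := by
  ext i
  fin_cases i <;> simp [gradAt, segreForm, pderiv_X, Derivation.leibniz] <;> ring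

/-- The Hessian matrix of the Segre cubic. -/
def segreHess {R : Type} [CommRing R] (v : Fin 5 → R) : Matrix (Fin 5) (Fin 5) R :=
  !![0, v 2, v 1, -v 4, -v 3;
     v 2, 0, v 0, -v 4, -v 3;
     v 1, v 0, 0, -v 4, -v 3;
     -v 4, -v 4, -v 4, -2 * v 4, -(v 0 + v 1 + v 2 + 2 * v 3 + 2 * v 4);
     -v 3, -v 3, -v 3, -(v 0 + v 1 + v 2 + 2 * v 3 + 2 * v 4), -2 * v 3]

theorem hessianAt_segreForm (v : Fin 5 → ℂ) : hessianAt segreForm v = segreHess v := by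
  ext i j
  fin_cases i <;> fin_cases j <;>
    simp [hessianAt, segreHess, segreForm, pderiv_X, Pi.single_apply, Derivation.leibniz] <;> ring

theorem segreHess_intVec (v : Fin 5 → ℤ) :
    segreHess (intVec v) = (segreHess v).map (Int.castRingHom ℂ) := by
  ext i j
  fin_cases i <;> fin_cases j <;> simp [segreHess, intVec]

theorem segreHess_smul (c : ℂ) (v : Fin 5 → ℂ) : segreHess (c • v) = c • segreHess v := by
  ext i j
  fin_cases i <;> fin_cases j <;> simp [segreHess] <;> ring

/-- The nodes of the Segre cubic. -/
def segreNode : Fin 10 → Fin 5 → ℤ :=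
  ![![1, 1, 1, -1, -1],
    ![1, 0, 0, -1, 0],
    ![1, 0, 0, 0, -1],
    ![1, 0, 0, 0, 0],
    ![0, 1, 0, -1, 0],
    ![0, 1, 0, 0, -1],
    ![0, 1, 0, 0, 0],
    ![0, 0, 1, -1, 0],
    ![0, 0, 1, 0, -1],
    ![0, 0, 1, 0, 0]]

/-- The rows and columns of an invertible minor of the Hessian. -/
def segreMinor : Fin 10 → Fin 4 → Fin 5 :=
  ![![0, 1, 2, 3],
    ![0, 1, 2, 4],
    ![0, 1, 2, 3],
    ![1, 2, 3, 4],
    ![0, 1, 2, 4],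
    ![0, 1, 2, 3],
    ![0, 2, 3, 4],
    ![0, 1, 2, 4],
    ![0, 1, 2, 3],
    ![0, 1, 3, 4]]

/-- The inverse of that minor. -/
def segreMinorInv : Fin 10 → Matrix (Fin 4) (Fin 4) ℤ :=
  ![!![0, 1, 1, -1; 1, 0, 1, -1; 1, 1, 0, -1; -1, -1, -1, 2],
    !![0, -1, -1, 1; -1, 0, 1, 0; -1, 1, 0, 0; 1, 0, 0, 0],
    !![0, -1, -1, 1; -1, 0, 1, 0; -1, 1, 0, 0; 1, 0, 0, 0],
    !![0, 1, 0, 0; 1, 0, 0, 0; 0, 0, 0, -1; 0, 0, -1, 0],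
    !![0, -1, 1, 0; -1, 0, -1, 1; 1, -1, 0, 0; 0, 1, 0, 0],
    !![0, -1, 1, 0; -1, 0, -1, 1; 1, -1, 0, 0; 0, 1, 0, 0],
    !![0, 1, 0, 0; 1, 0, 0, 0; 0, 0, 0, -1; 0, 0, -1, 0],
    !![0, 1, -1, 0; 1, 0, -1, 0; -1, -1, 0, 1; 0, 0, 1, 0],
    !![0, 1, -1, 0; 1, 0, -1, 0; -1, -1, 0, 1; 0, 0, 1, 0],
    !![0, 1, 0, 0; 1, 0, 0, 0; 0, 0, 0, -1; 0, 0, -1, 0]]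

theorem rank_segreHess_segreNode (k : Fin 10) :
    (segreHess (intVec (segreNode k))).rank = 4 := by
  rw [segreHess_intVec]
  refine rank_map_intCast_of_minor _ (segreMinor k) (segreMinorInv k) ?_ ?_ <;> revert k <;> decide

theorem gradAt_segreForm_smul (c : ℂ) (v : Fin 5 → ℂ) :
    gradAt segreForm (c • v) = c ^ 2 • gradAt segreForm v := by
  rw [gradAt_segreForm, gradAt_segreForm]
  ext i
  fin_cases i <;> simp <;> ring

theorem gradAt_segreNode (k : Fin 10) : gradAt segreForm (intVec (segreNode k)) = 0 := by
  rw [gradAt_segreForm]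
  ext i
  fin_cases k <;> fin_cases i <;> simp [segreNode, intVec]

/-- With `β₂` minus the sum of the coordinates, a zero of the gradient is a point where all products
`αⱼ αₖ` and `βⱼ βₖ`, `j ≠ k`, have one common value. If it is zero, at most one `α` and one `β`
survive, and they are opposite: nine points. Otherwise the `α` are equal and the `β` are equal,
which gives the tenth. -/
theorem exists_segreNode_of_gradAt_eq_zero {v : Fin 5 → ℂ} (hv : gradAt segreForm v = 0) :
    ∃ (k : Fin 10) (c : ℂ), v = c • intVec (segreNode k) := by
  rw [gradAt_segreForm] at hv
  have h0 := congrFun hv 0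
  have h1 := congrFun hv 1
  have h2 := congrFun hv 2
  have h3 := congrFun hv 3
  have h4 := congrFun hv 4
  simp at h0 h1 h2 h3 h4
  obtain ⟨a, ha⟩ : ∃ a, a = v 0 := ⟨_, rfl⟩
  obtain ⟨b, hb⟩ : ∃ a, a = v 1 := ⟨_, rfl⟩
  obtain ⟨c, hc⟩ : ∃ a, a = v 2 := ⟨_, rfl⟩
  obtain ⟨d, hd⟩ : ∃ a, a = v 3 := ⟨_, rfl⟩
  obtain ⟨e, he⟩ : ∃ a, a = v 4 := ⟨_, rfl⟩
  have hv' : v = ![a, b, c, d, e] := by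
    ext i; fin_cases i <;> simp [*]
  simp only [← ha, ← hb, ← hc, ← hd, ← he] at h0 h1 h2 h3 h4
  rw [hv']
  clear hv hv' ha hb hc hd he
  by_cases hde : d * e = 0
  · have hbc : b * c = 0 := by linear_combination h0 + hde
    have hac : a * c = 0 := by linear_combination h1 + hde
    have hab : a * b = 0 := by linear_combination h2 + hde
    have hef : e * (a + b + c + d + e) = 0 := by linear_combination -h3 - hde
    have hdf : d * (a + b + c + d + e) = 0 := by linear_combination -h4 - hde
    have two : ∀ p q r : ℂ, p * q = 0 → p * r = 0 → q * r = 0 →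
        (q = 0 ∧ r = 0) ∨ (p = 0 ∧ r = 0) ∨ (p = 0 ∧ q = 0) := by
      intro p q r hpq hpr hqr
      rw [mul_eq_zero] at hpq hpr hqr
      tauto
    rcases two a b c hab hac hbc with ⟨rfl, rfl⟩ | ⟨rfl, rfl⟩ | ⟨rfl, rfl⟩ <;>
      rcases two d e _ hde hdf hef with ⟨rfl, h⟩ | ⟨rfl, h⟩ | ⟨rfl, rfl⟩
    · exact ⟨1, a, by ext i; fin_cases i <;> simp [segreNode, intVec]; linear_combination h⟩
    · exact ⟨2, a, by ext i; fin_cases i <;> simp [segreNode, intVec]; linear_combination h⟩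
    · exact ⟨3, a, by ext i; fin_cases i <;> simp [segreNode, intVec]⟩
    · exact ⟨4, b, by ext i; fin_cases i <;> simp [segreNode, intVec]; linear_combination h⟩
    · exact ⟨5, b, by ext i; fin_cases i <;> simp [segreNode, intVec]; linear_combination h⟩
    · exact ⟨6, b, by ext i; fin_cases i <;> simp [segreNode, intVec]⟩
    · exact ⟨7, c, by ext i; fin_cases i <;> simp [segreNode, intVec]; linear_combination h⟩
    · exact ⟨8, c, by ext i; fin_cases i <;> simp [segreNode, intVec]; linear_combination h⟩
    · exact ⟨9, c, by ext i; fin_cases i <;> simp [segreNode, intVec]⟩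
  · obtain ⟨hd, he⟩ := mul_ne_zero_iff.1 hde
    have hbc : b * c ≠ 0 := fun h => hde (by linear_combination h - h0)
    obtain ⟨hb, hc⟩ := mul_ne_zero_iff.1 hbc
    obtain rfl : a = b := mul_right_cancel₀ hc (by linear_combination h1 - h0)
    obtain rfl : a = c := mul_right_cancel₀ hb (by linear_combination h2 - h0)
    have e1 : -(a + a + a + d + e) = d := mul_left_cancel₀ he (by linear_combination h3)
    have e2 : -(a + a + a + d + e) = e := mul_left_cancel₀ hd (by linear_combination h4)
    refine ⟨0, a, ?_⟩
    ext i
    fin_cases i <;> simp [segreNode, intVec]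
    · linear_combination -(2 / 3 : ℂ) * e1 + (1 / 3 : ℂ) * e2
    · linear_combination (1 / 3 : ℂ) * e1 - (2 / 3 : ℂ) * e2

theorem segreNode_ne_zero (k : Fin 10) : segreNode k ≠ 0 := by
  revert k; decide

theorem segreNode_not_proportional {k l : Fin 10} (h : k ≠ l) :
    ∃ i j, segreNode k i * segreNode l j ≠ segreNode k j * segreNode l i := by
  revert k l; decide

theorem isSegrePrimal_linSubst {N : Matrix (Fin 5) (Fin 5) ℂ} (hN : IsUnit N.det) :
    IsSegrePrimal (linSubst N segreForm) := by
  have hNt : IsUnit N.transpose.det := by rwa [Matrix.det_transpose]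
  have hinv : ∀ v w, N.mulVec v = w ↔ v = N⁻¹.mulVec w := fun v w => by
    constructor
    · rintro rfl
      simp [Matrix.nonsing_inv_mul N hN]
    · rintro rfl
      simp [Matrix.mul_nonsing_inv N hN]
  have hne : ∀ k, N⁻¹.mulVec (intVec (segreNode k)) ≠ 0 := fun k h => by
    have := (hinv _ _).2 h.symm
    rw [Matrix.mulVec_zero] at this
    exact intVec_ne_zero (segreNode_ne_zero k) this.symm
  have hmem : ∀ p : P4, p ∈ singPts (linSubst N segreForm) ↔
      gradAt segreForm (N.mulVec p.rep) = 0 := fun p => by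
    have h1 : p ∈ singPts (linSubst N segreForm) ↔ gradAt (linSubst N segreForm) p.rep = 0 :=
      funext_iff.symm
    rw [h1, gradAt_linSubst]
    refine ⟨fun h => ?_, fun h => by rw [h, Matrix.mulVec_zero]⟩
    have := congrArg (N.transpose⁻¹.mulVec) h
    simpa [Matrix.nonsing_inv_mul _ hNt] using this
  have hsing : singPts (linSubst N segreForm) =
      Set.range fun k => Projectivization.mk ℂ _ (hne k) := by
    ext p
    rw [hmem]
    constructor
    · intro h
      obtain ⟨k, c, hk⟩ := exists_segreNode_of_gradAt_eq_zero h
      refine ⟨k, ?_⟩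
      conv_rhs => rw [← p.mk_rep]
      rw [eq_comm]
      refine (Projectivization.mk_eq_mk_iff' _ _ _ _ _).2 ⟨c, ?_⟩
      rw [← Matrix.mulVec_smul, ← hk, eq_comm, ← hinv]
    · rintro ⟨k, rfl⟩
      obtain ⟨c, hc, e⟩ := exists_rep_mk_eq_smul _ (hne k)
      rw [e, Matrix.mulVec_smul, Matrix.mulVec_mulVec, Matrix.mul_nonsing_inv N hN,
        Matrix.one_mulVec, gradAt_segreForm_smul, gradAt_segreNode, smul_zero]
  refine ⟨linSubst_isHomogeneous _ segreForm_isHomogeneous, ?_, fun p hp => ⟨hp, ?_⟩⟩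
  · rw [hsing, ← Set.image_univ, Set.ncard_image_of_injective, Set.ncard_univ, Nat.card_fin]
    intro k l hkl
    by_contra hne'
    obtain ⟨c, hc⟩ := (Projectivization.mk_eq_mk_iff' _ _ _ _ _).1 hkl
    rw [← Matrix.mulVec_smul, ← hinv, Matrix.mulVec_mulVec, Matrix.mul_nonsing_inv N hN,
      Matrix.one_mulVec] at hc
    exact intVec_not_proportional (segreNode_not_proportional (Ne.symm hne')) c hc
  · rw [hsing] at hp
    obtain ⟨k, rfl⟩ := hp
    obtain ⟨c, hc, e⟩ := exists_rep_mk_eq_smul _ (hne k)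
    rw [e, hessianAt_linSubst, Matrix.mulVec_smul, Matrix.mulVec_mulVec,
      Matrix.mul_nonsing_inv N hN, Matrix.one_mulVec, hessianAt_segreForm, segreHess_smul,
      Matrix.rank_mul_eq_left_of_isUnit_det _ _ hN, Matrix.rank_mul_eq_right_of_isUnit_det _ _ hNt,
      Matrix.rank_smul_eq hc, rank_segreHess_segreNode]

/-! ## The dual of the Segre cubic -/

/-- After adding `t = β₀ β₁`, the gradient lists the products `αⱼ αₖ` and, with `t` itself, the
products `βⱼ βₖ`. On the cubic the two triples have the same product and the same second symmetric
function, so `t` is a double root of the fibre equation of the gradient. -/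
theorem eval_gradAt_igusaForm {v : Fin 5 → ℂ} (hv : eval v segreForm = 0) :
    eval (gradAt segreForm v) igusaForm = 0 := by
  rw [eval_igusaForm, gradAt_segreForm]
  rw [eval_segreForm] at hv
  simp
  linear_combination ((v 0 * v 1 * v 2 - v 3 * v 4 * (v 0 + v 1 + v 2 + v 3 + v 4)) *
    (v 0 + v 1 + v 2) ^ 2 - 4 * (v 0 * v 1 + v 0 * v 2 + v 1 * v 2 -
      (v 3 * v 4 - (v 3 + v 4) * (v 0 + v 1 + v 2 + v 3 + v 4))) *
    (v 0 * v 1 * v 2 + v 3 * v 4 * (v 0 + v 1 + v 2 + v 3 + v 4))) * hv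

/-- Inverts the polar map: from the double root `t`, take as `α` the products of pairs among `wᵢ +
t`, `i < 3`, and as `β` minus those among `w₃ + t, w₄ + t, t`. The root equation puts the point on
the cubic. -/
theorem exists_gradAt_eq_smul {w : Fin 5 → ℂ} (hw : eval w exceptionalForm ≠ 0)
    (h : eval w igusaForm = 0) :
    ∃ (v : Fin 5 → ℂ) (c : ℂ), eval v segreForm = 0 ∧ c ≠ 0 ∧ gradAt segreForm v = c • w := by
  rw [eval_igusaForm] at h
  have hL0 : w 0 + w 1 + w 2 - w 3 - w 4 ≠ 0 := by
    rw [eval_exceptionalForm] at hw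
    intro h
    simp [h] at hw
  obtain ⟨t, ht⟩ : ∃ t, 2 * (w 0 + w 1 + w 2 - w 3 - w 4) * t +
      (w 0 * w 1 + w 0 * w 2 + w 1 * w 2 - w 3 * w 4) = 0 :=
    ⟨-(w 0 * w 1 + w 0 * w 2 + w 1 * w 2 - w 3 * w 4) / (2 * (w 0 + w 1 + w 2 - w 3 - w 4)), by
      field_simp; ring⟩
  have hF : FibreEq w t := by
    rw [fibreEq_iff]
    apply mul_left_cancel₀ (mul_ne_zero (show (4 : ℂ) ≠ 0 by norm_num) hL0)
    linear_combination (2 * (w 0 + w 1 + w 2 - w 3 - w 4) * t +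
      (w 0 * w 1 + w 0 * w 2 + w 1 * w 2 - w 3 * w 4)) * ht - h
  obtain ⟨n0, n1, n2, n3, n4, n5⟩ := hF.ne_zero hw
  unfold FibreEq at hF
  -- The derivative of the fibre equation at the double root; it becomes the condition that the six
  -- coordinates `α, β` sum to zero.
  have hE : (w 0 + t) * (w 1 + t) + (w 0 + t) * (w 2 + t) + (w 1 + t) * (w 2 + t) =
      (w 3 + t) * (w 4 + t) + (w 3 + t) * t + (w 4 + t) * t := by
    linear_combination ht
  obtain ⟨v, hv⟩ : ∃ v : Fin 5 → ℂ, v = ![(w 1 + t) * (w 2 + t), (w 0 + t) * (w 2 + t),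
    (w 0 + t) * (w 1 + t), -((w 4 + t) * t), -((w 3 + t) * t)] := ⟨_, rfl⟩
  have hsum : v 0 + v 1 + v 2 + v 3 + v 4 = (w 3 + t) * (w 4 + t) := by
    simp [hv]
    linear_combination hE
  refine ⟨v, (w 3 + t) * (w 4 + t) * t, ?_, mul_ne_zero (mul_ne_zero n3 n4) n5, ?_⟩
  · rw [eval_segreForm, hsum, hv]
    simp
    linear_combination ((w 0 + t) * (w 1 + t) * (w 2 + t) + (w 3 + t) * (w 4 + t) * t) * hF
  · rw [gradAt_segreForm, hsum, hv]
    ext i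
    fin_cases i
    · simp
      linear_combination (w 0 + t) * hF
    · simp
      linear_combination (w 1 + t) * hF
    · simp
      linear_combination (w 2 + t) * hF
    · simp
      ring
    · simp
      ring

/-- Gradients transform by the transposed matrix, so substituting `Mᵀ` in the cubic moves its dual
by `M`, that is, substitutes `M⁻¹` in the quartic. -/
theorem dualVariety_linSubst_segreForm {M : Matrix (Fin 5) (Fin 5) ℂ} (hM : IsUnit M.det) :
    dualVariety (linSubst M.transpose segreForm) =
      {q | eval q.rep (linSubst M⁻¹ igusaForm) = 0} := by
  have hM' : IsUnit (M⁻¹).det := Matrix.isUnit_nonsing_inv_det M hM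
  have hMt : IsUnit M.transpose.det := by rwa [Matrix.det_transpose]
  refine zariskiClosure_eq_hypersurface (linSubst_isHomogeneous _ igusaForm_isHomogeneous)
    (linSubst_isHomogeneous _ exceptionalForm_isHomogeneous) (by norm_num)
    (linSubst_irreducible hM' irreducible_igusaForm)
    (fun h => not_igusaForm_dvd_exceptionalForm ((linSubst_dvd_linSubst_iff hM').1 h)) ?_ ?_
  · rintro q ⟨p, hp, h, rfl⟩
    rw [eval_rep_mk_eq_zero_iff (linSubst_isHomogeneous _ igusaForm_isHomogeneous), eval_linSubst,
      gradAt_linSubst, Matrix.mulVec_mulVec, Matrix.transpose_transpose,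
      Matrix.nonsing_inv_mul M hM, Matrix.one_mulVec]
    rw [eval_linSubst] at hp
    exact eval_gradAt_igusaForm hp
  · intro q hq hw
    rw [eval_linSubst] at hq hw
    obtain ⟨v, c, hv, hc, e⟩ := exists_gradAt_eq_smul hw hq
    have hv0 : M.transpose⁻¹.mulVec v ≠ 0 := by
      intro h0
      have : v = 0 := by
        have := congrArg M.transpose.mulVec h0
        simpa [Matrix.mul_nonsing_inv _ hMt] using this
      rw [this, show (0 : Fin 5 → ℂ) = (0 : ℂ) • 0 by simp, gradAt_segreForm_smul] at e
      have h1 := congrArg M.mulVec e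
      simp [Matrix.mulVec_smul, Matrix.mul_nonsing_inv _ hM] at h1
      rw [eq_comm, smul_eq_zero] at h1
      exact q.rep_nonzero (h1.resolve_left hc)
    obtain ⟨d, hd, e'⟩ := exists_rep_mk_eq_smul _ hv0
    have hM1 : M.transpose.mulVec (Projectivization.mk ℂ _ hv0).rep = d • v := by
      rw [e', Matrix.mulVec_smul, Matrix.mulVec_mulVec, Matrix.mul_nonsing_inv _ hMt,
        Matrix.one_mulVec]
    have hgrad : gradAt (linSubst M.transpose segreForm) (Projectivization.mk ℂ _ hv0).rep =
        (d ^ 2 * c) • q.rep := by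
      rw [gradAt_linSubst, hM1, gradAt_segreForm_smul, e, Matrix.transpose_transpose, smul_smul,
        Matrix.mulVec_smul, Matrix.mulVec_mulVec, Matrix.mul_nonsing_inv _ hM, Matrix.one_mulVec]
    refine ⟨Projectivization.mk ℂ _ hv0, ?_, ?_, ?_⟩
    · rw [eval_linSubst, hM1, segreForm_isHomogeneous.eval_smul, hv, mul_zero]
    · rw [hgrad]
      exact smul_ne_zero (mul_ne_zero (pow_ne_zero 2 hd) hc) q.rep_nonzero
    · conv_rhs => rw [← q.mk_rep]
      exact (Projectivization.mk_eq_mk_iff' _ _ _ _ _).2 ⟨_, hgrad.symm⟩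

theorem isIgusaQuartic_imageOfHypersurface {b : Fin 5 → BiPoly} {M : Matrix (Fin 5) (Fin 5) ℂ}
    (hM : IsUnit M.det) (hb : ∀ k, b k = ∑ l, C (M k l) * stdForms l) :
    IsIgusaQuartic (imageOfHypersurface b vRam) := by
  have hMt : IsUnit M.transpose.det := by rwa [Matrix.det_transpose]
  refine ⟨⟨linSubst M⁻¹ igusaForm, linSubst_isHomogeneous _ igusaForm_isHomogeneous,
    linSubst_irreducible (Matrix.isUnit_nonsing_inv_det M hM) irreducible_igusaForm,
    imageOfHypersurface_vRam hM hb⟩, linSubst M.transpose segreForm,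
    isSegrePrimal_linSubst hMt, ?_⟩
  rw [imageOfHypersurface_vRam hM hb, dualVariety_linSubst_segreForm hM]

end

noncomputable section

/-! ## The ramification divisor -/

/-- The matrix of the dehomogenized forms and their partial derivatives. -/
def jetMatrix (b : Fin 5 → BiPoly) (i j : Fin 3) :
    Matrix (Unit ⊕ (Fin 2 ⊕ Fin 2)) (Fin 5) (MvPolynomial (Fin 2 ⊕ Fin 2) ℂ) :=
  Matrix.of fun m l => m.elim (fun _ => dehom i j (b l)) fun m => pderiv m (dehom i j (b l))

/-- The indices of five forms, starting with `k`. -/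
def indexEquiv (k : Fin 5) : Unit ⊕ (Fin 2 ⊕ Fin 2) ≃ Fin 5 :=
  (Equiv.sumComm _ _).trans
    ((Equiv.optionEquivSumPUnit _).symm.trans
      ((Equiv.optionCongr finSumFinEquiv).trans (finSuccEquiv' k).symm))

theorem indexEquiv_inl (k : Fin 5) (u : Unit) : indexEquiv k (Sum.inl u) = k := by
  simp [indexEquiv]

theorem indexEquiv_inr (k : Fin 5) (l : Fin 2 ⊕ Fin 2) :
    indexEquiv k (Sum.inr l) = k.succAbove (finSumFinEquiv l) := by
  simp [indexEquiv]

/-- The quotient rule as column operations: scale the other columns by `β` and subtract multiples of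
column `k` so that the row of values becomes `(β, 0, 0, 0, 0)`. The remaining block is the Jacobian
numerator. -/
theorem pow_mul_det_jetMatrix (b : Fin 5 → BiPoly) (i j : Fin 3) (k : Fin 5) :
    ((jetMatrix b i j).submatrix id (indexEquiv k)).det * dehom i j (b k) ^ 4 =
      dehom i j (b k) * jacobianNumerator b i j k := by
  set β := dehom i j (b k) with hβ
  have h1 : ((jetMatrix b i j).submatrix id (indexEquiv k)) *
      Matrix.fromBlocks 1 (Matrix.of fun _ l => -dehom i j (b (k.succAbove (finSumFinEquiv l)))) 0
        (Matrix.diagonal fun _ => β) =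
      Matrix.fromBlocks (Matrix.of fun _ _ => β) 0 (Matrix.of fun m _ => pderiv m β)
        (Matrix.of fun m l : Fin 2 ⊕ Fin 2 =>
          pderiv m (dehom i j (b (k.succAbove (finSumFinEquiv l)))) * β -
            dehom i j (b (k.succAbove (finSumFinEquiv l))) * pderiv m β) := by
    ext m l
    rw [Matrix.mul_apply, Fintype.sum_sum_type]
    rcases m with m | m <;> rcases l with l | l
    · simp [jetMatrix, indexEquiv_inl, hβ]
    · simp [jetMatrix, indexEquiv_inl, indexEquiv_inr, Matrix.diagonal_apply, ← hβ]
      ring_nf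
    · simp [jetMatrix, indexEquiv_inl, hβ]
    · simp [jetMatrix, indexEquiv_inl, indexEquiv_inr, Matrix.diagonal_apply, ← hβ]
      ring_nf
  have h2 := congrArg Matrix.det h1
  rw [Matrix.det_mul, Matrix.det_fromBlocks_zero₂₁, Matrix.det_fromBlocks_zero₁₂, Matrix.det_one,
    Matrix.det_diagonal, one_mul] at h2
  simpa [jacobianNumerator] using h2

theorem jetMatrix_submatrix_eq_mul {b : Fin 5 → BiPoly} {M : Matrix (Fin 5) (Fin 5) ℂ}
    (hb : ∀ k, b k = ∑ l, C (M k l) * stdForms l) (i j : Fin 3) (k : Fin 5) :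
    (jetMatrix b i j).submatrix id (indexEquiv k) =
      (jetMatrix stdForms i j).submatrix id (indexEquiv 0) *
        (M.transpose.map C).submatrix (indexEquiv 0) (indexEquiv k) := by
  ext1 m l
  have h : ∀ l, dehom i j (b l) = ∑ l', C (M l l') * dehom i j (stdForms l') := fun l => by
    rw [hb, map_sum]
    refine Finset.sum_congr rfl fun l' _ => ?_
    rw [map_mul, dehom, algHom_C]
    rfl
  rw [Matrix.mul_apply]
  simp only [Matrix.submatrix_apply, id_eq]
  rw [(indexEquiv 0).sum_comp fun l' => jetMatrix stdForms i j m l' *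
    M.transpose.map C l' (indexEquiv k l)]
  rcases m with m | m
  · simp [jetMatrix, h, mul_comm]
  · simp [jetMatrix, h, mul_comm]

theorem dehom_X_inl (i j k : Fin 3) : dehom i j (X (Sum.inl k)) =
    i.insertNth (α := fun _ => MvPolynomial (Fin 2 ⊕ Fin 2) ℂ) 1 (fun m => X (Sum.inl m)) k := by
  simp [dehom]

theorem dehom_X_inr (i j k : Fin 3) : dehom i j (X (Sum.inr k)) =
    j.insertNth (α := fun _ => MvPolynomial (Fin 2 ⊕ Fin 2) ℂ) 1 (fun m => X (Sum.inr m)) k := by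
  simp [dehom]

theorem pderiv_dehom_X (i j k : Fin 3) (m : Fin 2) :
    pderiv (Sum.inl m) (dehom i j (X (Sum.inl k))) =
        C (Pi.single (M := fun _ => ℂ) (i.succAbove m) 1 k) ∧
      pderiv (Sum.inr m) (dehom i j (X (Sum.inr k))) =
        C (Pi.single (M := fun _ => ℂ) (j.succAbove m) 1 k) ∧
      pderiv (Sum.inl m) (dehom i j (X (Sum.inr k))) = 0 ∧
      pderiv (Sum.inr m) (dehom i j (X (Sum.inl k))) = 0 := by
  simp only [dehom_X_inl, dehom_X_inr]
  refine ⟨?_, ?_, ?_, ?_⟩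
  · refine Fin.succAboveCases i ?_ (fun l => ?_) k
    · simp [(Fin.succAbove_ne i m).symm]
    · simp [pderiv_X, Pi.single_apply, apply_ite (C : ℂ → MvPolynomial (Fin 2 ⊕ Fin 2) ℂ)]
  · refine Fin.succAboveCases j ?_ (fun l => ?_) k
    · simp [(Fin.succAbove_ne j m).symm]
    · simp [pderiv_X, Pi.single_apply, apply_ite (C : ℂ → MvPolynomial (Fin 2 ⊕ Fin 2) ℂ)]
  · refine Fin.succAboveCases j ?_ (fun l => ?_) k <;> simp [pderiv_X]
  · refine Fin.succAboveCases i ?_ (fun l => ?_) k <;> simp [pderiv_X]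

set_option maxHeartbeats 4000000 in
-- By bilinearity, a partial derivative is the value with one argument replaced by a basis vector,
-- so these rows are the evaluated jets. The nine charts are expanded separately, and differ only by
-- the sign.
theorem det_stdVec (i j : Fin 3) (s t : Fin 2 → ℂ) :
    (Matrix.of ![stdVec (i.insertNth (α := fun _ => ℂ) 1 s) (j.insertNth (α := fun _ => ℂ) 1 t),
      stdVec (Pi.single (i.succAbove 0) 1) (j.insertNth (α := fun _ => ℂ) 1 t),
      stdVec (Pi.single (i.succAbove 1) 1) (j.insertNth (α := fun _ => ℂ) 1 t),
      stdVec (i.insertNth (α := fun _ => ℂ) 1 s) (Pi.single (j.succAbove 0) 1),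
      stdVec (i.insertNth (α := fun _ => ℂ) 1 s) (Pi.single (j.succAbove 1) 1)]).det =
    (-1) ^ (i + j : ℕ) * eval (Sum.elim (i.insertNth (α := fun _ => ℂ) 1 s)
      (j.insertNth (α := fun _ => ℂ) 1 t)) vRam := by
  have h : ∀ (k : Fin 3) (u : Fin 2 → ℂ), k.insertNth (α := fun _ => ℂ) 1 u =
      ![![1, u 0, u 1], ![u 0, 1, u 1], ![u 0, u 1, 1]] k := fun k u => by
    ext l
    fin_cases k <;> fin_cases l <;> rfl
  have h0 : ∀ k : Fin 3, (Pi.single (k.succAbove 0) 1 : Fin 3 → ℂ) =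
      ![![0, 1, 0], ![1, 0, 0], ![1, 0, 0]] k := fun k => by
    ext l
    fin_cases k <;> fin_cases l <;> rfl
  have h1 : ∀ k : Fin 3, (Pi.single (k.succAbove 1) 1 : Fin 3 → ℂ) =
      ![![0, 0, 1], ![0, 0, 1], ![0, 1, 0]] k := fun k => by
    ext l
    fin_cases k <;> fin_cases l <;> rfl
  rw [eval_vRam, h, h, h0, h1, h0, h1]
  fin_cases i <;> fin_cases j <;>
    simp [Matrix.det_succ_row_zero, Fin.sum_univ_succ, stdVec, Fin.succAbove] <;> ring

theorem det_jetMatrix_stdForms (i j : Fin 3) :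
    ((jetMatrix stdForms i j).submatrix id (indexEquiv 0)).det =
      (-1) ^ (i + j : ℕ) * dehom i j vRam := by
  rw [← Matrix.det_submatrix_equiv_self (indexEquiv 0).symm, Matrix.submatrix_submatrix]
  refine MvPolynomial.funext fun v => ?_
  obtain ⟨x, hx⟩ : ∃ x, x = i.insertNth (α := fun _ => ℂ) 1 fun m => v (Sum.inl m) := ⟨_, rfl⟩
  obtain ⟨y, hy⟩ : ∃ y, y = j.insertNth (α := fun _ => ℂ) 1 fun m => v (Sum.inr m) := ⟨_, rfl⟩
  have ex : ∀ k, eval v (dehom i j (X (Sum.inl k))) = x k := fun k => by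
    rw [dehom_X_inl, hx]
    refine Fin.succAboveCases i ?_ (fun l => ?_) k <;> simp
  have ey : ∀ k, eval v (dehom i j (X (Sum.inr k))) = y k := fun k => by
    rw [dehom_X_inr, hy]
    refine Fin.succAboveCases j ?_ (fun l => ?_) k <;> simp
  have h0 : ∀ l, eval v (dehom i j (stdForms l)) = stdVec x y l := fun l => by
    fin_cases l <;> simp [stdForms, stdVec, ex, ey]
  have h1 : ∀ m l, eval v (pderiv (Sum.inl m) (dehom i j (stdForms l))) =
      stdVec (Pi.single (i.succAbove m) 1) y l := fun m l => by
    fin_cases l <;> simp [stdForms, stdVec, pderiv_dehom_X, ey, mul_comm]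
  have h2 : ∀ m l, eval v (pderiv (Sum.inr m) (dehom i j (stdForms l))) =
      stdVec x (Pi.single (j.succAbove m) 1) l := fun m l => by
    fin_cases l <;> simp [stdForms, stdVec, pderiv_dehom_X, ex]
  have h3 : eval v (dehom i j vRam) = eval (Sum.elim x y) vRam := by
    rw [eval_vRam]
    simp [vRam, ex, ey]
  have key := det_stdVec i j (fun m => v (Sum.inl m)) (fun m => v (Sum.inr m))
  rw [← hx, ← hy] at key
  rw [map_mul, h3, map_pow, map_neg, map_one, ← key, RingHom.map_det]
  have hidx : ∀ l, indexEquiv 0 (Sum.inr l) = (finSumFinEquiv l).succ := fun l => by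
    rw [indexEquiv_inr, Fin.succAbove_zero]
  have e0 : (indexEquiv 0).symm 0 = Sum.inl () := by
    rw [Equiv.symm_apply_eq, indexEquiv_inl]
  have e1 : (indexEquiv 0).symm 1 = Sum.inr (Sum.inl 0) := by
    rw [Equiv.symm_apply_eq, hidx]; rfl
  have e2 : (indexEquiv 0).symm 2 = Sum.inr (Sum.inl 1) := by
    rw [Equiv.symm_apply_eq, hidx]; rfl
  have e3 : (indexEquiv 0).symm 3 = Sum.inr (Sum.inr 0) := by
    rw [Equiv.symm_apply_eq, hidx]; rfl
  have e4 : (indexEquiv 0).symm 4 = Sum.inr (Sum.inr 1) := by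
    rw [Equiv.symm_apply_eq, hidx]; rfl
  congr 1
  ext k l
  simp only [RingHom.mapMatrix_apply, Matrix.map_apply, Matrix.submatrix_apply,
    Function.comp_apply, id_eq, Equiv.apply_symm_apply, jetMatrix, Matrix.of_apply]
  fin_cases k
  · simp only [Fin.zero_eta, e0]; exact h0 l
  · simp only [Fin.mk_one, e1]; exact h1 0 l
  · simp only [Fin.reduceFinMk, e2]; exact h1 1 l
  · simp only [Fin.reduceFinMk, e3]; exact h2 0 l
  · simp only [Fin.reduceFinMk, e4]; exact h2 1 l

/-- Once `β` is inverted, the Jacobian numerator and the equation differ by powers of `β`, a sign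
and the determinant of the change of basis, all units. -/
theorem isRamificationDivisor_vRam {b : Fin 5 → BiPoly} {M : Matrix (Fin 5) (Fin 5) ℂ}
    (hM : IsUnit M.det) (hb : ∀ k, b k = ∑ l, C (M k l) * stdForms l) :
    IsRamificationDivisor b vRam := by
  refine ⟨fun h => ?_, fun i j k => ?_⟩
  · have h1 := congrArg (eval (Sum.elim ![1, 2, 4] ![1, 3, 2])) h
    rw [eval_vRam] at h1
    simp at h1
    norm_num at h1
  · set β := dehom i j (b k)
    set ρ := algebraMap (MvPolynomial (Fin 2 ⊕ Fin 2) ℂ) (Localization.Away β)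
    have hβ : IsUnit (ρ β) := IsLocalization.Away.algebraMap_isUnit β
    have hA : IsUnit (M.transpose.map (C : ℂ →+* MvPolynomial (Fin 2 ⊕ Fin 2) ℂ)) := by
      rw [Matrix.isUnit_iff_isUnit_det]
      have := hM.map (C : ℂ →+* MvPolynomial (Fin 2 ⊕ Fin 2) ℂ)
      rw [← Matrix.det_transpose, RingHom.map_det] at this
      exact this
    have hA' := (Matrix.isUnit_iff_isUnit_det _).1
      ((Matrix.isUnit_submatrix_equiv (indexEquiv 0) (indexEquiv k)).2 hA)
    have h1 := pow_mul_det_jetMatrix b i j k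
    rw [jetMatrix_submatrix_eq_mul hb, Matrix.det_mul, det_jetMatrix_stdForms] at h1
    have h2 := congrArg ρ h1
    simp only [map_mul ρ] at h2
    have u1 : IsUnit (ρ ((-1) ^ (i + j : ℕ))) :=
      IsUnit.map ρ ((IsUnit.neg isUnit_one).pow _)
    have a1 : Associated (ρ β * ρ (jacobianNumerator b i j k)) (ρ (jacobianNumerator b i j k)) :=
      associated_unit_mul_left _ _ hβ
    refine a1.symm.trans ?_
    rw [← h2, mul_assoc, mul_assoc]
    refine (associated_unit_mul_left _ _ u1).trans ?_
    refine associated_mul_unit_left _ _ ((hA'.map ρ).mul ?_)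
    rw [map_pow]
    exact hβ.pow 4

end

noncomputable section

/-! ## The singular points of the threefold

With the conics `A = (x₀ - x₁) x₂` and `B = x₀ (x₁ - x₂)` the equation is
`A(x) B(y) - B(x) A(y)`. -/

section

variable {R : Type} [CommRing R]

/-- The first conic of the pencil through the four points. -/
def conicA (x : Fin 3 → R) : R := (x 0 - x 1) * x 2

/-- The second conic of the pencil through the four points. -/
def conicB (x : Fin 3 → R) : R := x 0 * (x 1 - x 2)

/-- The gradient of `conicA`. -/
def gradConicA (x : Fin 3 → R) : Fin 3 → R := ![x 2, -x 2, x 0 - x 1]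

/-- The gradient of `conicB`. -/
def gradConicB (x : Fin 3 → R) : Fin 3 → R := ![x 1 - x 2, x 0, -x 0]

/-- The partial derivatives of `vRam` in `x`. -/
def vRamGradX (x y : Fin 3 → R) : Fin 3 → R :=
  conicB y • gradConicA x - conicA y • gradConicB x

/-- The partial derivatives of `vRam` in `y`. -/
def vRamGradY (x y : Fin 3 → R) : Fin 3 → R :=
  conicA x • gradConicB y - conicB x • gradConicA y

/-- The Hessian matrix of `vRam`. -/
def vRamHess (x y : Fin 3 → R) : Matrix (Fin 3 ⊕ Fin 3) (Fin 3 ⊕ Fin 3) R :=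
  Matrix.fromBlocks
    (conicB y • !![0, 0, 1; 0, 0, -1; 1, -1, 0] - conicA y • !![0, 1, -1; 1, 0, 0; -1, 0, 0])
    (Matrix.of fun i j => gradConicA x i * gradConicB y j - gradConicB x i * gradConicA y j)
    (Matrix.of fun j i => gradConicA x i * gradConicB y j - gradConicB x i * gradConicA y j)
    (conicA x • !![0, 1, -1; 1, 0, 0; -1, 0, 0] - conicB x • !![0, 0, 1; 0, 0, -1; 1, -1, 0])

end

/-- The `x`-coordinates of the singular points. -/
def vRamNodeX : Fin 19 → Fin 3 → ℤ :=
  ![![1, 0, 0], ![1, 0, 0], ![1, 0, 0], ![1, 0, 0],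
    ![0, 1, 0], ![0, 1, 0], ![0, 1, 0], ![0, 1, 0],
    ![0, 0, 1], ![0, 0, 1], ![0, 0, 1], ![0, 0, 1],
    ![1, 1, 1], ![1, 1, 1], ![1, 1, 1], ![1, 1, 1],
    ![1, 1, 0], ![0, 1, 1], ![1, 0, 1]]

/-- The `y`-coordinates of the singular points. -/
def vRamNodeY : Fin 19 → Fin 3 → ℤ :=
  ![![1, 0, 0], ![0, 1, 0], ![0, 0, 1], ![1, 1, 1],
    ![1, 0, 0], ![0, 1, 0], ![0, 0, 1], ![1, 1, 1],
    ![1, 0, 0], ![0, 1, 0], ![0, 0, 1], ![1, 1, 1],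
    ![1, 0, 0], ![0, 1, 0], ![0, 0, 1], ![1, 1, 1],
    ![1, 1, 0], ![0, 1, 1], ![1, 0, 1]]

/-- The rows and columns of an invertible minor of the Hessian. -/
def vRamMinor : Fin 19 → Fin 4 → Fin 3 ⊕ Fin 3 :=
  ![![.inl 1, .inl 2, .inr 1, .inr 2],
    ![.inl 1, .inl 2, .inr 0, .inr 2],
    ![.inl 1, .inl 2, .inr 0, .inr 1],
    ![.inl 1, .inl 2, .inr 1, .inr 2],
    ![.inl 0, .inl 2, .inr 1, .inr 2],
    ![.inl 0, .inl 2, .inr 0, .inr 2],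
    ![.inl 0, .inl 2, .inr 0, .inr 1],
    ![.inl 0, .inl 2, .inr 0, .inr 2],
    ![.inl 0, .inl 1, .inr 1, .inr 2],
    ![.inl 0, .inl 1, .inr 0, .inr 2],
    ![.inl 0, .inl 1, .inr 0, .inr 1],
    ![.inl 0, .inl 1, .inr 0, .inr 1],
    ![.inl 1, .inl 2, .inr 1, .inr 2],
    ![.inl 0, .inl 2, .inr 0, .inr 2],
    ![.inl 0, .inl 1, .inr 0, .inr 1],
    ![.inl 0, .inl 1, .inr 0, .inr 1],
    ![.inl 0, .inl 2, .inr 0, .inr 2],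
    ![.inl 0, .inl 1, .inr 0, .inr 1],
    ![.inl 0, .inl 1, .inr 0, .inr 1]]

/-- The inverse of that minor. -/
def vRamMinorInv : Fin 19 → Matrix (Fin 4) (Fin 4) ℤ :=
  ![!![0, 0, 0, -1; 0, 0, 1, 0; 0, 1, 0, 0; -1, 0, 0, 0],
    !![0, 0, 1, 1; 0, 0, 1, 0; 1, 1, 0, 0; 1, 0, 0, 0],
    !![0, 0, -1, 0; 0, 0, -1, -1; -1, -1, 0, 0; 0, -1, 0, 0],
    !![0, 0, 1, 0; 0, 0, 0, -1; 1, 0, 0, 0; 0, -1, 0, 0],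
    !![0, 0, -1, -1; 0, 0, -1, 0; -1, -1, 0, 0; -1, 0, 0, 0],
    !![0, 0, 0, 1; 0, 0, -1, 0; 0, -1, 0, 0; 1, 0, 0, 0],
    !![0, 0, 0, 1; 0, 0, 1, 1; 0, 1, 0, 0; 1, 1, 0, 0],
    !![0, 0, -1, 0; 0, 0, 0, 1; -1, 0, 0, 0; 0, 1, 0, 0],
    !![0, 0, 1, 1; 0, 0, 0, 1; 1, 0, 0, 0; 1, 1, 0, 0],
    !![0, 0, 0, -1; 0, 0, -1, -1; 0, -1, 0, 0; -1, -1, 0, 0],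
    !![0, 0, 0, -1; 0, 0, 1, 0; 0, 1, 0, 0; -1, 0, 0, 0],
    !![0, 0, 1, 0; 0, 0, 0, -1; 1, 0, 0, 0; 0, -1, 0, 0],
    !![0, 0, -1, 0; 0, 0, 0, 1; -1, 0, 0, 0; 0, 1, 0, 0],
    !![0, 0, 1, 0; 0, 0, 0, -1; 1, 0, 0, 0; 0, -1, 0, 0],
    !![0, 0, -1, 0; 0, 0, 0, 1; -1, 0, 0, 0; 0, 1, 0, 0],
    !![0, 0, 0, 1; 0, 0, -1, 0; 0, -1, 0, 0; 1, 0, 0, 0],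
    !![0, 1, 0, 0; 1, 0, 0, 0; 0, 0, 0, -1; 0, 0, -1, 0],
    !![0, 1, 0, 0; 1, 0, 0, 0; 0, 0, 0, -1; 0, 0, -1, 0],
    !![0, -1, 0, 0; -1, 0, 0, 0; 0, 0, 0, 1; 0, 0, 1, 0]]

theorem rank_vRamHess_intVec (k : Fin 19) :
    (vRamHess (intVec (vRamNodeX k)) (intVec (vRamNodeY k))).rank = 4 := by
  have h : vRamHess (intVec (vRamNodeX k)) (intVec (vRamNodeY k)) =
      (vRamHess (vRamNodeX k) (vRamNodeY k)).map (Int.castRingHom ℂ) := by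
    ext i j
    rcases i with i | i <;> rcases j with j | j <;> fin_cases i <;> fin_cases j <;>
      simp [vRamHess, conicA, conicB, gradConicA, gradConicB, intVec]
  rw [h]
  clear h
  refine rank_map_intCast_of_minor _ (vRamMinor k) (vRamMinorInv k) ?_ ?_ <;> revert k <;> decide +kernel

theorem vRamHess_smul_smul (c d : ℂ) (x y : Fin 3 → ℂ) :
    vRamHess (c • x) (d • y) = Matrix.diagonal (Sum.elim (fun _ => d) fun _ => c) *
      vRamHess x y * Matrix.diagonal (Sum.elim (fun _ => d) fun _ => c) := by
  ext i j
  rw [Matrix.mul_diagonal, Matrix.diagonal_mul]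
  rcases i with i | i <;> rcases j with j | j <;> fin_cases i <;> fin_cases j <;>
    simp [vRamHess, conicA, conicB, gradConicA, gradConicB] <;> ring

theorem rank_vRamHess_smul_smul {c d : ℂ} (hc : c ≠ 0) (hd : d ≠ 0) (x y : Fin 3 → ℂ) :
    (vRamHess (c • x) (d • y)).rank = (vRamHess x y).rank := by
  have h : IsUnit (Matrix.diagonal (Sum.elim (fun _ : Fin 3 => d) fun _ : Fin 3 => c)).det := by
    rw [Matrix.det_diagonal]
    simp [hc, hd]
  rw [vRamHess_smul_smul, Matrix.rank_mul_eq_left_of_isUnit_det _ _ h,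
    Matrix.rank_mul_eq_right_of_isUnit_det _ _ h]

/-! ### Gradient, Hessian and classification of the singular points -/

theorem pderiv_vRam (s : Fin 3 ⊕ Fin 3) : pderiv s vRam =
    Sum.elim (vRamGradX (fun i => (X (Sum.inl i) : BiPoly)) fun i => X (Sum.inr i))
      (vRamGradY (fun i => (X (Sum.inl i) : BiPoly)) fun i => X (Sum.inr i)) s := by
  rcases s with i | i <;> fin_cases i <;>
    simp [vRam, vRamGradX, vRamGradY, conicA, conicB, gradConicA, gradConicB, pderiv_X,
      Derivation.leibniz]

theorem eval_pderiv_vRam (x y : Fin 3 → ℂ) (s : Fin 3 ⊕ Fin 3) :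
    eval (Sum.elim x y) (pderiv s vRam) = Sum.elim (vRamGradX x y) (vRamGradY x y) s := by
  rw [pderiv_vRam]
  rcases s with i | i <;> fin_cases i <;>
    simp [vRamGradX, vRamGradY, conicA, conicB, gradConicA, gradConicB]

theorem hessianAt_vRam (x y : Fin 3 → ℂ) : hessianAt vRam (Sum.elim x y) = vRamHess x y := by
  ext i j
  rw [hessianAt, Matrix.of_apply, pderiv_vRam]
  rcases j with j | j <;> rcases i with i | i <;> fin_cases j <;>
    simp only [vRamGradX, vRamGradY, conicA, conicB, gradConicA, gradConicB, vRamHess,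
      Sum.elim_inl, Sum.elim_inr, Pi.sub_apply, Pi.smul_apply, Matrix.fromBlocks_apply₁₁,
      Matrix.fromBlocks_apply₁₂, Matrix.fromBlocks_apply₂₁, Matrix.fromBlocks_apply₂₂] <;>
    fin_cases i <;> simp [pderiv_X, Derivation.leibniz] <;> ring

theorem vRamGrad_smul_smul (c d : ℂ) (x y : Fin 3 → ℂ) :
    vRamGradX (c • x) (d • y) = (c * d ^ 2) • vRamGradX x y ∧
      vRamGradY (c • x) (d • y) = (c ^ 2 * d) • vRamGradY x y := by
  constructor <;> ext i <;> fin_cases i <;>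
    simp [vRamGradX, vRamGradY, conicA, conicB, gradConicA, gradConicB] <;> ring

theorem vRamGrad_intVec (k : Fin 19) :
    vRamGradX (intVec (vRamNodeX k)) (intVec (vRamNodeY k)) = 0 ∧
      vRamGradY (intVec (vRamNodeX k)) (intVec (vRamNodeY k)) = 0 := by
  have h : vRamGradX (vRamNodeX k) (vRamNodeY k) = 0 ∧
      vRamGradY (vRamNodeX k) (vRamNodeY k) = 0 := by
    revert k; decide
  constructor
  · have : vRamGradX (intVec (vRamNodeX k)) (intVec (vRamNodeY k)) =
        intVec (vRamGradX (vRamNodeX k) (vRamNodeY k)) := by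
      ext i
      fin_cases i <;> simp [vRamGradX, conicA, conicB, gradConicA, gradConicB, intVec]
    rw [this, h.1]
    ext i
    simp [intVec]
  · have : vRamGradY (intVec (vRamNodeX k)) (intVec (vRamNodeY k)) =
        intVec (vRamGradY (vRamNodeX k) (vRamNodeY k)) := by
      ext i
      fin_cases i <;> simp [vRamGradY, conicA, conicB, gradConicA, gradConicB, intVec]
    rw [this, h.2]
    ext i
    simp [intVec]

theorem vec3_eq (x : Fin 3 → ℂ) : x = ![x 0, x 1, x 2] := by
  ext i
  fin_cases i <;> rfl

/-- The base points of the pencil. -/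
theorem exists_basePt {x : Fin 3 → ℂ} (hA : conicA x = 0) (hB : conicB x = 0) :
    ∃ (i : Fin 4) (c : ℂ), x = c • intVec (vRamNodeY (i.castLE (by norm_num))) := by
  rw [conicA, mul_eq_zero, sub_eq_zero] at hA
  rw [conicB, mul_eq_zero, sub_eq_zero] at hB
  rw [vec3_eq x]
  rcases hA with hA | hA <;> rcases hB with hB | hB
  · exact ⟨2, x 2, by ext i; fin_cases i <;> simp [vRamNodeY, intVec, ← hA, hB]⟩
  · exact ⟨3, x 0, by ext i; fin_cases i <;> simp [vRamNodeY, intVec, hA, ← hB]⟩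
  · exact ⟨1, x 1, by ext i; fin_cases i <;> simp [vRamNodeY, intVec, hA, hB]⟩
  · exact ⟨0, x 0, by ext i; fin_cases i <;> simp [vRamNodeY, intVec, hA, hB]⟩

/-- The node of a singular conic of the pencil. -/
theorem exists_conicNode {x : Fin 3 → ℂ} (hx : x ≠ 0) {l m : ℂ} (hlm : l ≠ 0 ∨ m ≠ 0)
    (h : l • gradConicA x - m • gradConicB x = 0) :
    ∃ c : ℂ, c ≠ 0 ∧ ((m = 0 ∧ x = c • ![1, 1, 0]) ∨ (l = 0 ∧ x = c • ![0, 1, 1]) ∨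
      (m = -l ∧ x = c • ![1, 0, 1])) := by
  have h0 := congrFun h 0
  have h1 := congrFun h 1
  have h2 := congrFun h 2
  simp [gradConicA, gradConicB] at h0 h1 h2
  have hne : ∀ (c : ℂ) (v : Fin 3 → ℂ), x = c • v → c ≠ 0 := by
    rintro c v hc rfl
    exact hx (by rw [hc, zero_smul])
  by_cases hm : m = 0
  · have hl := hlm.resolve_right (not_not.2 hm)
    have e2 : x 2 = 0 := by simpa [hm, hl] using h0
    have e0 : x 0 = x 1 := by simpa [hm, hl, sub_eq_zero] using h2
    have : x = x 1 • ![1, 1, 0] := by ext i; fin_cases i <;> simp [e0, e2]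
    exact ⟨x 1, hne _ _ this, Or.inl ⟨hm, this⟩⟩
  · by_cases hl : l = 0
    · have e2 : x 1 = x 2 := by simpa [hm, hl, sub_eq_zero] using h0
      have e0 : x 0 = 0 := by simpa [hm, hl, sub_eq_zero] using h2
      have : x = x 2 • ![0, 1, 1] := by ext i; fin_cases i <;> simp [e0, e2]
      exact ⟨x 2, hne _ _ this, Or.inr (Or.inl ⟨hl, this⟩)⟩
    · have a1 : x 2 = x 0 + x 1 := mul_left_cancel₀ hm (by linear_combination h0 + h1)
      have a2 : x 2 = x 0 - x 1 := mul_left_cancel₀ hl (by linear_combination -h1 - h2)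
      have e1 : x 1 = 0 := by linear_combination (a2 - a1) / 2
      have e2 : x 2 = x 0 := by rw [a1, e1, add_zero]
      have : x = x 0 • ![1, 0, 1] := by ext i; fin_cases i <;> simp [e1, e2]
      have hc := hne _ _ this
      refine ⟨x 0, hc, Or.inr (Or.inr ⟨mul_right_cancel₀ hc ?_, this⟩)⟩
      rw [e2] at h1
      linear_combination -h1

/-- The two conics meet transversally at each of the four base points. -/
theorem gradConic_independent {i : Fin 4} {c l m : ℂ} (hc : c ≠ 0)
    (h : l • gradConicB (c • intVec (vRamNodeY (i.castLE (by norm_num)))) -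
      m • gradConicA (c • intVec (vRamNodeY (i.castLE (by norm_num)))) = 0) : l = 0 ∧ m = 0 := by
  have h0 := congrFun h 0
  have h1 := congrFun h 1
  have h2 := congrFun h 2
  fin_cases i <;> simp [gradConicA, gradConicB, intVec, vRamNodeY, hc] at h0 h1 h2 <;>
    simp_all

/-- If `y` is a base point, transversality forces `x` to be one too. Otherwise `x` is the node of
the conic of the pencil through `y`, so it is not a base point, and by symmetry `y` is the node of
the conic through `x`. -/
theorem exists_vRamNode {x y : Fin 3 → ℂ} (hx : x ≠ 0) (hy : y ≠ 0) (h1 : vRamGradX x y = 0)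
    (h2 : vRamGradY x y = 0) :
    ∃ (k : Fin 19) (c d : ℂ), c ≠ 0 ∧ d ≠ 0 ∧ x = c • intVec (vRamNodeX k) ∧
      y = d • intVec (vRamNodeY k) := by
  have hne : ∀ (x : Fin 3 → ℂ), x ≠ 0 → ∀ (c : ℂ) (v : Fin 3 → ℂ), x = c • v → c ≠ 0 := by
    rintro x hx c v hc rfl
    exact hx (by rw [hc, zero_smul])
  -- The first sixteen entries of the table are the pairs of base points, numbered `4 i + j`.
  have hX : ∀ i j : Fin 4, vRamNodeX ⟨4 * i + j, by omega⟩ =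
    vRamNodeY (i.castLE (by norm_num)) := by decide
  have hY : ∀ i j : Fin 4, vRamNodeY ⟨4 * i + j, by omega⟩ =
    vRamNodeY (j.castLE (by norm_num)) := by decide
  by_cases h : conicA y = 0 ∧ conicB y = 0
  · obtain ⟨j, d, hj⟩ := exists_basePt h.1 h.2
    have hd := hne _ hy _ _ hj
    rw [hj] at h2
    obtain ⟨hA, hB⟩ := gradConic_independent hd h2
    obtain ⟨i, c, hi⟩ := exists_basePt hA hB
    have hc := hne _ hx _ _ hi
    refine ⟨⟨4 * i + j, by omega⟩, c, d, hc, hd, ?_, ?_⟩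
    · rw [hi, hX]
    · rw [hj, hY]
  · have h' : conicB y ≠ 0 ∨ conicA y ≠ 0 := by tauto
    obtain ⟨c, hc, hx'⟩ := exists_conicNode hx h' h1
    have h3 : -conicB x ≠ 0 ∨ -conicA x ≠ 0 := by
      rcases hx' with ⟨-, rfl⟩ | ⟨-, rfl⟩ | ⟨-, rfl⟩ <;> simp [conicA, conicB, hc]
    have h4 : (-conicB x) • gradConicA y - (-conicA x) • gradConicB y = 0 := by
      rw [← h2, vRamGradY]
      module
    obtain ⟨d, hd, hy'⟩ := exists_conicNode hy h3 h4
    -- Of the nine pairs of nodes, the six with distinct nodes contradict the equation of the conic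
    -- through `x`.
    rcases hx' with ⟨-, rfl⟩ | ⟨-, rfl⟩ | ⟨-, rfl⟩ <;>
      rcases hy' with ⟨e, rfl⟩ | ⟨e, rfl⟩ | ⟨e, rfl⟩ <;>
      simp [conicA, conicB, hc] at e
    · exact ⟨16, c, d, hc, hd, by ext i; fin_cases i <;> simp [vRamNodeX, intVec],
        by ext i; fin_cases i <;> simp [vRamNodeY, intVec]⟩
    · exact ⟨17, c, d, hc, hd, by ext i; fin_cases i <;> simp [vRamNodeX, intVec],
        by ext i; fin_cases i <;> simp [vRamNodeY, intVec]⟩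
    · exact ⟨18, c, d, hc, hd, by ext i; fin_cases i <;> simp [vRamNodeX, intVec],
        by ext i; fin_cases i <;> simp [vRamNodeY, intVec]⟩

theorem vRamNode_ne_zero (k : Fin 19) : vRamNodeX k ≠ 0 ∧ vRamNodeY k ≠ 0 := by
  revert k; decide

theorem vRamNode_not_proportional {k l : Fin 19} (h : k ≠ l) :
    (∃ i j, vRamNodeX k i * vRamNodeX l j ≠ vRamNodeX k j * vRamNodeX l i) ∨
      ∃ i j, vRamNodeY k i * vRamNodeY l j ≠ vRamNodeY k j * vRamNodeY l i := by
  revert k l; decide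

theorem mem_biSing_vRam_iff (p : P2 × P2) : p ∈ biSing vRam ↔
    vRamGradX p.1.rep p.2.rep = 0 ∧ vRamGradY p.1.rep p.2.rep = 0 := by
  simp only [biSing, coords, Set.mem_ofPred_eq, eval_pderiv_vRam, Sum.forall, Sum.elim_inl,
    Sum.elim_inr, funext_iff, Pi.zero_apply]

/-- The singular points of the threefold. -/
def vRamNode (k : Fin 19) : P2 × P2 :=
  (Projectivization.mk ℂ _ (intVec_ne_zero (vRamNode_ne_zero k).1),
    Projectivization.mk ℂ _ (intVec_ne_zero (vRamNode_ne_zero k).2))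

theorem vRamNode_injective : Function.Injective vRamNode := by
  intro k l hkl
  by_contra hne
  obtain ⟨c, hc⟩ := (Projectivization.mk_eq_mk_iff' _ _ _ _ _).1 (congrArg Prod.fst hkl)
  obtain ⟨d, hd⟩ := (Projectivization.mk_eq_mk_iff' _ _ _ _ _).1 (congrArg Prod.snd hkl)
  rcases vRamNode_not_proportional (Ne.symm hne) with h | h
  · exact intVec_not_proportional h c hc
  · exact intVec_not_proportional h d hd

theorem biSing_vRam : biSing vRam = Set.range vRamNode := by
  ext p
  rw [mem_biSing_vRam_iff]
  constructor
  · rintro ⟨h1, h2⟩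
    obtain ⟨k, c, d, hc, hd, hx, hy⟩ :=
      exists_vRamNode p.1.rep_nonzero p.2.rep_nonzero h1 h2
    refine ⟨k, Prod.ext ?_ ?_⟩
    · conv_rhs => rw [← p.1.mk_rep]
      exact ((Projectivization.mk_eq_mk_iff' _ _ _ _ _).2 ⟨c, hx.symm⟩).symm
    · conv_rhs => rw [← p.2.mk_rep]
      exact ((Projectivization.mk_eq_mk_iff' _ _ _ _ _).2 ⟨d, hy.symm⟩).symm
  · rintro ⟨k, rfl⟩
    obtain ⟨c, hc, e⟩ := exists_rep_mk_eq_smul _ (intVec_ne_zero (vRamNode_ne_zero k).1)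
    obtain ⟨d, hd, e'⟩ := exists_rep_mk_eq_smul _ (intVec_ne_zero (vRamNode_ne_zero k).2)
    rw [vRamNode, e, e', (vRamGrad_smul_smul c d _ _).1, (vRamGrad_smul_smul c d _ _).2,
      (vRamGrad_intVec k).1, (vRamGrad_intVec k).2, smul_zero, smul_zero]
    exact ⟨rfl, rfl⟩

theorem ncard_biSing_vRam : (biSing vRam).ncard = 19 := by
  rw [biSing_vRam, ← Set.image_univ, Set.ncard_image_of_injective _ vRamNode_injective,
    Set.ncard_univ, Nat.card_fin]

theorem rank_vRamHess {x y : Fin 3 → ℂ} (hx : x ≠ 0) (hy : y ≠ 0) (h1 : vRamGradX x y = 0)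
    (h2 : vRamGradY x y = 0) : (vRamHess x y).rank = 4 := by
  obtain ⟨k, c, d, hc, hd, rfl, rfl⟩ := exists_vRamNode hx hy h1 h2
  rw [rank_vRamHess_smul_smul hc hd, rank_vRamHess_intVec]

theorem isBiNode_vRam {p : P2 × P2} (hp : p ∈ biSing vRam) : IsBiNode vRam p := by
  obtain ⟨h1, h2⟩ := (mem_biSing_vRam_iff p).1 hp
  exact ⟨hp, by rw [coords, hessianAt_vRam, rank_vRamHess p.1.rep_nonzero p.2.rep_nonzero h1 h2]⟩

/-- Rank four leaves a kernel of dimension two, and by Euler's relations it contains `(x, 0)` and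
`(0, y)`. -/
theorem eq_smul_of_vRamHess_mulVec {x y x' y' : Fin 3 → ℂ} (hx : x ≠ 0) (hy : y ≠ 0)
    (h1 : vRamGradX x y = 0) (h2 : vRamGradY x y = 0)
    (h : (vRamHess x y).mulVec (Sum.elim x' y') = 0) :
    (∃ c : ℂ, x' = c • x) ∧ ∃ d : ℂ, y' = d • y := by
  set H := vRamHess x y with hH
  have hr : H.rank = 4 := rank_vRamHess hx hy h1 h2
  have e0 := congrFun h1 0
  have e1 := congrFun h1 1
  have e2 := congrFun h1 2
  have e3 := congrFun h2 0
  have e4 := congrFun h2 1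
  have e5 := congrFun h2 2
  simp [vRamGradX, vRamGradY, conicA, conicB, gradConicA, gradConicB] at e0 e1 e2 e3 e4 e5
  have k1 : H.mulVec (Sum.elim x 0) = 0 := by
    ext i
    rcases i with i | i <;> fin_cases i <;>
      simp [hH, vRamHess, Matrix.mulVec, dotProduct, Fin.sum_univ_three, conicA, conicB,
        gradConicA, gradConicB]
    · linear_combination e0
    · linear_combination e1
    · linear_combination e2
    · linear_combination 2 * e3
    · linear_combination 2 * e4
    · linear_combination 2 * e5
  have k2 : H.mulVec (Sum.elim 0 y) = 0 := by
    ext i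
    rcases i with i | i <;> fin_cases i <;>
      simp [hH, vRamHess, Matrix.mulVec, dotProduct, Fin.sum_univ_three, conicA, conicB,
        gradConicA, gradConicB]
    · linear_combination 2 * e0
    · linear_combination 2 * e1
    · linear_combination 2 * e2
    · linear_combination e3
    · linear_combination e4
    · linear_combination e5
  have hli : LinearIndependent ℂ
      ![(Sum.elim x 0 : Fin 3 ⊕ Fin 3 → ℂ), (Sum.elim 0 y : Fin 3 ⊕ Fin 3 → ℂ)] := by
    rw [LinearIndependent.pair_iff]
    intro s t hst
    obtain ⟨i, hi⟩ := Function.ne_iff.1 hx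
    obtain ⟨j, hj⟩ := Function.ne_iff.1 hy
    have a := congrFun hst (Sum.inl i)
    have b := congrFun hst (Sum.inr j)
    simp at a b hi hj
    exact ⟨a.resolve_right hi, b.resolve_right hj⟩
  have hfr := finrank_span_eq_card hli
  have hle : Submodule.span ℂ (Set.range
      ![(Sum.elim x 0 : Fin 3 ⊕ Fin 3 → ℂ), (Sum.elim 0 y : Fin 3 ⊕ Fin 3 → ℂ)]) ≤
      LinearMap.ker H.mulVecLin := by
    rw [Submodule.span_le]
    rintro _ ⟨i, rfl⟩
    fin_cases i
    · exact k1
    · exact k2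
  have hrn := H.mulVecLin.finrank_range_add_finrank_ker
  have hr' : Module.finrank ℂ (LinearMap.range H.mulVecLin) = 4 := hr
  have heq := Submodule.eq_of_le_of_finrank_eq hle (by
    rw [hfr, Fintype.card_fin]
    rw [hr'] at hrn
    simp at hrn
    omega)
  have hmem : (Sum.elim x' y' : Fin 3 ⊕ Fin 3 → ℂ) ∈ LinearMap.ker H.mulVecLin := h
  rw [← heq, Submodule.mem_span_range_iff_exists_fun] at hmem
  obtain ⟨c, hc⟩ := hmem
  refine ⟨⟨c 0, ?_⟩, ⟨c 1, ?_⟩⟩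
  · ext i
    simpa using (congrFun hc (Sum.inl i)).symm
  · ext i
    simpa using (congrFun hc (Sum.inr i)).symm

theorem vRam_mem_biForms : vRam ∈ biForms 2 2 := by
  have hx : ∀ i : Fin 3, (X (Sum.inl i) : BiPoly) ∈ biForms 1 0 := fun i =>
    isWeightedHomogeneous_X ℂ _ _
  have hy : ∀ i : Fin 3, (X (Sum.inr i) : BiPoly) ∈ biForms 0 1 := fun i =>
    isWeightedHomogeneous_X ℂ _ _
  have hmul : ∀ {a b c d : ℕ} {f g : BiPoly}, f ∈ biForms a b → g ∈ biForms c d →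
      f * g ∈ biForms (a + c) (b + d) := fun hf hg => IsWeightedHomogeneous.mul hf hg
  exact Submodule.sub_mem _
    (hmul (hmul (Submodule.sub_mem _ (hx 0) (hx 1)) (hx 2))
      (hmul (hy 0) (Submodule.sub_mem _ (hy 1) (hy 2))))
    (hmul (hmul (hx 0) (Submodule.sub_mem _ (hx 1) (hx 2)))
      (hmul (Submodule.sub_mem _ (hy 0) (hy 1)) (hy 2)))

end

noncomputable section

/-! ## Wedge products in `⋀³ ℂ⁶` -/

theorem wedge3_eq_ιMulti (p q r : W6) : wedge3 p q r = ExteriorAlgebra.ιMulti ℂ 3 ![p, q, r] := by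
  simp [wedge3, mul_assoc, Matrix.vecTail]

theorem wedge3_mul_wedge3 (p q r p' q' r' : W6) :
    wedge3 p q r * wedge3 p' q' r' = ExteriorAlgebra.ιMulti ℂ 6 ![p, q, r, p', q', r'] := by
  simp [wedge3, mul_assoc, Matrix.vecTail]

theorem wedge3_swap_left (p q r : W6) : wedge3 q p r = -wedge3 p q r := by
  rw [wedge3, wedge3, ← neg_mul, eq_neg_of_add_eq_zero_left (ExteriorAlgebra.ι_add_mul_swap q p)]

theorem wedge3_swap_right (p q r : W6) : wedge3 p r q = -wedge3 p q r := by
  rw [wedge3, wedge3, mul_assoc, mul_assoc,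
    eq_neg_of_add_eq_zero_left (ExteriorAlgebra.ι_add_mul_swap r q), mul_neg]

theorem wedge3_mem (p q r : W6) : wedge3 p q r ∈ ⋀[ℂ]^3 W6 := by
  rw [wedge3_eq_ιMulti]
  exact ExteriorAlgebra.ιMulti_range ℂ 3 ⟨_, rfl⟩

theorem ExteriorAlgebra.ιMulti_ne_zero {K E : Type*} [Field K] [AddCommGroup E] [Module K E]
    {n : ℕ} {v : Fin n → E} (hv : LinearIndependent K v) : ExteriorAlgebra.ιMulti K n v ≠ 0 := by
  have h := (exteriorPower.ιMulti_family_linearIndependent_field (n := n) hv).ne_zero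
    ⟨Finset.univ, by simp⟩
  intro h0
  apply h
  apply Subtype.ext
  rw [exteriorPower.ιMulti_family_apply_coe]
  unfold ExteriorAlgebra.ιMulti_family
  -- The only order embedding of `Fin n` into itself is the identity, so the family has the single
  -- member `v`.
  have : ∀ f : Fin n ↪o Fin n, v ∘ f = v := fun f => by
    rw [OrderEmbedding.range_inj (f := f) (g := (OrderIso.refl (Fin n)).toOrderEmbedding) |>.1
      ((Finite.surjective_of_injective f.injective).range_eq.trans
        (OrderIso.refl (Fin n)).surjective.range_eq.symm)]
    rfl
  rw [this, h0]
  rfl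

theorem ιMulti_eq_zero_iff {K E : Type*} [Field K] [AddCommGroup E] [Module K E]
    {n : ℕ} {v : Fin n → E} : ExteriorAlgebra.ιMulti K n v = 0 ↔ ¬ LinearIndependent K v :=
  ⟨fun h hv => ExteriorAlgebra.ιMulti_ne_zero hv h, fun h =>
    AlternatingMap.map_linearDependent _ v h⟩

/-- The standard basis vectors. -/
def stdE (i : Fin 6) : W6 := Pi.single i 1

/-- The coordinate triples. The triple `(0, 1, 2)` is followed by the triples of one index `i < 3`
and two other ones, those of two indices below `3` and another one, in reverse order, and
`(3, 4, 5)`. -/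
def trip : Fin 20 → Fin 3 → Fin 6 :=
  ![![0, 1, 2],
    ![0, 4, 5], ![0, 5, 3], ![0, 3, 4],
    ![1, 4, 5], ![1, 5, 3], ![1, 3, 4],
    ![2, 4, 5], ![2, 5, 3], ![2, 3, 4],
    ![0, 1, 5], ![0, 1, 4], ![0, 1, 3],
    ![2, 0, 5], ![2, 0, 4], ![2, 0, 3],
    ![1, 2, 5], ![1, 2, 4], ![1, 2, 3],
    ![3, 4, 5]]

/-- The three by three minor of the vectors `p, q, r` given by the columns `I`. -/
def minor3 {R : Type} [CommRing R] (I : Fin 3 → Fin 6) (p q r : Fin 6 → R) : R :=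
  p (I 0) * (q (I 1) * r (I 2) - q (I 2) * r (I 1)) -
    p (I 1) * (q (I 0) * r (I 2) - q (I 2) * r (I 0)) +
    p (I 2) * (q (I 0) * r (I 1) - q (I 1) * r (I 0))

/-- A Plücker coordinate. -/
def plCoord (I : Fin 3 → Fin 6) : ExteriorAlgebra ℂ W6 →ₗ[ℂ] ℂ :=
  ExteriorAlgebra.liftAlternating fun n => match n with
    | 3 => (Matrix.detRowAlternating (R := ℂ) (n := Fin 3)).compLinearMap (LinearMap.funLeft ℂ ℂ I)
    | _ => 0

theorem plCoord_wedge3 (I : Fin 3 → Fin 6) (p q r : W6) :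
    plCoord I (wedge3 p q r) = minor3 I p q r := by
  rw [wedge3_eq_ιMulti, plCoord, ExteriorAlgebra.liftAlternating_apply_ιMulti]
  change (Matrix.of fun i j => ![p, q, r] i (I j)).det = _
  rw [Matrix.det_fin_three]
  simp [minor3]
  ring

/-- The coordinates of `⋀³ ℂ⁶`. -/
def co (k : Fin 20) : ExteriorAlgebra ℂ W6 →ₗ[ℂ] ℂ := plCoord (trip k)

/-- The basis of `⋀³ ℂ⁶`. -/
def basis3 (k : Fin 20) : ExteriorAlgebra ℂ W6 :=
  wedge3 (stdE (trip k 0)) (stdE (trip k 1)) (stdE (trip k 2))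

theorem co_wedge3 (k : Fin 20) (p q r : W6) : co k (wedge3 p q r) = minor3 (trip k) p q r :=
  plCoord_wedge3 _ _ _ _

theorem co_basis3 (k l : Fin 20) : co k (basis3 l) = if k = l then 1 else 0 := by
  have h : ∀ k l : Fin 20, minor3 (R := ℤ) (trip k) (Pi.single (M := fun _ => ℤ) (trip l 0) 1)
      (Pi.single (M := fun _ => ℤ) (trip l 1) 1) (Pi.single (M := fun _ => ℤ) (trip l 2) 1) = if k = l then 1 else 0 := by
    decide +kernel
  have h' := congrArg (Int.cast : ℤ → ℂ) (h k l)
  rw [basis3, co_wedge3]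
  have e : ∀ i j : Fin 6, stdE i j = ((Pi.single (M := fun _ => ℤ) i (1 : ℤ) j : ℤ) : ℂ) := by
    intro i j
    simp [stdE, Pi.single_apply]
  simp only [minor3, e]
  simp only [minor3] at h'
  push_cast at h' ⊢
  exact h'

/-- Up to at most one transposition, every increasing triple occurs in the list `trip`. -/
theorem exteriorPower_three_le_span_basis3 :
    ⋀[ℂ]^3 W6 ≤ Submodule.span ℂ (Set.range basis3) := by
  have hs : Submodule.span ℂ (Set.range stdE) = ⊤ := by
    rw [← (Pi.basisFun ℂ (Fin 6)).span_eq]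
    congr 2
    ext i
    simp [stdE]
  rw [← exteriorPower.ιMulti_family_span_fixedDegree_of_span ℂ hs, Submodule.span_le]
  rintro _ ⟨s, rfl⟩
  unfold ExteriorAlgebra.ιMulti_family
  generalize Set.powersetCard.ofFinEmbEquiv.symm s = f
  have h3 : ExteriorAlgebra.ιMulti ℂ 3 (stdE ∘ f) =
      wedge3 (stdE (f 0)) (stdE (f 1)) (stdE (f 2)) := by
    rw [wedge3_eq_ιMulti]
    congr 1
    ext i
    fin_cases i <;> rfl
  have h01 : f 0 < f 1 := f.strictMono (by decide)
  have h12 : f 1 < f 2 := f.strictMono (by decide)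
  have key : ∀ i j k : Fin 6, i < j → j < k → ∃ l : Fin 20, trip l = ![i, j, k] ∨
    trip l = ![i, k, j] ∨ trip l = ![j, i, k] := by decide +kernel
  obtain ⟨l, hl⟩ := key _ _ _ h01 h12
  rw [h3]
  have hmem : basis3 l ∈ Submodule.span ℂ (Set.range basis3) := Submodule.subset_span ⟨l, rfl⟩
  rcases hl with h | h | h
  · simpa [basis3, h] using hmem
  · rw [← neg_neg (wedge3 _ _ _), ← wedge3_swap_right]
    exact neg_mem (by simpa [basis3, h] using hmem)
  · rw [← neg_neg (wedge3 _ _ _), ← wedge3_swap_left]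
    exact neg_mem (by simpa [basis3, h] using hmem)

/-- Elements of `⋀³ ℂ⁶` in coordinates. -/
theorem sum_co_smul_basis3 {ω : ExteriorAlgebra ℂ W6} (h : ω ∈ ⋀[ℂ]^3 W6) :
    ω = ∑ k, co k ω • basis3 k := by
  obtain ⟨c, rfl⟩ := (Submodule.mem_span_range_iff_exists_fun ℂ).1
    (exteriorPower_three_le_span_basis3 h)
  simp [co_basis3]

theorem eq_of_co_eq {ω η : ExteriorAlgebra ℂ W6} (hω : ω ∈ ⋀[ℂ]^3 W6) (hη : η ∈ ⋀[ℂ]^3 W6)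
    (h : ∀ k, co k ω = co k η) : ω = η := by
  rw [sum_co_smul_basis3 hω, sum_co_smul_basis3 hη]
  simp [h]

theorem basis3_mem (k : Fin 20) : basis3 k ∈ ⋀[ℂ]^3 W6 := wedge3_mem _ _ _

theorem volW_eq_ιMulti : volW = ExteriorAlgebra.ιMulti ℂ 6 stdE := by
  rw [volW, wedge3_mul_wedge3]
  congr 1
  ext i
  fin_cases i <;> rfl

theorem volW_ne_zero : volW ≠ 0 := by
  rw [volW_eq_ιMulti]
  apply ExteriorAlgebra.ιMulti_ne_zero
  have := (Pi.basisFun ℂ (Fin 6)).linearIndependent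
  rwa [show ⇑(Pi.basisFun ℂ (Fin 6)) = stdE by ext i; simp [stdE]] at this

/-- The list `trip` is arranged so that complementary triples sit at reversed positions, with
positive sign for the first ten. -/
theorem basis3_mul_basis3 (k l : Fin 20) : basis3 k * basis3 l =
    (if l = k.rev then (if k < 10 then 1 else -1) else 0 : ℂ) • volW := by
  rw [basis3, basis3, wedge3_mul_wedge3, volW_eq_ιMulti]
  have he : ∀ f : Fin 6 → Fin 6, ![stdE (f 0), stdE (f 1), stdE (f 2), stdE (f 3), stdE (f 4),
      stdE (f 5)] = stdE ∘ f := by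
    intro f
    ext i
    fin_cases i <;> rfl
  have he := he ![trip k 0, trip k 1, trip k 2, trip l 0, trip l 1, trip l 2]
  simp only [Matrix.cons_val] at he
  rw [he]
  by_cases h : l = k.rev
  · subst h
    have hp : ∀ k : Fin 20, ∃ σ : Equiv.Perm (Fin 6),
        (∀ i, σ i = ![trip k 0, trip k 1, trip k 2, trip k.rev 0, trip k.rev 1, trip k.rev 2] i) ∧
          Equiv.Perm.sign σ = if k < 10 then 1 else -1 := by
      decide +kernel
    obtain ⟨σ, h1, h2⟩ := hp k
    rw [← funext h1, AlternatingMap.map_perm, h2, if_pos rfl]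
    split_ifs <;> simp [-ExteriorAlgebra.ιMulti_succ_apply]
  · have hp : ∀ k l : Fin 20, l ≠ k.rev → ∃ i j : Fin 6, i ≠ j ∧
        ![trip k 0, trip k 1, trip k 2, trip l 0, trip l 1, trip l 2] i =
        ![trip k 0, trip k 1, trip k 2, trip l 0, trip l 1, trip l 2] j := by
      decide +kernel
    obtain ⟨i, j, hij, h'⟩ := hp k l h
    rw [AlternatingMap.map_eq_zero_of_eq _ (stdE ∘ _) (congrArg stdE h') hij]
    simp [h]

/-- The wedge pairing of `⋀³ ℂ⁶` in coordinates. -/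
theorem mul_eq_sum_co {ω η : ExteriorAlgebra ℂ W6} (hω : ω ∈ ⋀[ℂ]^3 W6) (hη : η ∈ ⋀[ℂ]^3 W6) :
    ω * η = (∑ k : Fin 20, (if k < 10 then 1 else -1) * (co k ω * co k.rev η)) • volW := by
  conv_lhs => rw [sum_co_smul_basis3 hω, sum_co_smul_basis3 hη]
  simp only [Finset.sum_mul_sum, smul_mul_smul_comm, basis3_mul_basis3, Finset.sum_smul]
  refine Finset.sum_congr rfl fun k _ => ?_
  rw [Finset.sum_eq_single k.rev]
  · simp
  · intro l _ hl
    simp [hl]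
  · simp

end

noncomputable section

/-! ## The Lagrangian subspace -/

theorem mem_planeU {p : W6} : p ∈ planeU ↔ p 3 = 0 ∧ p 4 = 0 ∧ p 5 = 0 := by
  rw [planeU, Submodule.mem_span_triple]
  constructor
  · rintro ⟨a, b, c, rfl⟩
    simp
  · rintro ⟨h3, h4, h5⟩
    refine ⟨p 0, p 1, p 2, ?_⟩
    ext i
    fin_cases i <;> simp [h3, h4, h5]

section

variable {R : Type} [CommRing R]

/-- The first three coordinates. -/
def lo (p : Fin 6 → R) : Fin 3 → R := ![p 0, p 1, p 2]

/-- The last three coordinates. -/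
def hi (p : Fin 6 → R) : Fin 3 → R := ![p 3, p 4, p 5]

/-- The polarity of the space of three by three matrices whose quadratic form restricts to
`2 * vRam` on the matrices of rank one. -/
def polB (M : Fin 3 → Fin 3 → R) : Fin 3 → Fin 3 → R :=
  ![![0, M 1 2 + M 2 0, -(M 2 1 + M 1 0)],
    ![-(M 0 2 + M 2 1), 0, M 0 1 + M 2 0],
    ![M 0 1 + M 1 2, -(M 0 2 + M 1 0), 0]]

theorem polB_add (M N : Fin 3 → Fin 3 → R) : polB (M + N) = polB M + polB N := by
  ext i j
  fin_cases i <;> fin_cases j <;> simp [polB] <;> ring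

theorem polB_smul (c : R) (M : Fin 3 → Fin 3 → R) : polB (c • M) = c • polB M := by
  ext i j
  fin_cases i <;> fin_cases j <;> simp [polB] <;> ring

theorem polB_zero : polB (0 : Fin 3 → Fin 3 → R) = 0 := by
  ext i j
  fin_cases i <;> fin_cases j <;> simp [polB]

end

theorem planeU_iff_hi {p : W6} : p ∈ planeU ↔ hi p = 0 := by
  rw [mem_planeU]
  constructor
  · rintro ⟨h3, h4, h5⟩
    ext i
    fin_cases i <;> simp [hi, h3, h4, h5]
  · intro h
    exact ⟨congrFun h 0, congrFun h 1, congrFun h 2⟩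

/-- The positions of the coordinates with one index below `3`. -/
def tix : Fin 3 → Fin 3 → Fin 20 := ![![1, 2, 3], ![4, 5, 6], ![7, 8, 9]]

/-- The coordinates with one index below `3`. -/
def tco : ExteriorAlgebra ℂ W6 →ₗ[ℂ] Fin 3 → Fin 3 → ℂ :=
  LinearMap.pi fun i => LinearMap.pi fun j => co (tix i j)

/-- The coordinates with two indices below `3`. -/
def sco : ExteriorAlgebra ℂ W6 →ₗ[ℂ] Fin 3 → Fin 3 → ℂ :=
  LinearMap.pi fun i => LinearMap.pi fun j => co (tix i j).rev

theorem tco_apply (ω : ExteriorAlgebra ℂ W6) (i j : Fin 3) : tco ω i j = co (tix i j) ω := rfl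

theorem sco_apply (ω : ExteriorAlgebra ℂ W6) (i j : Fin 3) : sco ω i j = co (tix i j).rev ω := rfl

theorem eq_of_coords_eq {ω η : ExteriorAlgebra ℂ W6} (hω : ω ∈ ⋀[ℂ]^3 W6) (hη : η ∈ ⋀[ℂ]^3 W6)
    (h0 : co 0 ω = co 0 η) (ht : tco ω = tco η) (hs : sco ω = sco η) (h19 : co 19 ω = co 19 η) :
    ω = η := by
  refine eq_of_co_eq hω hη fun k => ?_
  have key : ∀ k : Fin 20, k = 0 ∨ k = 19 ∨ ∃ i j, k = tix i j ∨ k = (tix i j).rev := by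
    decide +kernel
  obtain rfl | rfl | ⟨i, j, rfl | rfl⟩ := key k
  · exact h0
  · exact h19
  · exact congrFun (congrFun ht i) j
  · exact congrFun (congrFun hs i) j

theorem mul_eq_coords {ω η : ExteriorAlgebra ℂ W6} (hω : ω ∈ ⋀[ℂ]^3 W6) (hη : η ∈ ⋀[ℂ]^3 W6) :
    ω * η = (co 0 ω * co 19 η - co 19 ω * co 0 η +
      ∑ i, ∑ j, (tco ω i j * sco η i j - sco ω i j * tco η i j)) • volW := by
  rw [mul_eq_sum_co hω hη]
  congr 1
  simp only [tco_apply, sco_apply]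
  generalize (fun k => co k ω) = a
  simp [Fin.sum_univ_succ, tix, Fin.rev, Fin.lt_def]
  ring

/-- The Lagrangian subspace of `⋀³ ℂ⁶` that is the graph of `polB`. -/
def lagA : Submodule ℂ (ExteriorAlgebra ℂ W6) where
  carrier := {ω | ω ∈ ⋀[ℂ]^3 W6 ∧ co 19 ω = 0 ∧ sco ω = polB (tco ω)}
  zero_mem' := by simp [polB_zero]
  add_mem' := by
    rintro ω η ⟨h1, h2, h3⟩ ⟨h1', h2', h3'⟩
    exact ⟨add_mem h1 h1', by simp [h2, h2'], by simp [h3, h3', polB_add]⟩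
  smul_mem' := by
    rintro c ω ⟨h1, h2, h3⟩
    exact ⟨Submodule.smul_mem _ _ h1, by simp [h2], by simp [h3, polB_smul]⟩

theorem lagA_le : lagA ≤ ⋀[ℂ]^3 W6 := fun _ h => h.1

/-- The element of `lagA` with given coordinates. -/
def lagMk (c : ℂ) (M : Fin 3 → Fin 3 → ℂ) : ExteriorAlgebra ℂ W6 :=
  c • basis3 0 + ∑ i, ∑ j, (M i j • basis3 (tix i j) + polB M i j • basis3 (tix i j).rev)

theorem lagMk_mem_exteriorPower (c : ℂ) (M : Fin 3 → Fin 3 → ℂ) : lagMk c M ∈ ⋀[ℂ]^3 W6 :=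
  add_mem (Submodule.smul_mem _ _ (basis3_mem _)) (sum_mem fun _ _ => sum_mem fun _ _ =>
    add_mem (Submodule.smul_mem _ _ (basis3_mem _)) (Submodule.smul_mem _ _ (basis3_mem _)))

theorem tix_ne (i j : Fin 3) : 0 ≠ tix i j ∧ 0 ≠ (tix i j).rev ∧ 19 ≠ tix i j ∧
    19 ≠ (tix i j).rev := by
  revert i j
  decide

theorem tix_ne_rev (i j k l : Fin 3) : tix i j ≠ (tix k l).rev ∧ (tix k l).rev ≠ tix i j := by
  revert i j k l
  decide

theorem tix_inj (i j k l : Fin 3) : tix i j = tix k l ↔ i = k ∧ j = l := by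
  revert i j k l
  decide

theorem co_zero_lagMk (c : ℂ) (M : Fin 3 → Fin 3 → ℂ) : co 0 (lagMk c M) = c := by
  simp [lagMk, co_basis3, tix_ne]

theorem co_nineteen_lagMk (c : ℂ) (M : Fin 3 → Fin 3 → ℂ) : co 19 (lagMk c M) = 0 := by
  simp [lagMk, co_basis3, tix_ne]

theorem tco_lagMk (c : ℂ) (M : Fin 3 → Fin 3 → ℂ) : tco (lagMk c M) = M := by
  ext i j
  simp [tco_apply, lagMk, co_basis3, (tix_ne _ _).1.symm, tix_ne_rev, tix_inj, ite_and]

theorem sco_lagMk (c : ℂ) (M : Fin 3 → Fin 3 → ℂ) : sco (lagMk c M) = polB M := by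
  ext i j
  simp [sco_apply, lagMk, co_basis3, (tix_ne _ _).2.1.symm, tix_ne_rev, tix_inj, ite_and]

theorem lagMk_mem (c : ℂ) (M : Fin 3 → Fin 3 → ℂ) : lagMk c M ∈ lagA :=
  ⟨lagMk_mem_exteriorPower c M, co_nineteen_lagMk c M, by rw [sco_lagMk, tco_lagMk]⟩

theorem eq_lagMk {ω : ExteriorAlgebra ℂ W6} (h : ω ∈ lagA) : ω = lagMk (co 0 ω) (tco ω) := by
  refine eq_of_coords_eq h.1 (lagMk_mem_exteriorPower _ _) ?_ ?_ ?_ ?_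
  · rw [co_zero_lagMk]
  · rw [tco_lagMk]
  · rw [sco_lagMk, h.2.2]
  · rw [co_nineteen_lagMk, h.2.1]

/-- The coordinates on `lagA`. -/
def lagEquiv : lagA ≃ₗ[ℂ] ℂ × (Fin 3 → Fin 3 → ℂ) where
  toFun ω := (co 0 ω, tco ω)
  map_add' _ _ := by simp
  map_smul' _ _ := by simp
  invFun c := ⟨lagMk c.1 c.2, lagMk_mem _ _⟩
  left_inv ω := Subtype.ext (eq_lagMk ω.2).symm
  right_inv c := by simp [co_zero_lagMk, tco_lagMk]

/-- The dimension is `1 + 9`, and isotropy is the self-adjointness of `polB` for the entrywise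
pairing of matrices. -/
theorem isLagrangian_lagA : IsLagrangian lagA := by
  refine ⟨lagA_le, ?_, ?_⟩
  · rw [lagEquiv.finrank_eq, Module.finrank_prod, Module.finrank_pi_fintype]
    simp
  · intro a ha b hb
    rw [mul_eq_coords ha.1 hb.1, ha.2.1, hb.2.1, ha.2.2, hb.2.2]
    convert zero_smul ℂ _
    simp [Fin.sum_univ_three, polB]
    ring

/-- Maximality of `lagA` as an isotropic subspace: pairing with `basis3 0` and with elementary
matrices reads off the equations that define it. -/
theorem mem_lagA_of_mul_eq_zero {ω : ExteriorAlgebra ℂ W6} (hω : ω ∈ ⋀[ℂ]^3 W6)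
    (h : ∀ a ∈ lagA, ω * a = 0) : ω ∈ lagA := by
  have h' : ∀ c M, co 0 ω * 0 - co 19 ω * c +
      ∑ i, ∑ j, (tco ω i j * polB M i j - sco ω i j * M i j) = 0 := by
    intro c M
    have := h _ (lagMk_mem c M)
    rw [mul_eq_coords hω (lagMk_mem_exteriorPower c M)] at this
    simpa only [co_zero_lagMk, co_nineteen_lagMk, tco_lagMk, sco_lagMk] using
      (smul_eq_zero.1 this).resolve_right volW_ne_zero
  refine ⟨hω, by simpa [polB_zero] using h' 1 0, ?_⟩
  ext i j
  have := h' 0 (Pi.single i (Pi.single j 1))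
  fin_cases i <;> fin_cases j <;>
    simp [Fin.sum_univ_three, polB] at this ⊢ <;> first | exact this | linear_combination -this

theorem basis3_zero_mem_lagA : basis3 0 ∈ lagA := by
  have : basis3 0 = lagMk 1 0 := by simp [lagMk, polB_zero]
  rw [this]
  exact lagMk_mem _ _

theorem eq_smul_basis3_zero {ω : ExteriorAlgebra ℂ W6} (h : ω ∈ lagA) (h0 : tco ω = 0) :
    ω = co 0 ω • basis3 0 := by
  conv_lhs => rw [eq_lagMk h, h0]
  simp [lagMk, polB_zero]

theorem lagA_le_filt1 : lagA ≤ filt1 := by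
  intro ω h
  rw [eq_lagMk h, lagMk]
  have hb : ∀ k : Fin 20, trip k 0 < 3 → basis3 k ∈ filt1 := by
    intro k hk
    refine Submodule.subset_span ⟨_, ?_, _, _, rfl⟩
    rw [mem_planeU]
    generalize trip k 0 = i at hk
    simp only [stdE]
    refine ⟨?_, ?_, ?_⟩ <;> apply Pi.single_eq_of_ne <;> rintro rfl <;> exact absurd hk (by decide)
  have ht : ∀ i j, trip (tix i j) 0 < 3 ∧ trip (tix i j).rev 0 < 3 := by decide
  exact add_mem (Submodule.smul_mem _ _ (hb _ (by decide))) (sum_mem fun i _ => sum_mem fun j _ =>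
    add_mem (Submodule.smul_mem _ _ (hb _ (ht i j).1)) (Submodule.smul_mem _ _ (hb _ (ht i j).2)))

section

variable {x : W6} (hx : x ∈ planeU) (v w : W6)
include hx

theorem co_nineteen_wedge3 : co 19 (wedge3 x v w) = 0 := by
  obtain ⟨h3, h4, h5⟩ := mem_planeU.1 hx
  simp [co_wedge3, minor3, trip, h3, h4, h5]

theorem tco_wedge3 :
    tco (wedge3 x v w) = fun i j => lo x i * crossProduct (hi v) (hi w) j := by
  obtain ⟨h3, h4, h5⟩ := mem_planeU.1 hx
  ext i j
  rw [tco_apply, co_wedge3]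
  fin_cases i <;> fin_cases j <;>
    simp [minor3, tix, trip, lo, hi, cross_apply, h3, h4, h5]

end

theorem stdE_mem_planeU : stdE 0 ∈ planeU ∧ stdE 1 ∈ planeU ∧ stdE 2 ∈ planeU := by
  refine ⟨?_, ?_, ?_⟩ <;> simp [mem_planeU, stdE]

theorem filt2_le : filt2 ≤ LinearMap.ker tco := by
  rw [filt2, Submodule.span_le]
  rintro _ ⟨p, hp, q, hq, r, rfl⟩
  rw [SetLike.mem_coe, LinearMap.mem_ker, tco_wedge3 hp, planeU_iff_hi.1 hq]
  ext i j
  simp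

theorem lagA_inf_filt2 : lagA ⊓ filt2 = filt3 := by
  apply le_antisymm
  · rintro ω ⟨h1, h2⟩
    rw [eq_smul_basis3_zero h1 (filt2_le h2)]
    exact Submodule.smul_mem _ _ (Submodule.subset_span
      ⟨_, stdE_mem_planeU.1, _, stdE_mem_planeU.2.1, _, stdE_mem_planeU.2.2, rfl⟩)
  · rw [filt3, Submodule.span_le]
    rintro _ ⟨p, hp, q, hq, r, hr, rfl⟩
    refine ⟨⟨wedge3_mem _ _ _, co_nineteen_wedge3 hp _ _, ?_⟩,
      Submodule.subset_span ⟨p, hp, q, hq, r, rfl⟩⟩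
    have : tco (wedge3 p q r) = 0 := by
      rw [tco_wedge3 hp, planeU_iff_hi.1 hq]
      ext i j
      simp
    rw [this, polB_zero]
    obtain ⟨h3, h4, h5⟩ := mem_planeU.1 hp
    obtain ⟨h3', h4', h5'⟩ := mem_planeU.1 hq
    obtain ⟨h3'', h4'', h5''⟩ := mem_planeU.1 hr
    ext i j
    rw [sco_apply, co_wedge3]
    fin_cases i <;> fin_cases j <;>
      simp [minor3, tix, trip, Fin.rev, h3, h4, h5, h3', h4', h5', h3'', h4'', h5'']

end

noncomputable section

/-! ## Three-dimensional subspaces and their wedge products -/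

/-- The span of three vectors. -/
def span3 (p q r : W6) : Submodule ℂ W6 := Submodule.span ℂ (Set.range ![p, q, r])

theorem mem_span3 {p q r z : W6} : z ∈ span3 p q r ↔ ∃ a b c : ℂ, a • p + b • q + c • r = z := by
  rw [span3, ← Submodule.mem_span_triple]
  congr! 2
  ext
  simp [eq_comm]
  tauto

theorem left_mem_span3 (p q r : W6) : p ∈ span3 p q r := Submodule.subset_span ⟨0, rfl⟩

theorem mid_mem_span3 (p q r : W6) : q ∈ span3 p q r := Submodule.subset_span ⟨1, rfl⟩

theorem right_mem_span3 (p q r : W6) : r ∈ span3 p q r := Submodule.subset_span ⟨2, rfl⟩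

theorem finrank_span3 {p q r : W6} (h : LinearIndependent ℂ ![p, q, r]) :
    Module.finrank ℂ (span3 p q r) = 3 := by
  rw [span3, finrank_span_eq_card h, Fintype.card_fin]

theorem linearIndependent_of_wedge3_ne_zero {p q r : W6} (h : wedge3 p q r ≠ 0) :
    LinearIndependent ℂ ![p, q, r] := by
  rw [wedge3_eq_ιMulti, Ne, ιMulti_eq_zero_iff, not_not] at h
  exact h

theorem exists_wedge3_eq_smul {a b c p q r : W6} (hp : p ∈ span3 a b c) (hq : q ∈ span3 a b c)
    (hr : r ∈ span3 a b c) : ∃ d : ℂ, wedge3 p q r = d • wedge3 a b c := by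
  obtain ⟨p0, p1, p2, rfl⟩ := mem_span3.1 hp
  obtain ⟨q0, q1, q2, rfl⟩ := mem_span3.1 hq
  obtain ⟨r0, r1, r2, rfl⟩ := mem_span3.1 hr
  refine ⟨!![p0, p1, p2; q0, q1, q2; r0, r1, r2].det, eq_of_co_eq (wedge3_mem _ _ _)
    (Submodule.smul_mem _ _ (wedge3_mem _ _ _)) fun k => ?_⟩
  rw [map_smul, co_wedge3, co_wedge3, Matrix.det_fin_three]
  simp [minor3]
  ring

theorem mem_span3_iff {p q r z : W6} (h : LinearIndependent ℂ ![p, q, r]) :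
    z ∈ span3 p q r ↔ ExteriorAlgebra.ι ℂ z * wedge3 p q r = 0 := by
  have : ExteriorAlgebra.ι ℂ z * wedge3 p q r = ExteriorAlgebra.ιMulti ℂ 4 ![z, p, q, r] := by
    simp [wedge3, mul_assoc, Matrix.vecTail]
  rw [this, ιMulti_eq_zero_iff]
  have := linearIndependent_finCons (K := ℂ) (x := z) (v := ![p, q, r])
  change LinearIndependent ℂ ![z, p, q, r] ↔ _ at this
  rw [this, span3]
  tauto

theorem span3_eq_of_wedge3_eq_smul {a b c p q r : W6} (h : LinearIndependent ℂ ![p, q, r])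
    (h' : LinearIndependent ℂ ![a, b, c]) {d : ℂ} (hd : wedge3 p q r = d • wedge3 a b c) :
    span3 p q r = span3 a b c := by
  have h0 : wedge3 p q r ≠ 0 := by
    rw [wedge3_eq_ιMulti]
    exact ExteriorAlgebra.ιMulti_ne_zero h
  have hd0 : d ≠ 0 := by
    rintro rfl
    exact h0 (by rw [hd, zero_smul])
  ext z
  rw [mem_span3_iff h, mem_span3_iff h', hd, mul_smul_comm, smul_eq_zero]
  simp [hd0]

theorem exists_span3_eq {P : Submodule ℂ W6} (hP : Module.finrank ℂ P = 3) {x : W6} (hx : x ∈ P)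
    (hx0 : x ≠ 0) : ∃ v w, LinearIndependent ℂ ![x, v, w] ∧ P = span3 x v w := by
  have step : ∀ {n : ℕ} (u : Fin n → W6), n < 3 → ∃ z ∈ P, z ∉ Submodule.span ℂ (Set.range u) := by
    intro n u hn
    by_contra! hc
    have h1 := Submodule.finrank_mono (show P ≤ Submodule.span ℂ (Set.range u) from hc)
    have h2 := finrank_range_le_card (R := ℂ) u
    rw [Set.finrank, Fintype.card_fin] at h2
    omega
  obtain ⟨w, hwP, hw⟩ := step ![x] (by norm_num)
  obtain ⟨v, hvP, hv⟩ := step ![w, x] (by norm_num)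
  have h1 : LinearIndependent ℂ ![x] := by simpa [linearIndependent_unique_iff] using hx0
  have h2 : LinearIndependent ℂ ![w, x] := linearIndependent_finCons.2 ⟨h1, hw⟩
  have h3 : LinearIndependent ℂ ![v, w, x] := linearIndependent_finCons.2 ⟨h2, hv⟩
  have h4 : wedge3 x v w ≠ 0 := by
    have := ExteriorAlgebra.ιMulti_ne_zero h3
    rw [← wedge3_eq_ιMulti, wedge3_swap_right, wedge3_swap_left, neg_neg] at this
    exact this
  have h5 := linearIndependent_of_wedge3_ne_zero h4
  refine ⟨v, w, h5, ?_⟩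
  refine (Submodule.eq_of_le_of_finrank_eq ?_ ((finrank_span3 h5).trans hP.symm)).symm
  rw [span3, Submodule.span_le]
  rintro _ ⟨i, rfl⟩
  fin_cases i
  exacts [hx, hvP, hwP]

theorem planeU_eq_span3 : planeU = span3 (stdE 0) (stdE 1) (stdE 2) := by
  ext z
  rw [mem_span3, planeU, Submodule.mem_span_triple]
  rfl

theorem wedge3_stdE : wedge3 (stdE 0) (stdE 1) (stdE 2) = basis3 0 := rfl

theorem linearIndependent_stdE : LinearIndependent ℂ ![stdE 0, stdE 1, stdE 2] := by
  apply linearIndependent_of_wedge3_ne_zero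
  rw [wedge3_stdE]
  intro h
  simpa [co_basis3] using congrArg (co 0) h

theorem finrank_planeU : Module.finrank ℂ planeU = 3 := by
  rw [planeU_eq_span3, finrank_span3 linearIndependent_stdE]

/-! ## The planes in `lagA` -/

/-- The coordinates of `v ∧ w` in the second exterior power of `ℂ⁶ / planeU`. -/
def hiCross (v w : W6) : Fin 3 → ℂ := crossProduct (hi v) (hi w)

/-- The factor two in `2 * vRam` cancels the one from differentiating the quadratic form of `polB`,
which leaves a contraction of `polB (x ⊗ y)`. -/
theorem vRamGradX_eq {R : Type} [CommRing R] (x y : Fin 3 → R) (i : Fin 3) :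
    vRamGradX x y i = ∑ j, polB (fun i j => x i * y j) i j * y j := by
  fin_cases i <;>
    simp [vRamGradX, conicA, conicB, gradConicA, gradConicB, polB, Fin.sum_univ_three] <;> ring

theorem vRamGradY_eq {R : Type} [CommRing R] (x y : Fin 3 → R) (j : Fin 3) :
    vRamGradY x y j = ∑ i, x i * polB (fun i j => x i * y j) i j := by
  fin_cases j <;>
    simp [vRamGradY, conicA, conicB, gradConicA, gradConicB, polB, Fin.sum_univ_three] <;> ring

theorem sco_wedge3 (p q r : W6) (i j : Fin 3) :
    sco (wedge3 p q r) i j = minor3 (trip (tix i j).rev) p q r := co_wedge3 _ _ _ _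

section

variable {x : W6} (hx : x ∈ planeU) (v w : W6)
include hx

/-- This component combines multiples of `hi v` and `hi w`, both orthogonal to their cross product.
-/
theorem sum_sco_wedge3_mul (i : Fin 3) : ∑ j, sco (wedge3 x v w) i j * hiCross v w j = 0 := by
  obtain ⟨h3, h4, h5⟩ := mem_planeU.1 hx
  simp only [sco_wedge3, Fin.sum_univ_three]
  fin_cases i <;>
    simp [minor3, tix, trip, Fin.rev, hiCross, hi, cross_apply, h3, h4, h5] <;> ring

theorem sum_mul_sco_wedge3 (j : Fin 3) : ∑ i, lo x i * sco (wedge3 x v w) i j = 0 := by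
  obtain ⟨h3, h4, h5⟩ := mem_planeU.1 hx
  simp only [sco_wedge3, Fin.sum_univ_three]
  fin_cases j <;> simp [minor3, tix, trip, Fin.rev, lo, h3, h4, h5] <;> ring

/-- The cofactors of the `sco` matrix, with indices modulo 3, are a multiple of `x ⊗ y`; the factor
is the coordinate on `⋀³ U`, which is therefore determined by the middle coordinates. -/
theorem co_zero_mul_tco_wedge3 (i j : Fin 3) :
    co 0 (wedge3 x v w) * tco (wedge3 x v w) i j =
      sco (wedge3 x v w) (i + 1) (j + 1) * sco (wedge3 x v w) (i + 2) (j + 2) -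
        sco (wedge3 x v w) (i + 1) (j + 2) * sco (wedge3 x v w) (i + 2) (j + 1) := by
  obtain ⟨h3, h4, h5⟩ := mem_planeU.1 hx
  simp only [sco_wedge3, tco_wedge3 hx, co_wedge3]
  fin_cases i <;> fin_cases j <;>
    simp [minor3, tix, trip, Fin.rev, lo, hi, cross_apply, h3, h4, h5] <;> ring

theorem tco_wedge3_eq : tco (wedge3 x v w) = fun i j => lo x i * hiCross v w j := tco_wedge3 hx v w

theorem lo_ne_zero (h0 : x ≠ 0) : lo x ≠ 0 := by
  intro h
  apply h0
  obtain ⟨h3, h4, h5⟩ := mem_planeU.1 hx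
  ext i
  fin_cases i
  exacts [congrFun h 0, congrFun h 1, congrFun h 2, h3, h4, h5]

variable {v w}

/-- In `lagA` the `sco` matrix is `polB (x ⊗ y)`, so its two contraction identities become the
vanishing of the gradient. -/
theorem vRamGrad_eq_zero (hA : wedge3 x v w ∈ lagA) :
    vRamGradX (lo x) (hiCross v w) = 0 ∧ vRamGradY (lo x) (hiCross v w) = 0 := by
  constructor
  · ext i
    rw [vRamGradX_eq, ← tco_wedge3_eq hx, ← hA.2.2, sum_sco_wedge3_mul hx, Pi.zero_apply]
  · ext j
    rw [vRamGradY_eq, ← tco_wedge3_eq hx, ← hA.2.2, sum_mul_sco_wedge3 hx, Pi.zero_apply]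

end

/-- Spanning vectors of the planes of `lagA` that meet `planeU` in a point. -/
def nodeVec : Fin 19 → Fin 3 → Fin 6 → ℤ :=
  ![![![1, 0, 0, 0, 0, 0], ![0, 0, 0, 0, 1, 0], ![0, 0, 0, 0, 0, 1]],
    ![![1, 0, 0, 0, 0, 0], ![0, 1, 0, 0, 0, 1], ![0, 0, 1, 1, 0, 0]],
    ![![1, 0, 0, 0, 0, 0], ![0, -1, 0, 1, 0, 0], ![0, 0, -1, 0, 1, 0]],
    ![![1, 0, 0, 0, 0, 0], ![0, 0, 1, 1, -1, 0], ![0, -1, -1, 0, 1, -1]],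
    ![![0, 1, 0, 0, 0, 0], ![0, 0, -1, 0, 1, 0], ![-1, 0, 0, 0, 0, 1]],
    ![![0, 1, 0, 0, 0, 0], ![0, 0, 0, 0, 0, 1], ![0, 0, 0, 1, 0, 0]],
    ![![0, 1, 0, 0, 0, 0], ![0, 0, 1, 1, 0, 0], ![1, 0, 0, 0, 1, 0]],
    ![![0, 1, 0, 0, 0, 0], ![0, 0, 1, 1, -1, 0], ![1, 0, 0, 0, 1, -1]],
    ![![0, 0, 1, 0, 0, 0], ![1, 0, 0, 0, 1, 0], ![0, 1, 0, 0, 0, 1]],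
    ![![0, 0, 1, 0, 0, 0], ![-1, 0, 0, 0, 0, 1], ![0, -1, 0, 1, 0, 0]],
    ![![0, 0, 1, 0, 0, 0], ![0, 0, 0, 1, 0, 0], ![0, 0, 0, 0, 1, 0]],
    ![![0, 0, 1, 0, 0, 0], ![-1, -1, 0, 1, -1, 0], ![1, 0, 0, 0, 1, -1]],
    ![![1, 1, 1, 0, 0, 0], ![0, 0, -1, 0, 1, 0], ![0, 1, 0, 0, 0, 1]],
    ![![1, 1, 1, 0, 0, 0], ![-1, 0, 0, 0, 0, 1], ![0, 0, 1, 1, 0, 0]],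
    ![![1, 1, 1, 0, 0, 0], ![0, -1, 0, 1, 0, 0], ![1, 0, 0, 0, 1, 0]],
    ![![1, 1, 1, 0, 0, 0], ![-1, -1, 1, 1, -1, 0], ![1, -1, -1, 0, 1, -1]],
    ![![1, 1, 0, 0, 0, 0], ![0, 0, -1, -1, 1, 0], ![-1, 0, 0, 0, 0, 1]],
    ![![0, 1, 1, 0, 0, 0], ![0, -1, 0, 1, 0, 0], ![1, 0, 0, 0, 1, -1]],
    ![![1, 0, 1, 0, 0, 0], ![0, 0, -1, 0, 1, 0], ![0, 1, 0, -1, 0, 1]]]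

/-- The planes of `lagA` that meet `planeU` in a point. -/
def nodePlane (k : Fin 19) : Submodule ℂ W6 :=
  span3 (intVec (nodeVec k 0)) (intVec (nodeVec k 1)) (intVec (nodeVec k 2))

/-- The Plücker vector of `nodePlane`. -/
def nodeWedge (k : Fin 19) : ExteriorAlgebra ℂ W6 :=
  wedge3 (intVec (nodeVec k 0)) (intVec (nodeVec k 1)) (intVec (nodeVec k 2))

theorem nodeVec_mem_planeU (k : Fin 19) : intVec (nodeVec k 0) ∈ planeU := by
  have h : nodeVec k 0 3 = 0 ∧ nodeVec k 0 4 = 0 ∧ nodeVec k 0 5 = 0 := by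
    revert k; decide
  simp [mem_planeU, intVec, h]

theorem lo_nodeVec (k : Fin 19) : lo (intVec (nodeVec k 0)) = intVec (vRamNodeX k) := by
  have h : lo (nodeVec k 0) = vRamNodeX k := by
    revert k; decide
  rw [← h]
  ext i
  fin_cases i <;> rfl

theorem hiCross_nodeVec (k : Fin 19) :
    hiCross (intVec (nodeVec k 1)) (intVec (nodeVec k 2)) = intVec (vRamNodeY k) := by
  have h : ![nodeVec k 1 4 * nodeVec k 2 5 - nodeVec k 1 5 * nodeVec k 2 4,
      nodeVec k 1 5 * nodeVec k 2 3 - nodeVec k 1 3 * nodeVec k 2 5,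
      nodeVec k 1 3 * nodeVec k 2 4 - nodeVec k 1 4 * nodeVec k 2 3] = vRamNodeY k := by
    revert k; decide
  rw [← h, hiCross, cross_apply]
  ext i
  fin_cases i <;> simp [hi, intVec]

theorem tco_nodeWedge (k : Fin 19) :
    tco (nodeWedge k) = fun i j => ((vRamNodeX k i * vRamNodeY k j : ℤ) : ℂ) := by
  rw [nodeWedge, tco_wedge3_eq (nodeVec_mem_planeU k), lo_nodeVec, hiCross_nodeVec]
  ext i j
  simp [intVec]

theorem nodeWedge_mem (k : Fin 19) : nodeWedge k ∈ lagA := by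
  refine ⟨wedge3_mem _ _ _, co_nineteen_wedge3 (nodeVec_mem_planeU k) _ _, ?_⟩
  have h : ∀ i j, minor3 (trip (tix i j).rev) (nodeVec k 0) (nodeVec k 1) (nodeVec k 2) =
      polB (fun i j => vRamNodeX k i * vRamNodeY k j) i j := by
    revert k; decide +kernel
  have h1 : ∀ (M : Fin 3 → Fin 3 → ℤ) (i j : Fin 3),
      polB (fun i j => (M i j : ℂ)) i j = ((polB M i j : ℤ) : ℂ) := by
    intro M i j
    fin_cases i <;> fin_cases j <;> simp [polB]
  ext i j
  rw [tco_nodeWedge, h1, ← h, nodeWedge, sco_wedge3]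
  simp [minor3, intVec]

theorem tco_nodeWedge_ne_zero (k : Fin 19) : tco (nodeWedge k) ≠ 0 := by
  have h : ∃ i j, vRamNodeX k i * vRamNodeY k j ≠ 0 := by
    revert k; decide
  obtain ⟨i, j, h⟩ := h
  intro h0
  rw [tco_nodeWedge] at h0
  exact h ((Int.cast_eq_zero (α := ℂ)).1 (congrFun (congrFun h0 i) j))

theorem linearIndependent_nodeVec (k : Fin 19) : LinearIndependent ℂ
    ![intVec (nodeVec k 0), intVec (nodeVec k 1), intVec (nodeVec k 2)] := by
  apply linearIndependent_of_wedge3_ne_zero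
  intro h
  exact tco_nodeWedge_ne_zero k (by rw [nodeWedge, h, map_zero])

/-- The singular point fixes `x ⊗ y` up to scale, `polB` then fixes the `sco` part, and the cofactor
identity fixes the coordinate on `⋀³ U`. -/
theorem wedge3_eq_smul_nodeWedge {x v w : W6} (hx : x ∈ planeU) (hx0 : x ≠ 0)
    (hy0 : hiCross v w ≠ 0) (hA : wedge3 x v w ∈ lagA) :
    ∃ (k : Fin 19) (c : ℂ), wedge3 x v w = c • nodeWedge k := by
  obtain ⟨h1, h2⟩ := vRamGrad_eq_zero hx hA
  obtain ⟨k, c, d, hc, hd, hX, hY⟩ := exists_vRamNode (lo_ne_zero hx hx0) hy0 h1 h2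
  have ht : tco (wedge3 x v w) = tco ((c * d) • nodeWedge k) := by
    rw [tco_wedge3_eq hx, map_smul, tco_nodeWedge, hX, hY]
    ext i j
    simp [intVec]
    ring
  have hA' : (c * d) • nodeWedge k ∈ lagA := Submodule.smul_mem _ _ (nodeWedge_mem k)
  have hs : sco (wedge3 x v w) = sco ((c * d) • nodeWedge k) := by rw [hA.2.2, hA'.2.2, ht]
  refine ⟨k, c * d, eq_of_coords_eq hA.1 hA'.1 ?_ ht hs (by rw [hA.2.1, hA'.2.1])⟩
  have h0 : tco ((c * d) • nodeWedge k) ≠ 0 := by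
    rw [map_smul]
    exact smul_ne_zero (mul_ne_zero hc hd) (tco_nodeWedge_ne_zero k)
  obtain ⟨i, hi⟩ := Function.ne_iff.1 h0
  obtain ⟨j, hij⟩ := Function.ne_iff.1 hi
  refine mul_right_cancel₀ hij ?_
  conv_lhs => rw [← ht]
  rw [co_zero_mul_tco_wedge3 hx, hs]
  simp only [map_smul, Pi.smul_apply, smul_eq_mul]
  have := co_zero_mul_tco_wedge3 (nodeVec_mem_planeU k) (intVec (nodeVec k 1))
    (intVec (nodeVec k 2)) i j
  rw [← nodeWedge] at this
  linear_combination (-(c * d) ^ 2) * this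

/-- The vanishing of the last coordinate on `lagA` is a vanishing determinant modulo `planeU`, so
some nonzero combination of the spanning vectors lies in `planeU`. -/
theorem exists_mem_planeU {P : Submodule ℂ W6} (hP : P ∈ planesIn lagA) :
    ∃ x ∈ P, x ∈ planeU ∧ x ≠ 0 := by
  obtain ⟨h3, hA⟩ := hP
  obtain ⟨x, hx, hx0⟩ := P.ne_bot_iff.1 (show P ≠ ⊥ by rintro rfl; simp at h3)
  obtain ⟨v, w, hli, rfl⟩ := exists_span3_eq h3 hx hx0
  have hw := hA x hx v (mid_mem_span3 _ _ _) w (right_mem_span3 _ _ _)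
  have hdet : (!![x 3, x 4, x 5; v 3, v 4, v 5; w 3, w 4, w 5]).det = 0 := by
    rw [← hw.2.1, co_wedge3, Matrix.det_fin_three]
    simp [minor3, trip]
    ring
  obtain ⟨c, hc0, hc⟩ := Matrix.exists_vecMul_eq_zero_iff.2 hdet
  refine ⟨c 0 • x + c 1 • v + c 2 • w, mem_span3.2 ⟨_, _, _, rfl⟩, mem_planeU.2 ⟨?_, ?_, ?_⟩, ?_⟩
  · simpa [Matrix.vecMul, dotProduct, Fin.sum_univ_three] using congrFun hc 0
  · simpa [Matrix.vecMul, dotProduct, Fin.sum_univ_three] using congrFun hc 1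
  · simpa [Matrix.vecMul, dotProduct, Fin.sum_univ_three] using congrFun hc 2
  · intro h
    apply hc0
    ext i
    exact Fintype.linearIndependent_iff.1 hli c (by simpa [Fin.sum_univ_three] using h) i

theorem wedge3_mem_of_span3 {a b c p q r : W6} (hA : wedge3 a b c ∈ lagA) (hp : p ∈ span3 a b c)
    (hq : q ∈ span3 a b c) (hr : r ∈ span3 a b c) : wedge3 p q r ∈ lagA := by
  obtain ⟨d, hd⟩ := exists_wedge3_eq_smul hp hq hr
  rw [hd]
  exact Submodule.smul_mem _ _ hA

theorem planeU_mem_planesIn : planeU ∈ planesIn lagA := by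
  refine ⟨finrank_planeU, ?_⟩
  rw [planeU_eq_span3]
  exact fun p hp q hq r hr => wedge3_mem_of_span3 basis3_zero_mem_lagA hp hq hr

theorem nodePlane_mem_planesIn (k : Fin 19) : nodePlane k ∈ planesIn lagA :=
  ⟨finrank_span3 (linearIndependent_nodeVec k), fun _ hp _ hq _ hr =>
    wedge3_mem_of_span3 (nodeWedge_mem k) hp hq hr⟩

theorem planesIn_lagA : planesIn lagA = insert planeU (Set.range nodePlane) := by
  apply Set.Subset.antisymm
  · intro P hP
    obtain ⟨x, hxP, hxU, hx0⟩ := exists_mem_planeU hP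
    obtain ⟨v, w, hli, rfl⟩ := exists_span3_eq hP.1 hxP hx0
    have hw := hP.2 x hxP v (mid_mem_span3 _ _ _) w (right_mem_span3 _ _ _)
    by_cases hy : hiCross v w = 0
    · left
      rw [planeU_eq_span3]
      refine span3_eq_of_wedge3_eq_smul hli linearIndependent_stdE
        (eq_smul_basis3_zero hw ?_)
      rw [tco_wedge3_eq hxU, hy]
      ext i j
      simp
    · right
      obtain ⟨k, c, hk⟩ := wedge3_eq_smul_nodeWedge hxU hx0 hy hw
      exact ⟨k, (span3_eq_of_wedge3_eq_smul hli (linearIndependent_nodeVec k) hk).symm⟩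
  · rintro P (rfl | ⟨k, rfl⟩)
    exacts [planeU_mem_planesIn, nodePlane_mem_planesIn k]

theorem nodePlane_injective : Function.Injective nodePlane := by
  intro k l h
  by_contra hkl
  have hm : ∀ {z}, z ∈ nodePlane k → z ∈ nodePlane l := fun hz => h ▸ hz
  obtain ⟨d, hd⟩ := exists_wedge3_eq_smul (hm (left_mem_span3 _ _ _)) (hm (mid_mem_span3 _ _ _))
    (hm (right_mem_span3 _ _ _))
  have ht := congrArg tco hd
  rw [map_smul, ← nodeWedge, ← nodeWedge, tco_nodeWedge, tco_nodeWedge] at ht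
  have key : ∀ k l : Fin 19, k ≠ l → ∃ i j i' j', (vRamNodeX k i * vRamNodeY k j) *
      (vRamNodeX l i' * vRamNodeY l j') ≠ (vRamNodeX k i' * vRamNodeY k j') *
      (vRamNodeX l i * vRamNodeY l j) := by
    decide +kernel
  obtain ⟨i, j, i', j', hne⟩ := key k l hkl
  have h1 := congrFun (congrFun ht i) j
  have h2 := congrFun (congrFun ht i') j'
  simp only [Pi.smul_apply, smul_eq_mul] at h1 h2
  apply hne
  have : ((vRamNodeX k i * vRamNodeY k j : ℤ) : ℂ) * ((vRamNodeX l i' * vRamNodeY l j' : ℤ) : ℂ) =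
      ((vRamNodeX k i' * vRamNodeY k j' : ℤ) : ℂ) * ((vRamNodeX l i * vRamNodeY l j : ℤ) : ℂ) := by
    rw [h1, h2]
    ring
  exact_mod_cast this

theorem planeU_notMem_range_nodePlane : planeU ∉ Set.range nodePlane := by
  rintro ⟨k, hk⟩
  have hm : intVec (nodeVec k 1) ∈ planeU := hk ▸ mid_mem_span3 _ _ _
  apply tco_nodeWedge_ne_zero k
  rw [nodeWedge, tco_wedge3_eq (nodeVec_mem_planeU k), hiCross, planeU_iff_hi.1 hm]
  ext i j
  simp

theorem ncard_planesIn_lagA : (planesIn lagA).ncard = 20 := by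
  rw [planesIn_lagA, Set.ncard_insert_of_notMem planeU_notMem_range_nodePlane (Set.finite_range _),
    ← Set.image_univ, Set.ncard_image_of_injective _ nodePlane_injective, Set.ncard_univ]
  simp

theorem lagA_eq_span : lagA = Submodule.span ℂ
    {e | ∃ P ∈ planesIn lagA, ∃ p ∈ P, ∃ q ∈ P, ∃ r ∈ P, e = wedge3 p q r} := by
  apply le_antisymm
  · intro ω hω
    -- The nine nodes with both points among the coordinate points give the elementary matrices; the
    -- Plücker vector of `planeU` supplies the remaining dimension.
    have hk : ∀ i j : Fin 3, ∃ k : Fin 19, ∀ i' j', vRamNodeX k i' * vRamNodeY k j' =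
        if i' = i ∧ j' = j then 1 else 0 := by
      decide +kernel
    choose k hk using hk
    have hA : ω - ∑ i, ∑ j, tco ω i j • nodeWedge (k i j) ∈ lagA :=
      sub_mem hω (sum_mem fun i _ => sum_mem fun j _ =>
        Submodule.smul_mem _ _ (nodeWedge_mem _))
    have h0 : tco (ω - ∑ i, ∑ j, tco ω i j • nodeWedge (k i j)) = 0 := by
      ext i' j'
      simp only [map_sub, map_sum, map_smul, tco_nodeWedge, hk, Pi.sub_apply, Finset.sum_apply,
        Pi.smul_apply, Pi.zero_apply]
      simp [ite_and]
    have := eq_smul_basis3_zero hA h0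
    rw [sub_eq_iff_eq_add] at this
    rw [this]
    refine add_mem (Submodule.smul_mem _ _ (Submodule.subset_span ⟨planeU, planeU_mem_planesIn, _,
      stdE_mem_planeU.1, _, stdE_mem_planeU.2.1, _, stdE_mem_planeU.2.2, rfl⟩))
      (sum_mem fun i _ => sum_mem fun j _ => Submodule.smul_mem _ _ (Submodule.subset_span
        ⟨_, nodePlane_mem_planesIn (k i j), _, left_mem_span3 _ _ _, _, mid_mem_span3 _ _ _, _,
          right_mem_span3 _ _ _, rfl⟩))
  · rw [Submodule.span_le]
    rintro _ ⟨P, hP, p, hp, q, hq, r, hr, rfl⟩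
    exact hP.2 p hp q hq r hr

end

noncomputable section

/-! ## The planes in `lagA` form a complete family of incident planes -/

theorem wedge3_mul_wedge3_eq_zero_iff {a b c p q r : W6} (h : LinearIndependent ℂ ![a, b, c])
    (h' : LinearIndependent ℂ ![p, q, r]) :
    wedge3 a b c * wedge3 p q r = 0 ↔ span3 a b c ⊓ span3 p q r ≠ ⊥ := by
  rw [wedge3_mul_wedge3, ιMulti_eq_zero_iff, 
    ← linearIndependent_equiv (finSumFinEquiv (m := 3) (n := 3))]
  have e : ![a, b, c, p, q, r] ∘ finSumFinEquiv (m := 3) (n := 3) =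
      Sum.elim ![a, b, c] ![p, q, r] := by
    ext i
    rcases i with i | i <;> fin_cases i <;> rfl
  rw [e, linearIndependent_sum]
  simp only [Sum.elim_comp_inl, Sum.elim_comp_inr, h, h', true_and, disjoint_iff]
  rfl

theorem wedge3_mul_wedge3_eq_zero {P Q : Submodule ℂ W6} (hP : Module.finrank ℂ P = 3)
    (hQ : Module.finrank ℂ Q = 3) (h : P ⊓ Q ≠ ⊥) {a b c p q r : W6} (ha : a ∈ P) (hb : b ∈ P)
    (hc : c ∈ P) (hp : p ∈ Q) (hq : q ∈ Q) (hr : r ∈ Q) : wedge3 a b c * wedge3 p q r = 0 := by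
  obtain ⟨x, hx, hx0⟩ := (Submodule.ne_bot_iff _).1 h
  obtain ⟨v, w, hli, rfl⟩ := exists_span3_eq hP hx.1 hx0
  obtain ⟨v', w', hli', rfl⟩ := exists_span3_eq hQ hx.2 hx0
  obtain ⟨d, hd⟩ := exists_wedge3_eq_smul ha hb hc
  obtain ⟨d', hd'⟩ := exists_wedge3_eq_smul hp hq hr
  rw [hd, hd', smul_mul_smul_comm, (wedge3_mul_wedge3_eq_zero_iff hli hli').2 h, smul_zero]

theorem mem_lagA_of_mul_wedge3_eq_zero {ω : ExteriorAlgebra ℂ W6} (hω : ω ∈ ⋀[ℂ]^3 W6)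
    (h : ∀ Q ∈ planesIn lagA, ∀ p ∈ Q, ∀ q ∈ Q, ∀ r ∈ Q, ω * wedge3 p q r = 0) : ω ∈ lagA := by
  refine mem_lagA_of_mul_eq_zero hω fun a ha => ?_
  rw [lagA_eq_span] at ha
  have hle : Submodule.span ℂ
      {e | ∃ P ∈ planesIn lagA, ∃ p ∈ P, ∃ q ∈ P, ∃ r ∈ P, e = wedge3 p q r} ≤
      LinearMap.ker (LinearMap.mulLeft ℂ ω) := by
    rw [Submodule.span_le]
    rintro _ ⟨P, hP, p, hp, q, hq, r, hr, rfl⟩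
    exact h P hP p hp q hq r hr
  exact hle ha

/-- Two planes meet exactly when their Plücker vectors are orthogonal, and the orthogonal of the
span of the family is `lagA` itself. -/
theorem mem_planesIn_lagA_iff (P : Submodule ℂ W6) : P ∈ planesIn lagA ↔
    Module.finrank ℂ P = 3 ∧ ∀ Q ∈ planesIn lagA, P ⊓ Q ≠ ⊥ := by
  constructor
  · intro hP
    refine ⟨hP.1, fun Q hQ => ?_⟩
    have hne : ∀ {P : Submodule ℂ W6}, Module.finrank ℂ P = 3 → ∃ x ∈ P, x ≠ 0 := fun h =>
      (Submodule.ne_bot_iff _).1 (by rintro rfl; simp at h)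
    obtain ⟨x, hx, hx0⟩ := hne hP.1
    obtain ⟨y, hy, hy0⟩ := hne hQ.1
    obtain ⟨v, w, hli, rfl⟩ := exists_span3_eq hP.1 hx hx0
    obtain ⟨v', w', hli', rfl⟩ := exists_span3_eq hQ.1 hy hy0
    rw [← wedge3_mul_wedge3_eq_zero_iff hli hli']
    exact isLagrangian_lagA.2.2 _ (hP.2 _ hx _ (mid_mem_span3 _ _ _) _ (right_mem_span3 _ _ _))
      _ (hQ.2 _ hy _ (mid_mem_span3 _ _ _) _ (right_mem_span3 _ _ _))
  · rintro ⟨h3, h⟩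
    refine ⟨h3, fun p hp q hq r hr => mem_lagA_of_mul_wedge3_eq_zero (wedge3_mem _ _ _)
      fun Q hQ p' hp' q' hq' r' hr' => ?_⟩
    exact wedge3_mul_wedge3_eq_zero h3 hQ.1 (h Q hQ) hp hq hr hp' hq' hr'

/-! ## Reducedness -/

theorem vRamHess_mulVec_inl {R : Type} [CommRing R] (x y x' y' : Fin 3 → R) (i : Fin 3) :
    (vRamHess x y).mulVec (Sum.elim x' y') (Sum.inl i) =
      ∑ j, (polB (fun i j => x' i * y j + x i * y' j) i j * y j +
        polB (fun i j => x i * y j) i j * y' j) := by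
  fin_cases i <;>
    simp [vRamHess, Matrix.mulVec, dotProduct, conicA, conicB, gradConicA, gradConicB, polB,
      Fin.sum_univ_three] <;> ring

theorem vRamHess_mulVec_inr {R : Type} [CommRing R] (x y x' y' : Fin 3 → R) (j : Fin 3) :
    (vRamHess x y).mulVec (Sum.elim x' y') (Sum.inr j) =
      ∑ i, (x i * polB (fun i j => x' i * y j + x i * y' j) i j +
        x' i * polB (fun i j => x i * y j) i j) := by
  fin_cases j <;>
    simp [vRamHess, Matrix.mulVec, dotProduct, conicA, conicB, gradConicA, gradConicB, polB,
      Fin.sum_univ_three] <;> ring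

section

variable {x X : W6} (hx : x ∈ planeU) (hX : X ∈ planeU) (v w Y Z : W6)
include hx hX

/-- The derivative of `sum_sco_wedge3_mul` along `(X, Y, Z)`. -/
theorem sum_sco_deriv_mul (i : Fin 3) :
    ∑ j, (sco (wedge3 X v w + wedge3 x Y w + wedge3 x v Z) i j * hiCross v w j +
      sco (wedge3 x v w) i j * (hiCross Y w + hiCross v Z) j) = 0 := by
  obtain ⟨h3, h4, h5⟩ := mem_planeU.1 hx
  obtain ⟨H3, H4, H5⟩ := mem_planeU.1 hX
  simp only [map_add, Pi.add_apply, sco_wedge3, Fin.sum_univ_three]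
  fin_cases i <;>
    simp [minor3, tix, trip, Fin.rev, hiCross, hi, cross_apply, h3, h4, h5, H3, H4, H5] <;> ring

theorem sum_mul_sco_deriv (j : Fin 3) :
    ∑ i, (lo x i * sco (wedge3 X v w + wedge3 x Y w + wedge3 x v Z) i j +
      lo X i * sco (wedge3 x v w) i j) = 0 := by
  obtain ⟨h3, h4, h5⟩ := mem_planeU.1 hx
  obtain ⟨H3, H4, H5⟩ := mem_planeU.1 hX
  simp only [map_add, Pi.add_apply, sco_wedge3, Fin.sum_univ_three]
  fin_cases j <;>
    simp [minor3, tix, trip, Fin.rev, lo, h3, h4, h5, H3, H4, H5] <;> ring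

theorem tco_deriv : tco (wedge3 X v w + wedge3 x Y w + wedge3 x v Z) =
    fun i j => lo X i * hiCross v w j + lo x i * (hiCross Y w + hiCross v Z) j := by
  ext i j
  rw [map_add, map_add, tco_wedge3_eq hX, tco_wedge3_eq hx, tco_wedge3_eq hx]
  simp
  ring

end

theorem stdE_apply (i j : Fin 6) : stdE i j = if j = i then 1 else 0 := Pi.single_apply i 1 j

theorem wedge3_swap_outer (p q r : W6) : wedge3 r q p = -wedge3 p q r := by
  rw [wedge3_swap_left q r p, wedge3_swap_right q p r, wedge3_swap_left p q r, neg_neg]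

theorem ι_mul_wedge3_swap (p q r s : W6) : ExteriorAlgebra.ι ℂ r * wedge3 q p s =
    -(ExteriorAlgebra.ι ℂ p * wedge3 q r s) := by
  have h := congrArg (· * ExteriorAlgebra.ι ℂ s) (wedge3_swap_outer p q r)
  simpa only [wedge3, mul_assoc, neg_mul] using h

theorem wedge3_self_left (p q : W6) : wedge3 p p q = 0 := by
  simp [wedge3]

theorem wedge3_self_right (p q : W6) : wedge3 p q q = 0 := by
  simp [wedge3, mul_assoc]

theorem ι_mul_wedge3_self (p q r : W6) : ExteriorAlgebra.ι ℂ q * wedge3 p q r = 0 := by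
  have h := congrArg (· * ExteriorAlgebra.ι ℂ r) (wedge3_swap_right q q p)
  simp only [wedge3_self_left] at h
  simpa [wedge3, mul_assoc] using h

theorem ι_mul_basis3_zero {u : W6} (hu : u ∈ planeU) : ExteriorAlgebra.ι ℂ u * basis3 0 = 0 := by
  rw [← wedge3_stdE, ← mem_span3_iff linearIndependent_stdE, ← planeU_eq_span3]
  exact hu

/-- A nonzero `Y ∧ x ∧ v ∧ w` is not killed by all of `planeU` when `v, w` are independent
modulo `planeU`. -/
theorem ι_mul_wedge3_eq_zero_of_forall {x v w Y : W6} (hy : hiCross v w ≠ 0)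
    (h : ∀ u ∈ planeU, ExteriorAlgebra.ι ℂ u * (ExteriorAlgebra.ι ℂ Y * wedge3 x v w) = 0) :
    ExteriorAlgebra.ι ℂ Y * wedge3 x v w = 0 := by
  have e4 : ExteriorAlgebra.ι ℂ Y * wedge3 x v w = ExteriorAlgebra.ιMulti ℂ 4 ![Y, x, v, w] := by
    simp [wedge3, mul_assoc, Matrix.vecTail]
  have e5 : ∀ u, ExteriorAlgebra.ι ℂ u * (ExteriorAlgebra.ι ℂ Y * wedge3 x v w) =
      ExteriorAlgebra.ιMulti ℂ 5 ![u, Y, x, v, w] := fun u => by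
    simp [wedge3, mul_assoc, Matrix.vecTail]
  by_contra hc
  rw [e4, ιMulti_eq_zero_iff, not_not] at hc
  have hU : ∀ u ∈ planeU, u ∈ Submodule.span ℂ (Set.range ![Y, x, v, w]) := by
    intro u hu
    by_contra hn
    have := h u hu
    rw [e5, ιMulti_eq_zero_iff] at this
    exact this (linearIndependent_finCons.2 ⟨hc, hn⟩)
  -- Completing `planeU`, `v`, `w` to a basis of `W` turns the count into six independent vectors
  -- inside a span of five.
  obtain ⟨z, hz⟩ : ∃ z : W6, wedge3 (stdE 0) (stdE 1) (stdE 2) * wedge3 z v w ≠ 0 := by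
    obtain ⟨j, hj⟩ := Function.ne_iff.1 hy
    refine ⟨stdE (![3, 4, 5] j), fun h0 => hj ?_⟩
    rw [wedge3_stdE, mul_eq_coords (basis3_mem 0) (wedge3_mem _ _ _)] at h0
    have := (smul_eq_zero.1 h0).resolve_right volW_ne_zero
    simp only [tco_apply, sco_apply, co_basis3, co_wedge3] at this
    fin_cases j <;>
      simpa [(tix_ne _ _).1.symm, (tix_ne _ _).2.1.symm, minor3, trip, stdE_apply, hiCross, hi,
        cross_apply] using this
  rw [wedge3_mul_wedge3, Ne, ιMulti_eq_zero_iff, not_not] at hz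
  have h1 : Submodule.span ℂ (Set.range ![stdE 0, stdE 1, stdE 2, z, v, w]) ≤
      Submodule.span ℂ (Set.range ![z, Y, x, v, w]) := by
    have hle : Submodule.span ℂ (Set.range ![Y, x, v, w]) ≤
        Submodule.span ℂ (Set.range ![z, Y, x, v, w]) := by
      refine Submodule.span_mono ?_
      rintro _ ⟨i, rfl⟩
      exact ⟨i.succ, rfl⟩
    rw [Submodule.span_le]
    rintro _ ⟨i, rfl⟩
    fin_cases i
    exacts [hle (hU _ stdE_mem_planeU.1), hle (hU _ stdE_mem_planeU.2.1),
      hle (hU _ stdE_mem_planeU.2.2), Submodule.subset_span ⟨0, rfl⟩,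
      Submodule.subset_span ⟨3, rfl⟩, Submodule.subset_span ⟨4, rfl⟩]
  have h2 := Submodule.finrank_mono h1
  have h3 := finrank_range_le_card (R := ℂ) ![z, Y, x, v, w]
  rw [finrank_span_eq_card hz, Fintype.card_fin] at h2
  rw [Set.finrank, Fintype.card_fin] at h3
  omega

/-- Multiplying by `v` removes the second term and makes `Y ∧ x ∧ v ∧ w` a multiple of `v ∧ ⋀³ U`,
which every vector of `planeU` kills. -/
theorem ι_mul_wedge3_eq_zero_of_add {x v w Y Z : W6} (hy : hiCross v w ≠ 0) {c : ℂ}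
    (h : wedge3 x Y w + wedge3 x v Z = c • basis3 0) :
    ExteriorAlgebra.ι ℂ Y * wedge3 x v w = 0 := by
  refine ι_mul_wedge3_eq_zero_of_forall hy fun u hu => ?_
  have h1 := congrArg (ExteriorAlgebra.ι ℂ v * ·) h
  simp only [mul_add, ι_mul_wedge3_self, add_zero, mul_smul_comm] at h1
  rw [ι_mul_wedge3_swap Y x v w, neg_eq_iff_eq_neg] at h1
  rw [h1, mul_neg, mul_smul_comm, ← mul_assoc,
    eq_neg_of_add_eq_zero_left (ExteriorAlgebra.ι_add_mul_swap u v), neg_mul, mul_assoc,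
    ι_mul_basis3_zero hu, mul_zero, neg_zero, smul_zero, neg_zero]

/-- The tangent space at a plane of `lagA` through a point of `planeU`. -/
theorem mem_span3_of_deriv_mem {x v w X Y Z : W6} (hx : x ∈ planeU)
    (hli : LinearIndependent ℂ ![x, v, w]) (hy : hiCross v w ≠ 0) (hA : wedge3 x v w ∈ lagA)
    (hX : X ∈ planeU) (hD : wedge3 X v w + wedge3 x Y w + wedge3 x v Z ∈ lagA) :
    X ∈ span3 x v w ∧ Y ∈ span3 x v w ∧ Z ∈ span3 x v w := by
  have hx0 : x ≠ 0 := hli.ne_zero 0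
  obtain ⟨h1, h2⟩ := vRamGrad_eq_zero hx hA
  -- Differentiating the gradient equations along the deformation shows that its effect on `(x, y)`
  -- lies in the kernel of the Hessian; the node then allows only rescaling.
  have hH : (vRamHess (lo x) (hiCross v w)).mulVec
      (Sum.elim (lo X) (hiCross Y w + hiCross v Z)) = 0 := by
    ext i
    rcases i with i | j
    · rw [vRamHess_mulVec_inl, ← tco_deriv hx hX, ← hD.2.2, ← tco_wedge3_eq hx, ← hA.2.2]
      exact sum_sco_deriv_mul hx hX v w Y Z i
    · rw [vRamHess_mulVec_inr, ← tco_deriv hx hX, ← hD.2.2, ← tco_wedge3_eq hx, ← hA.2.2]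
      exact sum_mul_sco_deriv hx hX v w Y Z j
  obtain ⟨⟨c, hc⟩, d, hd⟩ := eq_smul_of_vRamHess_mulVec (lo_ne_zero hx hx0) hy h1 h2 hH
  have hXx : X = c • x := by
    obtain ⟨h3, h4, h5⟩ := mem_planeU.1 hx
    obtain ⟨H3, H4, H5⟩ := mem_planeU.1 hX
    ext i
    fin_cases i
    exacts [congrFun hc 0, congrFun hc 1, congrFun hc 2, by simp [h3, H3], by simp [h4, H4],
      by simp [h5, H5]]
  -- Removing the rescalings leaves an element of `lagA` with zero `tco` part, hence a multiple of
  -- `basis3 0`.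
  have hE : wedge3 x Y w + wedge3 x v (Z - d • w) = wedge3 X v w + wedge3 x Y w + wedge3 x v Z -
      (c + d) • wedge3 x v w := by
    rw [hXx]
    simp [wedge3, mul_sub, add_smul]
    abel
  have hEA : wedge3 x Y w + wedge3 x v (Z - d • w) ∈ lagA := by
    rw [hE]
    exact sub_mem hD (Submodule.smul_mem _ _ hA)
  have hE0 : tco (wedge3 x Y w + wedge3 x v (Z - d • w)) = 0 := by
    rw [hE, map_sub, map_smul, tco_deriv hx hX, hc, hd, tco_wedge3_eq hx]
    ext i j
    simp
    ring
  have hE' := eq_smul_basis3_zero hEA hE0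
  refine ⟨mem_span3.2 ⟨c, 0, 0, by simp [hXx]⟩,
    (mem_span3_iff hli).2 (ι_mul_wedge3_eq_zero_of_add hy hE'), ?_⟩
  have hy' : hiCross w v ≠ 0 := by
    rw [hiCross, ← cross_anticomm]
    exact neg_ne_zero.2 hy
  have hE'' : wedge3 x (Z - d • w) v + wedge3 x w Y =
      (-co 0 (wedge3 x Y w + wedge3 x v (Z - d • w))) • basis3 0 := by
    rw [neg_smul, ← hE', wedge3_swap_right x v, wedge3_swap_right x Y]
    abel
  have hZ := ι_mul_wedge3_eq_zero_of_add hy' hE''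
  rw [wedge3_swap_right, mul_neg, neg_eq_zero, ← mem_span3_iff hli] at hZ
  have := add_mem hZ (Submodule.smul_mem _ d (right_mem_span3 x v w))
  rwa [sub_add_cancel] at this

/-- The last coordinate of the derivative vanishes, so `X` lies in the span of `planeU`, `v` and
`w`. Subtracting its part along `v` and `w`, found by Cramer's rule, does not change the derivative.
-/
theorem mem_span3_of_deriv_mem' {x v w X Y Z : W6} (hx : x ∈ planeU)
    (hli : LinearIndependent ℂ ![x, v, w]) (hy : hiCross v w ≠ 0) (hA : wedge3 x v w ∈ lagA)
    (hD : wedge3 X v w + wedge3 x Y w + wedge3 x v Z ∈ lagA) :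
    X ∈ span3 x v w ∧ Y ∈ span3 x v w ∧ Z ∈ span3 x v w := by
  obtain ⟨h3, h4, h5⟩ := mem_planeU.1 hx
  have h19 : X 3 * hiCross v w 0 + X 4 * hiCross v w 1 + X 5 * hiCross v w 2 = 0 := by
    have := hD.2.1
    simp only [map_add, co_wedge3] at this
    simp [minor3, trip, h3, h4, h5] at this
    simp [hiCross, hi, cross_apply]
    linear_combination this
  obtain ⟨j, hj⟩ := Function.ne_iff.1 hy
  obtain ⟨a, b, hab⟩ : ∃ a b : ℂ, X - (a • v + b • w) ∈ planeU := by
    refine ⟨hiCross X w j / hiCross v w j, hiCross v X j / hiCross v w j, mem_planeU.2 ?_⟩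
    have key : ∀ (m : Fin 6) (n : ℂ), X m * hiCross v w j - (hiCross X w j * v m +
        hiCross v X j * w m) = 0 →
        (X - ((hiCross X w j / hiCross v w j) • v + (hiCross v X j / hiCross v w j) • w)) m =
          0 := by
      intro m n h
      simp only [Pi.sub_apply, Pi.add_apply, Pi.smul_apply, smul_eq_mul]
      have hj' : hiCross v w j ≠ 0 := hj
      field_simp
      linear_combination h
    refine ⟨key 3 0 ?_, key 4 0 ?_, key 5 0 ?_⟩ <;> fin_cases j <;>
      simp [hiCross, hi, cross_apply] at h19 ⊢ <;> first | ring1 | linear_combination h19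
  have hE : wedge3 (X - (a • v + b • w)) v w + wedge3 x Y w + wedge3 x v Z =
      wedge3 X v w + wedge3 x Y w + wedge3 x v Z := by
    have h1 := wedge3_self_left v w
    have h2 : wedge3 w v w = 0 := by rw [wedge3_swap_left, wedge3_self_right, neg_zero]
    have h4 : wedge3 (X - (a • v + b • w)) v w =
        wedge3 X v w - (a • wedge3 v v w + b • wedge3 w v w) := by
      simp [wedge3, sub_mul, add_mul]
    rw [h4, h1, h2]
    simp
  rw [← hE] at hD
  obtain ⟨h1, h2⟩ := mem_span3_of_deriv_mem hx hli hy hA hab hD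
  refine ⟨?_, h2⟩
  have := add_mem h1 (mem_span3.2 ⟨0, a, b, rfl⟩)
  simpa using this

/-- At `planeU` the derivative has zero `tco` part, so its `sco` part, which lists the last three
coordinates of `X, Y, Z`, is `polB 0 = 0`. -/
theorem mem_planeU_of_deriv_mem {X Y Z : W6}
    (hD : wedge3 X (stdE 1) (stdE 2) + wedge3 (stdE 0) Y (stdE 2) +
      wedge3 (stdE 0) (stdE 1) Z ∈ lagA) : X ∈ planeU ∧ Y ∈ planeU ∧ Z ∈ planeU := by
  have ht : tco (wedge3 X (stdE 1) (stdE 2) + wedge3 (stdE 0) Y (stdE 2) +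
      wedge3 (stdE 0) (stdE 1) Z) = 0 := by
    ext i j
    simp only [map_add, tco_apply, co_wedge3]
    fin_cases i <;> fin_cases j <;> simp [minor3, trip, tix, stdE_apply]
  have hs := hD.2.2
  rw [ht, polB_zero] at hs
  have hs' : ∀ i j, minor3 (trip (tix i j).rev) X (stdE 1) (stdE 2) +
      minor3 (trip (tix i j).rev) (stdE 0) Y (stdE 2) +
      minor3 (trip (tix i j).rev) (stdE 0) (stdE 1) Z = 0 := fun i j => by
    simpa only [map_add, Pi.add_apply, sco_wedge3, Pi.zero_apply] using congrFun (congrFun hs i) j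
  simp only [mem_planeU]
  refine ⟨⟨?_, ?_, ?_⟩, ⟨?_, ?_, ?_⟩, ⟨?_, ?_, ?_⟩⟩
  · simpa [minor3, trip, tix, stdE_apply, Fin.rev] using hs' 0 0
  · simpa [minor3, trip, tix, stdE_apply, Fin.rev] using hs' 0 1
  · simpa [minor3, trip, tix, stdE_apply, Fin.rev] using hs' 0 2
  · simpa [minor3, trip, tix, stdE_apply, Fin.rev] using hs' 1 0
  · simpa [minor3, trip, tix, stdE_apply, Fin.rev] using hs' 1 1
  · simpa [minor3, trip, tix, stdE_apply, Fin.rev] using hs' 1 2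
  · simpa [minor3, trip, tix, stdE_apply, Fin.rev] using hs' 2 0
  · simpa [minor3, trip, tix, stdE_apply, Fin.rev] using hs' 2 1
  · simpa [minor3, trip, tix, stdE_apply, Fin.rev] using hs' 2 2

theorem map_mem_span3 {a b c : W6} (τ : span3 a b c →ₗ[ℂ] W6)
    (ha : τ ⟨a, left_mem_span3 _ _ _⟩ ∈ span3 a b c)
    (hb : τ ⟨b, mid_mem_span3 _ _ _⟩ ∈ span3 a b c)
    (hc : τ ⟨c, right_mem_span3 _ _ _⟩ ∈ span3 a b c) (p : span3 a b c) : τ p ∈ span3 a b c := by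
  obtain ⟨r, s, t, h⟩ := mem_span3.1 p.2
  have : p = r • ⟨a, left_mem_span3 _ _ _⟩ + s • ⟨b, mid_mem_span3 _ _ _⟩ +
      t • ⟨c, right_mem_span3 _ _ _⟩ := Subtype.ext h.symm
  rw [this, map_add, map_add, map_smul, map_smul, map_smul]
  exact add_mem (add_mem (Submodule.smul_mem _ _ ha) (Submodule.smul_mem _ _ hb))
    (Submodule.smul_mem _ _ hc)

theorem isFiniteMorinConfiguration_planesIn_lagA :
    IsFiniteMorinConfiguration (planesIn lagA) := by
  refine ⟨?_, mem_planesIn_lagA_iff, ?_⟩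
  · rw [planesIn_lagA]
    exact (Set.finite_range _).insert _
  · intro P hP
    -- Tangency to every Schubert divisor says that the derivative of the Plücker vector is
    -- orthogonal to `lagA`, hence lies in it.
    have hD : ∀ τ : P →ₗ[ℂ] W6, (∀ Q ∈ planesIn lagA, ∀ p₁ p₂ p₃ : P, ∀ q₁ ∈ Q, ∀ q₂ ∈ Q,
        ∀ q₃ ∈ Q, (wedge3 (τ p₁) p₂ p₃ + wedge3 p₁ (τ p₂) p₃ + wedge3 p₁ p₂ (τ p₃)) *
          wedge3 q₁ q₂ q₃ = 0) → ∀ p₁ p₂ p₃ : P,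
        wedge3 (τ p₁) p₂ p₃ + wedge3 p₁ (τ p₂) p₃ + wedge3 p₁ p₂ (τ p₃) ∈ lagA := by
      intro τ h p₁ p₂ p₃
      exact mem_lagA_of_mul_wedge3_eq_zero
        (add_mem (add_mem (wedge3_mem _ _ _) (wedge3_mem _ _ _)) (wedge3_mem _ _ _))
        fun Q hQ q₁ h₁ q₂ h₂ q₃ h₃ => h Q hQ p₁ p₂ p₃ q₁ h₁ q₂ h₂ q₃ h₃
    rw [planesIn_lagA] at hP
    intro τ h
    replace hD := hD τ h
    clear h
    rcases hP with rfl | ⟨k, rfl⟩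
    · revert τ
      rw [planeU_eq_span3]
      intro τ hD
      obtain ⟨h1, h2, h3⟩ := mem_planeU_of_deriv_mem (hD ⟨_, left_mem_span3 _ _ _⟩
        ⟨_, mid_mem_span3 _ _ _⟩ ⟨_, right_mem_span3 _ _ _⟩)
      rw [planeU_eq_span3] at h1 h2 h3
      exact map_mem_span3 τ h1 h2 h3
    · obtain ⟨h1, h2, h3⟩ := mem_span3_of_deriv_mem' (nodeVec_mem_planeU k)
        (linearIndependent_nodeVec k)
        (by rw [hiCross_nodeVec]; exact intVec_ne_zero (vRamNode_ne_zero k).2) (nodeWedge_mem k)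
        (hD ⟨_, left_mem_span3 _ _ _⟩ ⟨_, mid_mem_span3 _ _ _⟩ ⟨_, right_mem_span3 _ _ _⟩)
      exact map_mem_span3 τ h1 h2 h3

/-! ### The equation of the V-threefold and the assembly -/

theorem isThreefoldOf_lagA : IsThreefoldOf lagA vRam := by
  -- The constant is `2` because the quadratic form of `polB` is `2 * vRam` on rank-one matrices.
  -- The congruence only fixes the `tco` part of `a`, which suffices: the `sco` part of `x ∧ v ∧ w`
  -- pairs to zero with its own `tco` part.
  refine ⟨2, two_ne_zero, fun x hx v w a ha h => ?_⟩
  have ht : tco a = tco (wedge3 x v w) := by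
    have := filt2_le h
    rwa [LinearMap.mem_ker, map_sub, sub_eq_zero] at this
  rw [mul_eq_coords (wedge3_mem _ _ _) ha.1, ha.2.1, co_nineteen_wedge3 hx, ha.2.2, ht]
  congr 1
  have hs : ∑ i, ∑ j, sco (wedge3 x v w) i j * tco (wedge3 x v w) i j = 0 := by
    refine Finset.sum_eq_zero fun i _ => ?_
    have := sum_sco_wedge3_mul hx v w i
    rw [tco_wedge3_eq hx, ← mul_zero (lo x i), ← this, Finset.mul_sum]
    exact Finset.sum_congr rfl fun j _ => by ring
  simp only [Finset.sum_sub_distrib, hs]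
  rw [tco_wedge3_eq hx]
  change _ = 2 * eval (Sum.elim (lo x) (hiCross v w)) vRam
  rw [eval_vRam]
  simp [Fin.sum_univ_three, polB]
  ring

theorem isAttachedTo20Planes_vRam : IsAttachedTo20Planes vRam :=
  ⟨lagA, planesIn lagA, isLagrangian_lagA, lagA_le_filt1, lagA_inf_filt2, rfl,
    planeU_mem_planesIn, ncard_planesIn_lagA, isFiniteMorinConfiguration_planesIn_lagA,
    lagA_eq_span, isThreefoldOf_lagA⟩

end

theorem mainTheorem7 :
    -- `V^ram` is a threefold of bidegree `(2, 2)` with exactly 19 singular points, all nodes,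
    -- attached to a Morin configuration of 20 planes
    vRam ∈ biForms 2 2 ∧ (biSing vRam).ncard = 19 ∧ (∀ p ∈ biSing vRam, IsBiNode vRam p) ∧
    IsAttachedTo20Planes vRam ∧
    -- `|𝓘(1,1)|` has dimension 4; `φ`, in any homogeneous coordinates of `ℙ⁴`, has degree 2,
    -- ramification divisor `V^ram`, and maps `V^ram` onto the Igusa quartic
    Module.finrank ℂ formsThroughO4 = 5 ∧
    ∀ b : Module.Basis (Fin 5) ℂ formsThroughO4,
      HasDegreeTwo (fun k => (b k : BiPoly)) ∧
      IsRamificationDivisor (fun k => (b k : BiPoly)) vRam ∧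
      IsIgusaQuartic (imageOfHypersurface (fun k => (b k : BiPoly)) vRam) := by
  refine ⟨vRam_mem_biForms, ncard_biSing_vRam, fun _ => isBiNode_vRam,
    isAttachedTo20Planes_vRam, finrank_formsThroughO4, fun b => ?_⟩
  obtain ⟨M, hM, hb⟩ := exists_matrix_of_basis b
  exact ⟨hasDegreeTwo_of_matrix hM hb, isRamificationDivisor_vRam hM hb,
    isIgusaQuartic_imageOfHypersurface hM hb⟩
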